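/- \textbf{Setting.} A circuit $\mathcal C$ on $n\ge 1$ qubits is a finite list of $m$ gates, each a unitary of any size applied to a set of distinct qubits; $U$ is the unitary it implements. For $j\in[n]$ the lightcone $\mathcal L(j)$ is the smallest subset of $[n]$ that contains $j$ and such that $U^\dagger A U$ acts nontrivially only on $\mathcal L(j)$ for every operator $A$ on qubit $j$; $\mathcal L(S)=\bigcup_{j\in S}\mathcal L(j)$; and $\mathcal L_{\leftarrow}$ is defined in the same way with $U^\dagger$ in place of $U$. For $c\ge 1$, $\mathcal L(j,c)$ and $\mathcal L_{\leftarrow}(j,c)$ are obtained from $\{j\}$ by applying alternately $c$ of these maps, beginning with $\mathcal L$ and with $\mathcal L_{\leftarrow}$ respectively, and $\ell_c=\max_{j}\max\{|\mathcal L(j,c)|,|\mathcal L_{\leftarrow}(j,c)|\}$. Let $\hat\ell_1\ge\ell_1$ be the maximum size of the lightcone of a single qubit in the layout of $\mathcal C$: one starts from $\{j\}$, follows the gates from the last to the first (or from the first to the last), and adds all qubits of a gate whenever the gate touches the current set. (For a circuit of depth $d$ composed of two-qubit gates, $\hat\ell_1\le 2^d$.) The model of computation is a random access machine with unit-cost exact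 arithmetic and comparison on real numbers (complex numbers being pairs of reals) and with unit-cost addition, subtraction and comparison of natural numbers. \textbf{Theorem.} For every constant $\beta>1$ there are a constant $C$ and one deterministic program such that the following holds. The program takes as input $n\ge 1$, a circuit $\mathcal C$ with $m$ gates on $n$ qubits, a real number $\delta>0$ and single-qubit operators $O_1,\dots,O_n$ with $$\|O_j-I\|\le\frac{1}{60\,\beta\,\ell_1\,\ell_4}\qquad\text{for all } j$$ (operator norm; the $O_j$ need not be Hermitian). It halts and outputs a complex number $\tilde\mu$ that approximates $\mu=\langle 0^n|U^\dagger (O_1\otimes\cdots\otimes O_n) U|0^n\rangle$ with multiplicative error $\delta$: $\mu$ and $\tilde\mu$ are nonzero, and for suitable branches of the logarithms $$|\log\mu-\log\tilde\mu|\le\delta .$$ Its running time is at most $(m+1)\,\bigl(2n/\min(\delta,1)\bigr)^{C\hat\ell_1}$. In particular, it is $(n\delta^{-1})^{\mathcal O(\hat\ell_1)}$ for $n\ge 2$, $\delta\le 1$ and circuits with $\mathrm{poly}(n)$ gates. -/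

import Mathlib

open scoped Matrix

noncomputable section

namespace MeanValue

/-! ## Qubits, operators, circuits -/

/-- Labels of the standard basis of `n` qubits. -/
abbrev Bits (n : ℕ) : Type := Fin n → Bool

/-- Operators on `n` qubits, as matrices in the standard basis. -/
abbrev Op (n : ℕ) : Type := Matrix (Bits n) (Bits n) ℂ

/-- `A` acts nontrivially only on the qubits in `S`: it is `B ⊗ I` for an operator `B` on the
qubits in `S`. -/
def ActsOn {n : ℕ} (S : Finset (Fin n)) (A : Op n) : Prop :=
  ∃ B : Matrix (S → Bool) (S → Bool) ℂ, ∀ x y : Bits n,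
    A x y = if ∀ k, k ∉ S → x k = y k then B (fun k => x k) (fun k => y k) else 0

/-- The tensor product of the single-qubit operators `O j`. -/
def tensor {n : ℕ} (O : Fin n → Matrix Bool Bool ℂ) : Op n :=
  Matrix.of fun x y => ∏ j, O j (x j) (y j)

/-- A gate: a unitary `mat` applied to the listed (distinct) qubits, any number of them. -/
structure Gate (n : ℕ) where
  arity : ℕ
  qubits : Fin arity ↪ Fin n
  mat : Matrix (Bits arity) (Bits arity) ℂ
  unitary : mat ∈ Matrix.unitaryGroup (Bits arity) ℂ

/-- The gate as an operator on all `n` qubits. -/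
def Gate.toOp {n : ℕ} (g : Gate n) : Op n :=
  Matrix.of fun x y =>
    if ∀ k, k ∉ Set.range g.qubits → x k = y k
    then g.mat (fun i => x (g.qubits i)) (fun i => y (g.qubits i)) else 0

/-- The qubits on which a gate is placed. -/
def Gate.support {n : ℕ} (g : Gate n) : Finset (Fin n) := Finset.univ.map g.qubits

/-- A circuit is the list of its gates; the head of the list is applied first. -/
abbrev Circuit (n : ℕ) : Type := List (Gate n)

/-- The unitary that a circuit implements. -/
def Circuit.toOp {n : ℕ} : Circuit n → Op n
  | [] => 1
  | g :: gs => Circuit.toOp gs * g.toOp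

/-- The mean value `⟨0ⁿ| U† O U |0ⁿ⟩`. -/
def meanValue {n : ℕ} (U O : Op n) : ℂ :=
  (Uᴴ * O * U) (fun _ => false) (fun _ => false)

/-! ## Lightcones -/

open scoped Classical in
/-- The lightcone of qubit `j` under the unitary `U`: the smallest set of qubits that contains `j`
and such that `U† A U` acts on this set for each operator `A` on qubit `j`
(the intersection of all sets with the two properties). -/
def lightcone {n : ℕ} (U : Op n) (j : Fin n) : Finset (Fin n) :=
  Finset.univ.filter fun k => ∀ T : Finset (Fin n), j ∈ T →
    (∀ A : Op n, ActsOn {j} A → ActsOn T (Uᴴ * A * U)) → k ∈ T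

/-- `S` enlarged by the support of the gate `g` if `g` touches `S`. -/
def Gate.spread {n : ℕ} (g : Gate n) (S : Finset (Fin n)) : Finset (Fin n) :=
  if (g.support ∩ S).Nonempty then S ∪ g.support else S

/-- The set of qubits reached from `S` when the gates are followed from the last to the first:
the lightcone that is read off from the layout of the circuit. -/
def Circuit.cone {n : ℕ} : Circuit n → Finset (Fin n) → Finset (Fin n)
  | [], S => S
  | g :: gs, S => g.spread (Circuit.cone gs S)

/-- The `c`-fold alternating lightcone `… F (B (F S))`, the innermost map being `F`, where `F` and
`B` give the forward and backward lightcones of single qubits. -/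
def iterCone {n : ℕ} (F B : Fin n → Finset (Fin n)) : ℕ → Finset (Fin n) → Finset (Fin n)
  | 0, S => S
  | c + 1, S => iterCone B F c (S.biUnion F)

/-- The largest size of a `c`-fold iterated lightcone, forward or backward, of a single qubit. -/
def maxCone {n : ℕ} (F B : Fin n → Finset (Fin n)) (c : ℕ) : ℕ :=
  Finset.univ.sup fun j => max (iterCone F B c {j}).card (iterCone B F c {j}).card

/-- The maximum iterated lightcone size `ℓ_c` of a unitary `U`. -/
def ell {n : ℕ} (U : Op n) (c : ℕ) : ℕ :=
  maxCone (lightcone U) (lightcone Uᴴ) c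

/-- The maximum size of a forward or backward lightcone of one qubit in the layout of a circuit
(following the gates in reverse order gives the lightcones of the inverse circuit). -/
def Circuit.ellOne {n : ℕ} (K : Circuit n) : ℕ :=
  maxCone (fun j => K.cone {j}) (fun j => Circuit.cone K.reverse {j}) 1

/-! ## Random access machine with exact arithmetic

Memory consists of arrays of natural numbers and arrays of complex numbers. Unit cost is charged for
a memory access, an addition or truncated subtraction or comparison of natural numbers, and an exact
field operation, conjugation or comparison of real parts of complex numbers. A complex number can be
kept as two real numbers, so this is the usual real random access machine up to constant factors.
There is no rounding and no conversion from complex to natural numbers. -/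

/-- Contents of the memory: the entry `i` of the array `a` is `nat a i` or `cpx a i`. -/
structure Mem where
  nat : ℕ → ℕ → ℕ
  cpx : ℕ → ℕ → ℂ

def Mem.setNat (s : Mem) (a i v : ℕ) : Mem :=
  { s with nat := Function.update s.nat a (Function.update (s.nat a) i v) }

def Mem.setCpx (s : Mem) (a i : ℕ) (v : ℂ) : Mem :=
  { s with cpx := Function.update s.cpx a (Function.update (s.cpx a) i v) }

/-- Expressions for natural numbers; `get a i` reads the entry `i` of the array `a`. -/
inductive NExpr where
  | const (k : ℕ)
  | get (a : ℕ) (i : NExpr)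
  | add (e f : NExpr)
  | sub (e f : NExpr)

def NExpr.eval (s : Mem) : NExpr → ℕ
  | .const k => k
  | .get a i => s.nat a (i.eval s)
  | .add e f => e.eval s + f.eval s
  | .sub e f => e.eval s - f.eval s

def NExpr.cost : NExpr → ℕ
  | .const _ => 1
  | .get _ i => i.cost + 1
  | .add e f => e.cost + f.cost + 1
  | .sub e f => e.cost + f.cost + 1

/-- Expressions for complex numbers. -/
inductive CExpr where
  | ofNat (e : NExpr)
  | imag
  | get (a : ℕ) (i : NExpr)
  | add (z w : CExpr)
  | sub (z w : CExpr)
  | mul (z w : CExpr)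
  | div (z w : CExpr)
  | conj (z : CExpr)

def CExpr.eval (s : Mem) : CExpr → ℂ
  | .ofNat e => (e.eval s : ℂ)
  | .imag => Complex.I
  | .get a i => s.cpx a (i.eval s)
  | .add z w => z.eval s + w.eval s
  | .sub z w => z.eval s - w.eval s
  | .mul z w => z.eval s * w.eval s
  | .div z w => z.eval s / w.eval s
  | .conj z => (starRingEnd ℂ) (z.eval s)

def CExpr.cost : CExpr → ℕ
  | .ofNat e => e.cost + 1
  | .imag => 1
  | .get _ i => i.cost + 1
  | .add z w => z.cost + w.cost + 1
  | .sub z w => z.cost + w.cost + 1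
  | .mul z w => z.cost + w.cost + 1
  | .div z w => z.cost + w.cost + 1
  | .conj z => z.cost + 1

/-- Tests; `reLt` compares real parts. -/
inductive Test where
  | natLt (e f : NExpr)
  | reLt (z w : CExpr)
  | not (b : Test)
  | and (b c : Test)

def Test.holds (s : Mem) : Test → Prop
  | .natLt e f => e.eval s < f.eval s
  | .reLt z w => (z.eval s).re < (w.eval s).re
  | .not b => ¬ b.holds s
  | .and b c => b.holds s ∧ c.holds s

def Test.cost : Test → ℕ
  | .natLt e f => e.cost + f.cost + 1
  | .reLt z w => z.cost + w.cost + 1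
  | .not b => b.cost + 1
  | .and b c => b.cost + c.cost + 1

/-- Programs. -/
inductive Prog where
  | skip
  | setNat (a : ℕ) (i e : NExpr)
  | setCpx (a : ℕ) (i : NExpr) (z : CExpr)
  | seq (p q : Prog)
  | ite (b : Test) (p q : Prog)
  | while (b : Test) (p : Prog)

/-- `Exec p s t s'`: the program `p`, started with memory `s`, halts after `t` steps with
memory `s'`. -/
inductive Exec : Prog → Mem → ℕ → Mem → Prop
  | skip (s : Mem) : Exec .skip s 1 s
  | setNat (a : ℕ) (i e : NExpr) (s : Mem) :
      Exec (.setNat a i e) s (i.cost + e.cost + 1) (s.setNat a (i.eval s) (e.eval s))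
  | setCpx (a : ℕ) (i : NExpr) (z : CExpr) (s : Mem) :
      Exec (.setCpx a i z) s (i.cost + z.cost + 1) (s.setCpx a (i.eval s) (z.eval s))
  | seq {p q : Prog} {s s' s'' : Mem} {t t' : ℕ} :
      Exec p s t s' → Exec q s' t' s'' → Exec (.seq p q) s (t + t') s''
  | iteTrue {b : Test} {p q : Prog} {s s' : Mem} {t : ℕ} :
      b.holds s → Exec p s t s' → Exec (.ite b p q) s (b.cost + t) s'
  | iteFalse {b : Test} {p q : Prog} {s s' : Mem} {t : ℕ} :
      ¬ b.holds s → Exec q s t s' → Exec (.ite b p q) s (b.cost + t) s'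
  | whileTrue {b : Test} {p : Prog} {s s' s'' : Mem} {t t' : ℕ} :
      b.holds s → Exec p s t s' → Exec (.while b p) s' t' s'' →
      Exec (.while b p) s (b.cost + t + t') s''
  | whileFalse {b : Test} {p : Prog} {s : Mem} :
      ¬ b.holds s → Exec (.while b p) s b.cost s

/-! ## Input and output -/

/-- The `a` lowest binary digits of `r`. -/
def bits (a r : ℕ) : Bits a := fun i => r.testBit i

/-- The entries of the matrix of a gate, row by row. -/
def Gate.entries {n : ℕ} (g : Gate n) : List ℂ :=
  (List.range (2 ^ g.arity)).flatMap fun r =>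
    (List.range (2 ^ g.arity)).map fun c => g.mat (bits g.arity r) (bits g.arity c)

/-- The discrete part of the input: `n`, the number of gates, and for each gate its arity followed
by its qubits. -/
def natInput {n : ℕ} (K : Circuit n) : List ℕ :=
  n :: K.length :: K.flatMap fun g => g.arity :: List.ofFn fun i => (g.qubits i : ℕ)

/-- The numerical part of the input: `δ`, the entries of the `O j`, the entries of the gates. -/
def cpxInput {n : ℕ} (K : Circuit n) (O : Fin n → Matrix Bool Bool ℂ) (δ : ℝ) : List ℂ :=
  (δ : ℂ) ::
    ((List.finRange n).flatMap (fun j =>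
        [O j false false, O j false true, O j true false, O j true true]) ++
      K.flatMap Gate.entries)

/-- The initial memory: the input is in the arrays numbered `0`, all other entries are zero. -/
def initMem {n : ℕ} (K : Circuit n) (O : Fin n → Matrix Bool Bool ℂ) (δ : ℝ) : Mem where
  nat a i := if a = 0 then (natInput K).getD i 0 else 0
  cpx a i := if a = 0 then (cpxInput K O δ).getD i 0 else 0

/-- The output of a halted program: the first entry of the complex array `1`. -/
def Mem.output (s : Mem) : ℂ := s.cpx 1 0

/-- `|log μ - log ν| ≤ δ`: the nonzero numbers `μ` and `ν` have logarithms at distance at most `δ`.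
No branch is fixed, since logarithms are determined up to multiples of `2πi` only. -/
def LogClose (μ ν : ℂ) (δ : ℝ) : Prop :=
  ∃ a b : ℂ, Complex.exp a = μ ∧ Complex.exp b = ν ∧ ‖a - b‖ ≤ δ

end MeanValue

end

/-! Write `O j = 1 + (O j - 1)` and expand the tensor product. The mean value becomes a sum of
`weight` over all sets R of qubits, that is, a polymer partition function Z. The weights satisfy
|w(R)| ≤ ε^|R| (`norm_weight_le`), and w(A ∪ B) = w(A) w(B) if no lightcone of a qubit of A meets
one of a qubit of B, because expectation values in a product state factorize
(`weight_union_of_not_coneAdj`). In the graph that joins qubits with meeting lightcones, each qubit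
has at most D = `ell U 4` neighbours, itself included (`card_coneAdj_le`). The sum Z(T) over R ⊆ T
is the mean value with `O j` replaced by 1 outside T.

Convergence: write a function of T as F(T) = ∑_{S ⊆ T} φ(S), with norm ∑ 2^|S| |φ(S)|. This norm is
submultiplicative for pointwise products (`setNorm_mul_le`), so inverses and logarithms near 1 are
controlled as in a Banach algebra. Removing a site v from Z leaves a sum over the connected sets
that contain v (`partition_eq_add_sum`), which is bounded by comparison with site percolation
(`sum_component_pow_le`). By induction each ratio Z(T ∩ W) / Z(T ∩ (W \ v)) is within 1/(2D) of 1 in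
norm (`partition_ne_zero_and_setNorm_le`). The logarithms of the ratios telescope to a logarithm of
Z of norm at most n (`exists_log_partition`), so its coefficients on sets of more than k qubits sum
to at most n / 2^k.

Algorithm: let E(S) be the exponential of the coefficient of log Z at S. Then Z(T) is the product of
E(S) over S ⊆ T, and E(S) = 1 for disconnected S (`eq_one_of_splits`). Up to an error δ in the
logarithm, the mean value is the product of E(S) over connected S with |S| ≤ k, where n ≤ δ 2^k
(`exists_factors`). No logarithm has to be computed: E(S) is Z(S) divided by the factors of the
smaller connected subsets of S. Convergence rests on the lightcones of the unitary, whereas the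
program tests connectedness through the layout; the weights factorize for both relations.

Cost: Z(S) depends only on the gates inside the layout cone of S (`Circuit.conj_filter`), which has
at most h|S| qubits with h = `ellOne`, so a state vector with 2^(h|S|) amplitudes suffices. There
are at most n (4h²)^k + 1 connected sets (`card_grown_le`). Since 2^k is at most polynomial in ν =
2n / min(δ, 1), both numbers are ν^O(h) (`loop_bounds`). Loops over the gates are never nested,
which gives the factor m + 1. -/

noncomputable section

namespace MeanValue

/-! ### Local operators, lightcones and the weights of sets of qubits. -/

section Operators

variable {n : ℕ} {S T : Finset (Fin n)} {A B M U : Op n}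

theorem ActsOn.apply_eq_zero (h : ActsOn S A) {x y : Bits n} {k : Fin n} (hk : k ∉ S)
    (hxy : x k ≠ y k) : A x y = 0 := by
  obtain ⟨B, hB⟩ := h
  rw [hB, if_neg]
  exact fun h => hxy (h k hk)

theorem ActsOn.apply_congr (h : ActsOn S A) {x y x' y' : Bits n} (hx : ∀ k ∈ S, x k = x' k)
    (hy : ∀ k ∈ S, y k = y' k) (hxy : ∀ k, k ∉ S → x k = y k)
    (hxy' : ∀ k, k ∉ S → x' k = y' k) : A x y = A x' y' := by
  obtain ⟨B, hB⟩ := h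
  rw [hB, hB, if_pos hxy, if_pos hxy']
  congr 1 <;> ext ⟨k, hk⟩ <;> simp [hx k hk, hy k hk]

theorem actsOn_of_apply (h0 : ∀ x y k, k ∉ S → x k ≠ y k → A x y = 0)
    (h1 : ∀ x y x' y' : Bits n, (∀ k ∈ S, x k = x' k) → (∀ k ∈ S, y k = y' k) →
      (∀ k, k ∉ S → x k = y k) → (∀ k, k ∉ S → x' k = y' k) → A x y = A x' y') :
    ActsOn S A := by
  classical
  refine ⟨fun u v => A (fun k => if h : k ∈ S then u ⟨k, h⟩ else false)
    (fun k => if h : k ∈ S then v ⟨k, h⟩ else false), fun x y => ?_⟩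
  split_ifs with h
  · apply h1
    · intro k hk; simp [hk]
    · intro k hk; simp [hk]
    · exact h
    · intro k hk; simp [hk]
  · push Not at h
    obtain ⟨k, hk, hne⟩ := h
    exact h0 x y k hk hne

theorem ActsOn.mono (h : ActsOn S A) (hST : S ⊆ T) : ActsOn T A := by
  refine actsOn_of_apply (fun x y k hk hne => h.apply_eq_zero (fun hk' => hk (hST hk')) hne) ?_
  intro x y x' y' hx hy hxy hxy'
  by_cases hz : ∀ k, k ∉ S → x k = y k
  · refine h.apply_congr (fun k hk => hx k (hST hk)) (fun k hk => hy k (hST hk)) hz ?_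
    intro k hk
    by_cases hkT : k ∈ T
    · rw [← hx k hkT, ← hy k hkT, hz k hk]
    · exact hxy' k hkT
  · push Not at hz
    obtain ⟨k, hk, hne⟩ := hz
    have hkT : k ∈ T := by
      by_contra hkT
      exact hne (hxy k hkT)
    rw [h.apply_eq_zero hk hne, h.apply_eq_zero hk (by rwa [← hx k hkT, ← hy k hkT])]

/-- Only one intermediate label survives in the matrix product: `A` cannot change qubits outside `S`
and `B` cannot change those inside. -/
theorem ActsOn.mul_apply_of_disjoint (hA : ActsOn S A) (hB : ActsOn T B) (hd : Disjoint S T)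
    (x y : Bits n) :
    (A * B) x y = A x (S.piecewise y x) * B (S.piecewise y x) y := by
  rw [Matrix.mul_apply]
  refine Finset.sum_eq_single _ ?_ (by simp)
  intro z _ hz
  by_contra hne
  apply hz
  ext k
  by_cases hk : k ∈ S
  · have hkT : k ∉ T := Finset.disjoint_left.1 hd hk
    simp only [hk, Finset.piecewise_eq_of_mem]
    by_contra h
    exact hne (by rw [hB.apply_eq_zero hkT h, mul_zero])
  · simp only [hk, not_false_eq_true, Finset.piecewise_eq_of_notMem]
    by_contra h
    exact hne (by rw [hA.apply_eq_zero hk (Ne.symm h), zero_mul])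

theorem ActsOn.commute (hA : ActsOn S A) (hB : ActsOn T B) (hd : Disjoint S T) : Commute A B := by
  ext x y
  rw [hA.mul_apply_of_disjoint hB hd, hB.mul_apply_of_disjoint hA hd.symm]
  by_cases h : ∀ k, k ∉ S → k ∉ T → x k = y k
  · have hl : ∀ k ∈ S, k ∉ T := fun k hk => Finset.disjoint_left.1 hd hk
    have hr : ∀ k ∈ T, k ∉ S := fun k hk => Finset.disjoint_right.1 hd hk
    rw [mul_comm]
    congr 1
    · apply hB.apply_congr
      · intro k hk; simp [hr k hk]
      · intro k hk; simp [hk]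
      · intro k hk
        by_cases hkS : k ∈ S
        · simp [hkS]
        · simp [hkS, h k hkS hk]
      · intro k hk; simp [hk]
    · apply hA.apply_congr
      · intro k hk; simp [hl k hk]
      · intro k hk; simp [hk]
      · intro k hk; simp [hk]
      · intro k hk
        by_cases hkT : k ∈ T
        · simp [hkT]
        · simp [hkT, h k hk hkT]
  · push Not at h
    obtain ⟨k, hkS, hkT, hne⟩ := h
    rw [hB.apply_eq_zero (x := S.piecewise y x) hkT (by simpa [hkS] using hne),
      hA.apply_eq_zero (x := T.piecewise y x) hkS (by simpa [hkT] using hne)]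
    simp

/-- The tensor product of the operators `O j` for `j ∈ S` and of identities elsewhere. -/
def partialTensor (O : Fin n → Matrix Bool Bool ℂ) (S : Finset (Fin n)) : Op n :=
  tensor fun j => if j ∈ S then O j else 1

theorem partialTensor_apply (O : Fin n → Matrix Bool Bool ℂ) (S : Finset (Fin n)) (x y : Bits n) :
    partialTensor O S x y = ∏ j, (if j ∈ S then O j else 1) (x j) (y j) := rfl

theorem tensor_mul (O P : Fin n → Matrix Bool Bool ℂ) :
    tensor O * tensor P = tensor (fun j => O j * P j) := by
  ext x y
  simp only [Matrix.mul_apply, tensor, Matrix.of_apply, ← Finset.prod_mul_distrib]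
  rw [Finset.prod_univ_sum, Fintype.piFinset_univ]

theorem tensor_one : tensor (fun _ : Fin n => (1 : Matrix Bool Bool ℂ)) = 1 := by
  ext x y
  simp only [tensor, Matrix.of_apply, Matrix.one_apply]
  by_cases h : x = y
  · simp [h]
  · rw [if_neg h]
    obtain ⟨k, hk⟩ := Function.ne_iff.1 h
    exact Finset.prod_eq_zero (Finset.mem_univ k) (if_neg hk)

theorem partialTensor_empty (O : Fin n → Matrix Bool Bool ℂ) : partialTensor O ∅ = 1 := by
  simp [partialTensor, tensor_one]

theorem partialTensor_univ (O : Fin n → Matrix Bool Bool ℂ) :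
    partialTensor O Finset.univ = tensor O := by
  simp [partialTensor]

theorem partialTensor_union (O : Fin n → Matrix Bool Bool ℂ) (hd : Disjoint S T) :
    partialTensor O (S ∪ T) = partialTensor O S * partialTensor O T := by
  rw [partialTensor, partialTensor, partialTensor, tensor_mul]
  congr 1
  ext1 j
  by_cases hS : j ∈ S
  · simp [hS, Finset.disjoint_left.1 hd hS]
  · simp [hS]

theorem actsOn_partialTensor (O : Fin n → Matrix Bool Bool ℂ) (S : Finset (Fin n)) :
    ActsOn S (partialTensor O S) := by
  apply actsOn_of_apply
  · intro x y k hk hne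
    rw [partialTensor_apply]
    exact Finset.prod_eq_zero (Finset.mem_univ k) (by simp [hk, hne])
  · intro x y x' y' hx hy hxy hxy'
    rw [partialTensor_apply, partialTensor_apply]
    refine Finset.prod_congr rfl fun k _ => ?_
    by_cases hk : k ∈ S
    · simp [hk, hx k hk, hy k hk]
    · simp only [hk, if_false, hxy k hk, hxy' k hk, Matrix.one_apply_eq]

theorem partialTensor_singleton_apply (O : Fin n → Matrix Bool Bool ℂ) (j : Fin n) (x y : Bits n) :
    partialTensor O {j} x y = if ∀ k, k ≠ j → x k = y k then O j (x j) (y j) else 0 := by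
  split_ifs with h
  · rw [partialTensor_apply, Finset.prod_eq_single j]
    · simp
    · intro k _ hk
      simp only [Finset.mem_singleton, hk, if_false, h k hk, Matrix.one_apply_eq]
    · simp
  · push Not at h
    obtain ⟨k, hk, hne⟩ := h
    exact (actsOn_partialTensor O {j}).apply_eq_zero (by simpa using hk) hne

/-- Comparing entries of the commutators with the matrix units on one outside qubit shows that `A`
is diagonal in that qubit and does not depend on its common value. Outside qubits are then changed
one at a time. The commutant criterion is what makes products and intersections of supports easy to
handle. -/
theorem actsOn_of_commute (h : ∀ k, k ∉ S → ∀ B : Op n, ActsOn {k} B → Commute A B) :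
    ActsOn S A := by
  have key : ∀ k, k ∉ S → ∀ (x y : Bits n) (a b : Bool),
      (if y k = b then A x (Function.update y k a) else 0) =
        if x k = a then A (Function.update x k b) y else 0 := by
    intro k hk x y a b
    have hc := congrFun (congrFun (h k hk _ (actsOn_partialTensor
      (fun _ => Matrix.of fun c d => if c = a ∧ d = b then 1 else 0) {k})) x) y
    rw [Matrix.mul_apply, Matrix.mul_apply, Finset.sum_eq_single (Function.update y k a),
      Finset.sum_eq_single (Function.update x k b)] at hc
    · rw [partialTensor_singleton_apply, partialTensor_singleton_apply] at hc
      rw [if_pos (fun i hi => by simp [hi]), if_pos (fun i hi => by simp [hi])] at hc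
      simpa using hc
    · intro z _ hz
      rw [partialTensor_singleton_apply]
      split_ifs with h1
      · simp only [Matrix.of_apply, mul_eq_zero]
        left
        rw [if_neg]
        rintro ⟨-, rfl⟩
        apply hz
        ext i
        by_cases hi : i = k
        · subst hi; simp
        · simp [hi, h1 i hi]
      · simp
    · simp
    · intro z _ hz
      rw [partialTensor_singleton_apply]
      split_ifs with h1
      · simp only [Matrix.of_apply, mul_eq_zero]
        right
        rw [if_neg]
        rintro ⟨rfl, -⟩
        apply hz
        ext i
        by_cases hi : i = k
        · subst hi; simp
        · simp [hi, h1 i hi]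
      · simp
    · simp
  have h0 : ∀ x y k, k ∉ S → x k ≠ y k → A x y = 0 := by
    intro x y k hk hne
    simpa [hne] using key k hk x y (y k) (y k)
  have h1 : ∀ x y k b, k ∉ S → x k = y k →
      A x y = A (Function.update x k b) (Function.update y k b) := by
    intro x y k b hk he
    simpa [he] using key k hk x (Function.update y k b) (x k) b
  refine actsOn_of_apply h0 fun x y x' y' hx hy hxy hxy' => ?_
  have ind : ∀ W : Finset (Fin n), W ⊆ Sᶜ →
      A x y = A (W.piecewise x' x) (W.piecewise y' y) := by
    intro W
    induction W using Finset.induction_on with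
    | empty => simp
    | insert j W hj ih =>
      intro hW
      have hjS : j ∉ S := by simpa using hW (Finset.mem_insert_self j W)
      rw [ih fun i hi => hW (Finset.mem_insert_of_mem hi), Finset.piecewise_insert,
        Finset.piecewise_insert, h1 _ _ j (x' j) hjS (by simp [hj, hxy j hjS]), ← hxy' j hjS]
  have ex : Sᶜ.piecewise x' x = x' := by
    ext k
    by_cases hk : k ∈ S <;> simp [hk, hx]
  have ey : Sᶜ.piecewise y' y = y' := by
    ext k
    by_cases hk : k ∈ S <;> simp [hk, hy]
  rw [ind Sᶜ subset_rfl, ex, ey]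

theorem actsOn_iff_commute :
    ActsOn S A ↔ ∀ k, k ∉ S → ∀ B : Op n, ActsOn {k} B → Commute A B :=
  ⟨fun h _ hk _ hB => h.commute hB (by simpa using hk), actsOn_of_commute⟩

theorem ActsOn.mul (hA : ActsOn S A) (hB : ActsOn T B) : ActsOn (S ∪ T) (A * B) := by
  rw [actsOn_iff_commute] at *
  intro k hk C hC
  simp only [Finset.mem_union, not_or] at hk
  exact (hA k hk.1 C hC).mul_left (hB k hk.2 C hC)

theorem actsOn_one : ActsOn S (1 : Op n) :=
  actsOn_of_commute fun _ _ _ _ => Commute.one_left _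

theorem ActsOn.conjTranspose (hA : ActsOn S A) : ActsOn S Aᴴ := by
  apply actsOn_of_apply
  · intro x y k hk hne
    rw [Matrix.conjTranspose_apply, hA.apply_eq_zero hk (Ne.symm hne), star_zero]
  · intro x y x' y' hx hy hxy hxy'
    rw [Matrix.conjTranspose_apply, Matrix.conjTranspose_apply,
      hA.apply_congr hy hx (fun k hk => (hxy k hk).symm) (fun k hk => (hxy' k hk).symm)]

/-- Expectation values in a product state factorize over disjoint sets of qubits. -/
theorem ActsOn.mul_apply_self (hA : ActsOn S A) (hB : ActsOn T B) (hd : Disjoint S T)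
    (x : Bits n) : (A * B) x x = A x x * B x x := by
  have h : S.piecewise x x = x := by
    ext k
    by_cases hk : k ∈ S <;> simp [hk]
  rw [hA.mul_apply_of_disjoint hB hd, h]

theorem conj_mul_conj (hU : U ∈ Matrix.unitaryGroup (Bits n) ℂ) (A B : Op n) :
    (Uᴴ * A * U) * (Uᴴ * B * U) = Uᴴ * (A * B) * U := by
  have h : U * Uᴴ = 1 := Matrix.mem_unitaryGroup_iff.1 hU
  calc _ = Uᴴ * A * (U * Uᴴ) * B * U := by simp only [Matrix.mul_assoc]
    _ = _ := by rw [h]; simp only [Matrix.mul_assoc, Matrix.one_mul]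

theorem commute_conj_iff (hU : U ∈ Matrix.unitaryGroup (Bits n) ℂ) :
    Commute (Uᴴ * A * U) B ↔ Commute A (U * B * Uᴴ) := by
  have h : U * Uᴴ = 1 := Matrix.mem_unitaryGroup_iff.1 hU
  have h' : Uᴴ * U = 1 := Matrix.mem_unitaryGroup_iff'.1 hU
  constructor
  · intro hc
    have : U * (Uᴴ * A * U * B) * Uᴴ = U * (B * (Uᴴ * A * U)) * Uᴴ := by rw [hc.eq]
    calc A * (U * B * Uᴴ) = (U * Uᴴ) * A * U * B * Uᴴ := by
          rw [h]; simp only [Matrix.mul_assoc, Matrix.one_mul]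
      _ = U * (Uᴴ * A * U * B) * Uᴴ := by simp only [Matrix.mul_assoc]
      _ = _ := this
      _ = U * B * Uᴴ * A * (U * Uᴴ) := by simp only [Matrix.mul_assoc]
      _ = _ := by rw [h, Matrix.mul_one]
  · intro hc
    have : Uᴴ * (A * (U * B * Uᴴ)) * U = Uᴴ * ((U * B * Uᴴ) * A) * U := by rw [hc.eq]
    calc Uᴴ * A * U * B = Uᴴ * A * U * B * (Uᴴ * U) := by rw [h', Matrix.mul_one]
      _ = Uᴴ * (A * (U * B * Uᴴ)) * U := by simp only [Matrix.mul_assoc]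
      _ = _ := this
      _ = (Uᴴ * U) * B * Uᴴ * A * U := by simp only [Matrix.mul_assoc]
      _ = _ := by rw [h']; simp only [Matrix.mul_assoc, Matrix.one_mul]

/-! ### Lightcones -/

theorem mem_lightcone_self (U : Op n) (j : Fin n) : j ∈ lightcone U j := by
  simp only [lightcone, Finset.mem_filter, Finset.mem_univ, true_and]
  exact fun T hT _ => hT

/-- The lightcone is an intersection of admissible sets. It is admissible itself because the
commutant criterion is tested qubit by qubit, and a qubit outside the intersection is outside some
admissible set. -/
theorem actsOn_lightcone {j : Fin n} (hA : ActsOn {j} A) :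
    ActsOn (lightcone U j) (Uᴴ * A * U) := by
  rw [actsOn_iff_commute]
  intro k hk B hB
  simp only [lightcone, Finset.mem_filter, Finset.mem_univ, true_and, not_forall] at hk
  obtain ⟨T, hT, h, hkT⟩ := hk
  exact actsOn_iff_commute.1 (h A hA) k hkT B hB

/-- Commutation of `U† A U` with `B` is the same as commutation of `A` with `U B U†`. If `k` is
missing from an admissible set for the backward cone of `q`, then the complement of `q` is
admissible for the forward cone of `k`. -/
theorem mem_lightcone_conjTranspose (hU : U ∈ Matrix.unitaryGroup (Bits n) ℂ) {q k : Fin n}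
    (hq : q ∈ lightcone U k) : k ∈ lightcone Uᴴ q := by
  simp only [lightcone, Finset.mem_filter, Finset.mem_univ, true_and]
  intro T hqT hT
  by_contra hkT
  have hkq : k ≠ q := fun h => hkT (h ▸ hqT)
  simp only [lightcone, Finset.mem_filter, Finset.mem_univ, true_and] at hq
  refine absurd (hq {q}ᶜ (by simpa using hkq) fun A hA => ?_) (by simp)
  rw [actsOn_iff_commute]
  intro k' hk' B hB
  obtain rfl : k' = q := by simpa using hk'
  rw [commute_conj_iff hU]
  have := hT B hB
  rw [Matrix.conjTranspose_conjTranspose] at this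
  exact (actsOn_iff_commute.1 this k hkT A hA).symm

theorem actsOn_conj_partialTensor (hU : U ∈ Matrix.unitaryGroup (Bits n) ℂ)
    (O : Fin n → Matrix Bool Bool ℂ) (S : Finset (Fin n)) :
    ActsOn (S.biUnion (lightcone U)) (Uᴴ * partialTensor O S * U) := by
  classical
  induction S using Finset.induction_on with
  | empty =>
    rw [partialTensor_empty, Matrix.mul_one, ← Matrix.star_eq_conjTranspose,
      Matrix.mem_unitaryGroup_iff'.1 hU]
    exact actsOn_one
  | insert j S hj ih =>
    rw [Finset.biUnion_insert, Finset.insert_eq, partialTensor_union _ (by simpa using hj),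
      ← conj_mul_conj hU]
    exact (actsOn_lightcone (actsOn_partialTensor O {j})).mul ih

/-! ### Norms -/

-- The map `A ↦ A ⊗ I` is a homomorphism of C*-algebras, hence a contraction.
open scoped Matrix.Norms.L2Operator in
theorem norm_partialTensor_singleton_le (O : Fin n → Matrix Bool Bool ℂ) (j : Fin n) :
    ‖partialTensor O {j}‖ ≤ ‖O j‖ := by
  let φ : Matrix Bool Bool ℂ →⋆ₙₐ[ℂ] Op n :=
    { toFun := fun A => partialTensor (fun _ => A) {j}
      map_smul' := fun c A => by
        ext x y
        simp only [partialTensor_singleton_apply, Matrix.smul_apply, MonoidHom.id_apply]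
        split_ifs <;> simp
      map_zero' := by
        ext x y
        simp [partialTensor_singleton_apply]
      map_add' := fun A B => by
        ext x y
        simp only [partialTensor_singleton_apply, Matrix.add_apply]
        split_ifs <;> simp
      map_mul' := fun A B => by
        rw [partialTensor, partialTensor, partialTensor, tensor_mul]
        congr 1
        ext1 k
        by_cases hk : k ∈ ({j} : Finset (Fin n)) <;> simp [hk]
      map_star' := fun A => by
        ext x y
        simp only [partialTensor_singleton_apply, Matrix.star_eq_conjTranspose,
          Matrix.conjTranspose_apply]
        simp only [eq_comm]
        split_ifs <;> simp }
  have h := NonUnitalStarAlgHom.norm_apply_le φ (O j)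
  have e : φ (O j) = partialTensor O {j} := by
    ext x y
    change partialTensor (fun _ => O j) {j} x y = _
    simp only [partialTensor_singleton_apply]
  rwa [e] at h

open scoped Matrix.Norms.L2Operator in
theorem norm_partialTensor_le (O : Fin n → Matrix Bool Bool ℂ) {ε : ℝ} (hO : ∀ j, ‖O j‖ ≤ ε)
    (S : Finset (Fin n)) : ‖partialTensor O S‖ ≤ ε ^ S.card := by
  classical
  induction S using Finset.induction_on with
  | empty =>
    rw [partialTensor_empty, Finset.card_empty, pow_zero]
    exact (CStarRing.norm_of_mem_unitary (one_mem _)).le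
  | insert j S hj ih =>
    rw [Finset.card_insert_of_notMem hj, Finset.insert_eq,
      partialTensor_union _ (by simpa using hj), pow_succ']
    have h0 : 0 ≤ ε := (norm_nonneg _).trans (hO j)
    exact (norm_mul_le _ _).trans (mul_le_mul ((norm_partialTensor_singleton_le O j).trans (hO j))
      ih (norm_nonneg _) h0)

open scoped Matrix.Norms.L2Operator in
theorem norm_conj_apply_le (hU : U ∈ Matrix.unitaryGroup (Bits n) ℂ) (M : Op n) (x : Bits n) :
    ‖(Uᴴ * M * U) x x‖ ≤ ‖M‖ := by
  have hUn : ‖U‖ = 1 := CStarRing.norm_of_mem_unitary hU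
  have h1 : ‖Uᴴ * M * U‖ ≤ ‖M‖ := by
    refine (norm_mul_le _ _).trans ?_
    rw [hUn, mul_one]
    refine (norm_mul_le _ _).trans ?_
    rw [Matrix.l2_opNorm_conjTranspose, hUn, one_mul]
  refine le_trans ?_ h1
  have h2 := Matrix.l2_opNorm_mulVec (Uᴴ * M * U) (EuclideanSpace.single x (1 : ℂ))
  rw [PiLp.norm_single, norm_one, mul_one] at h2
  have h3 := PiLp.norm_apply_le ((EuclideanSpace.equiv (Bits n) ℂ).symm
    ((Uᴴ * M * U) *ᵥ (EuclideanSpace.single x (1 : ℂ)).ofLp)) x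
  have h4 : ((Uᴴ * M * U) *ᵥ (EuclideanSpace.single x (1 : ℂ)).ofLp) x = (Uᴴ * M * U) x x :=
    congrFun (Matrix.mulVec_single_one (Uᴴ * M * U) x) x
  rw [← h4]
  exact h3.trans h2

/-- The weight `⟨0ⁿ| U† ⊗_{j ∈ S} (O j - 1) U |0ⁿ⟩` of a set of qubits. -/
def weight (U : Op n) (O : Fin n → Matrix Bool Bool ℂ) (S : Finset (Fin n)) : ℂ :=
  meanValue U (partialTensor (fun j => O j - 1) S)

theorem weight_empty (hU : U ∈ Matrix.unitaryGroup (Bits n) ℂ) (O : Fin n → Matrix Bool Bool ℂ) :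
    weight U O ∅ = 1 := by
  rw [weight, partialTensor_empty, meanValue, Matrix.mul_one, ← Matrix.star_eq_conjTranspose,
    Matrix.mem_unitaryGroup_iff'.1 hU, Matrix.one_apply_eq]

theorem norm_weight_le (hU : U ∈ Matrix.unitaryGroup (Bits n) ℂ)
    (O : Fin n → Matrix Bool Bool ℂ) {ε : ℝ}
    (hO : ∀ j, ‖Matrix.toEuclideanCLM (n := Bool) (𝕜 := ℂ) (O j - 1)‖ ≤ ε) (S : Finset (Fin n)) :
    ‖weight U O S‖ ≤ ε ^ S.card :=
  (norm_conj_apply_le hU _ _).trans (norm_partialTensor_le _ hO S)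

theorem weight_union_of_actsOn (hU : U ∈ Matrix.unitaryGroup (Bits n) ℂ)
    (O : Fin n → Matrix Bool Bool ℂ) {S' T' : Finset (Fin n)} (hd : Disjoint S T)
    (hS : ActsOn S' (Uᴴ * partialTensor (fun j => O j - 1) S * U))
    (hT : ActsOn T' (Uᴴ * partialTensor (fun j => O j - 1) T * U)) (hd' : Disjoint S' T') :
    weight U O (S ∪ T) = weight U O S * weight U O T := by
  rw [weight, partialTensor_union _ hd, meanValue, ← conj_mul_conj hU,
    hS.mul_apply_self hT hd']
  rfl

theorem tensor_eq_sum_partialTensor (O : Fin n → Matrix Bool Bool ℂ) (T : Finset (Fin n)) :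
    partialTensor O T = ∑ R ∈ T.powerset, partialTensor (fun j => O j - 1) R := by
  classical
  ext x y
  rw [Matrix.sum_apply]
  have h : ∀ j, (if j ∈ T then O j else 1) (x j) (y j) =
      (if j ∈ T then (O j - 1) (x j) (y j) else 0) + (1 : Matrix Bool Bool ℂ) (x j) (y j) := by
    intro j
    split_ifs <;> simp
  simp only [partialTensor_apply, h]
  rw [Finset.prod_add]
  refine (Finset.sum_subset (Finset.powerset_mono.2 (Finset.subset_univ T)) ?_).symm.trans ?_
  · intro R _ hR
    rw [Finset.mem_powerset, Finset.not_subset] at hR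
    obtain ⟨k, hk, hkT⟩ := hR
    rw [Finset.prod_eq_zero hk (by simp [hkT]), zero_mul]
  · refine Finset.sum_congr rfl fun R hR => ?_
    rw [Finset.mem_powerset] at hR
    rw [← Finset.prod_sdiff (Finset.subset_univ R), mul_comm]
    congr 1
    · refine Finset.prod_congr rfl fun k hk => ?_
      simp [(Finset.mem_sdiff.1 hk).2]
    · refine Finset.prod_congr rfl fun k hk => ?_
      simp [hk, hR hk]

/-- This identifies the mean value with a partition function whose polymers are sets of qubits;
subsets `T` give the partial sums used by the recursion. -/
theorem meanValue_partialTensor (U : Op n) (O : Fin n → Matrix Bool Bool ℂ)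
    (T : Finset (Fin n)) :
    meanValue U (partialTensor O T) = ∑ R ∈ T.powerset, weight U O R := by
  simp only [weight, meanValue, tensor_eq_sum_partialTensor O T, Matrix.mul_sum, Matrix.sum_mul,
    Matrix.sum_apply]

end Operators

/-! ### Circuits as operators, and the lightcones of their layout. -/

section Circuits

variable {n : ℕ}

theorem extend_apply_of_not_mem {a : ℕ} (q : Fin a ↪ Fin n) (c : Bits a) (x : Bits n) {k : Fin n}
    (hk : k ∉ Set.range q) : Function.extend q c x k = x k :=
  Function.extend_apply' _ _ _ (by simpa using hk)

/-- Labels that agree with `x` off the listed qubits are parametrized by their bits on those qubits,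
so a gate acts through a sum of `2 ^ a` terms. -/
theorem sum_ite_eq_sum_extend {a : ℕ} (q : Fin a ↪ Fin n) (x : Bits n) (f : Bits n → ℂ)
    (p : Bits n → Prop) [DecidablePred p] (hp : ∀ z, p z ↔ ∀ k, k ∉ Set.range q → x k = z k) :
    ∑ z, (if p z then f z else 0) = ∑ c : Bits a, f (Function.extend q c x) := by
  rw [← Finset.sum_filter]
  refine Finset.sum_nbij' (fun z i => z (q i)) (fun c => Function.extend q c x) (by simp) ?_ ?_ ?_ ?_
  · intro c _
    simp only [Finset.mem_filter, Finset.mem_univ, true_and, hp]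
    intro k hk
    rw [extend_apply_of_not_mem q c x hk]
  · intro z hz
    simp only [Finset.mem_filter, Finset.mem_univ, true_and, hp] at hz
    ext k
    by_cases hk : k ∈ Set.range q
    · obtain ⟨i, rfl⟩ := hk
      rw [q.injective.extend_apply]
    · rw [extend_apply_of_not_mem q _ x hk, hz k hk]
  · intro c _
    ext i
    exact q.injective.extend_apply _ _ _
  · intro z hz
    simp only [Finset.mem_filter, Finset.mem_univ, true_and, hp] at hz
    congr 1
    ext k
    by_cases hk : k ∈ Set.range q
    · obtain ⟨i, rfl⟩ := hk
      rw [q.injective.extend_apply]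
    · rw [extend_apply_of_not_mem q _ x hk, hz k hk]

theorem Gate.mem_support {g : Gate n} {k : Fin n} : k ∈ g.support ↔ k ∈ Set.range g.qubits := by
  simp [Gate.support]

/-- The matrix `A` applied to the listed qubits, as an operator on all `n` qubits. -/
def embed {a : ℕ} (q : Fin a ↪ Fin n) (A : Matrix (Bits a) (Bits a) ℂ) : Op n :=
  Matrix.of fun x y =>
    if ∀ k, k ∉ Set.range q → x k = y k then A (fun i => x (q i)) (fun i => y (q i)) else 0

theorem Gate.toOp_eq_embed (g : Gate n) : g.toOp = embed g.qubits g.mat := rfl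

theorem embed_apply_extend {a : ℕ} (q : Fin a ↪ Fin n) (A : Matrix (Bits a) (Bits a) ℂ)
    (x y : Bits n) (c : Bits a) (h : ∀ k, k ∉ Set.range q → y k = x k) :
    embed q A y (Function.extend q c x) = A (fun i => y (q i)) c := by
  rw [embed, Matrix.of_apply, if_pos]
  · congr 1
    ext i
    exact q.injective.extend_apply _ _ _
  · intro k hk
    rw [h k hk, extend_apply_of_not_mem _ _ _ hk]

theorem embed_mulVec {a : ℕ} (q : Fin a ↪ Fin n) (A : Matrix (Bits a) (Bits a) ℂ)
    (v : Bits n → ℂ) (x : Bits n) :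
    (embed q A *ᵥ v) x = ∑ c : Bits a, A (fun i => x (q i)) c * v (Function.extend q c x) := by
  rw [Matrix.mulVec, dotProduct]
  have : ∀ z, embed q A x z * v z = if ∀ k, k ∉ Set.range q → x k = z k
      then embed q A x z * v z else 0 := by
    intro z
    by_cases h : ∀ k, k ∉ Set.range q → x k = z k
    · rw [if_pos h]
    · rw [if_neg h, embed, Matrix.of_apply, if_neg h, zero_mul]
  rw [Finset.sum_congr rfl fun z _ => this z,
    sum_ite_eq_sum_extend q x (fun z => embed q A x z * v z) _ fun z => Iff.rfl]
  refine Finset.sum_congr rfl fun c _ => ?_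
  rw [embed_apply_extend q A x x c fun _ _ => rfl]

theorem Gate.actsOn_toOp (g : Gate n) : ActsOn g.support g.toOp := by
  apply actsOn_of_apply
  · intro x y k hk hne
    rw [Gate.toOp, Matrix.of_apply, if_neg]
    exact fun h => hne (h k (by rwa [Gate.mem_support] at hk))
  · intro x y x' y' hx hy hxy hxy'
    rw [Gate.toOp, Matrix.of_apply, Matrix.of_apply, if_pos, if_pos]
    · have h : ∀ i, g.qubits i ∈ g.support := fun i => Gate.mem_support.2 ⟨i, rfl⟩
      congr 1 <;> ext i
      · rw [hx _ (h i)]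
      · rw [hy _ (h i)]
    · exact fun k hk => hxy' k (by rwa [Gate.mem_support])
    · exact fun k hk => hxy k (by rwa [Gate.mem_support])

theorem Gate.toOp_mem_unitaryGroup (g : Gate n) : g.toOp ∈ Matrix.unitaryGroup (Bits n) ℂ := by
  rw [Matrix.mem_unitaryGroup_iff]
  ext x y
  have h := embed_mulVec g.qubits g.mat (fun z => star (g.toOp y z)) x
  rw [← g.toOp_eq_embed] at h
  have e : (g.toOp * star g.toOp) x y = (g.toOp *ᵥ fun z => star (g.toOp y z)) x := rfl
  rw [e, h]
  by_cases hxy : ∀ k, k ∉ Set.range g.qubits → y k = x k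
  · simp only [g.toOp_eq_embed, embed_apply_extend g.qubits g.mat x y _ hxy]
    have hu := congrFun (congrFun (Matrix.mem_unitaryGroup_iff.1 g.unitary)
      (fun i => x (g.qubits i))) (fun i => y (g.qubits i))
    rw [Matrix.mul_apply] at hu
    refine hu.trans ?_
    rw [Matrix.one_apply, Matrix.one_apply]
    congr 1
    refine propext ⟨fun he => ?_, fun he => by rw [he]⟩
    ext k
    by_cases hk : k ∈ Set.range g.qubits
    · obtain ⟨i, rfl⟩ := hk
      exact congrFun he i
    · exact (hxy k hk).symm
  · rw [Matrix.one_apply, if_neg fun he => hxy fun k _ => by rw [he]]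
    refine Finset.sum_eq_zero fun c _ => ?_
    rw [Gate.toOp, Matrix.of_apply, if_neg, star_zero, mul_zero]
    intro h
    apply hxy
    intro k hk
    rw [h k hk, extend_apply_of_not_mem _ _ _ hk]

theorem Circuit.toOp_mem_unitaryGroup (K : Circuit n) :
    K.toOp ∈ Matrix.unitaryGroup (Bits n) ℂ := by
  induction K with
  | nil => exact one_mem _
  | cons g K ih => exact mul_mem ih g.toOp_mem_unitaryGroup

/-! ### Layout lightcones -/

variable {S T Q : Finset (Fin n)} {M : Op n}

theorem Gate.subset_spread (g : Gate n) (S : Finset (Fin n)) : S ⊆ g.spread S := by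
  rw [Gate.spread]
  split_ifs
  · exact Finset.subset_union_left
  · exact subset_rfl

theorem Gate.mem_spread {g : Gate n} {k : Fin n} :
    k ∈ g.spread S ↔ k ∈ S ∨ k ∈ g.support ∧ ∃ i ∈ g.support, i ∈ S := by
  rw [Gate.spread]
  split_ifs with h
  · obtain ⟨i, hi⟩ := h
    rw [Finset.mem_inter] at hi
    rw [Finset.mem_union]
    exact or_congr_right ⟨fun hk => ⟨hk, i, hi⟩, fun hk => hk.1⟩
  · refine ⟨Or.inl, ?_⟩
    rintro (hk | ⟨-, i, hi⟩)
    · exact hk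
    · exact absurd ⟨i, Finset.mem_inter.2 hi⟩ h

theorem Circuit.cone_append (K K' : Circuit n) (S : Finset (Fin n)) :
    Circuit.cone (K ++ K') S = Circuit.cone K (Circuit.cone K' S) := by
  induction K with
  | nil => rfl
  | cons g K ih => simp only [List.cons_append, Circuit.cone, ih]

theorem Circuit.subset_cone (K : Circuit n) (S : Finset (Fin n)) : S ⊆ K.cone S := by
  induction K with
  | nil => exact subset_rfl
  | cons g K ih => exact ih.trans (g.subset_spread _)

theorem Circuit.mem_cone_iff (K : Circuit n) {S : Finset (Fin n)} {q : Fin n} :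
    q ∈ K.cone S ↔ ∃ j ∈ S, q ∈ K.cone {j} := by
  induction K generalizing q with
  | nil => simp [Circuit.cone]
  | cons g K ih =>
    simp only [Circuit.cone, Gate.mem_spread]
    constructor
    · rintro (hq | ⟨hq, i, hi, hiS⟩)
      · obtain ⟨j, hj, h⟩ := ih.1 hq
        exact ⟨j, hj, Or.inl h⟩
      · obtain ⟨j, hj, h⟩ := ih.1 hiS
        exact ⟨j, hj, Or.inr ⟨hq, i, hi, h⟩⟩
    · rintro ⟨j, hj, hq | ⟨hq, i, hi, hiS⟩⟩
      · exact Or.inl (ih.2 ⟨j, hj, hq⟩)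
      · exact Or.inr ⟨hq, i, hi, ih.2 ⟨j, hj, hiS⟩⟩

/-- Spreading through one gate is a symmetric relation between qubits, so reversing the list of
gates transposes the composite relation. Thus the table of cones in one direction decides membership
in the other. -/
theorem Circuit.exists_mem_cone_reverse (K : Circuit n) (S T : Finset (Fin n)) :
    (∃ q ∈ T, q ∈ K.cone S) ↔ ∃ q ∈ S, q ∈ Circuit.cone K.reverse T := by
  induction K generalizing T with
  | nil =>
    simp only [Circuit.cone, List.reverse_nil]
    exact ⟨fun ⟨q, h1, h2⟩ => ⟨q, h2, h1⟩, fun ⟨q, h1, h2⟩ => ⟨q, h2, h1⟩⟩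
  | cons g K ih =>
    rw [List.reverse_cons, Circuit.cone_append]
    simp only [Circuit.cone]
    rw [← ih]
    simp only [Gate.mem_spread]
    constructor
    · rintro ⟨q, hq, h | ⟨h, i, hi, hi'⟩⟩
      · exact ⟨q, Or.inl hq, h⟩
      · exact ⟨i, Or.inr ⟨hi, q, h, hq⟩, hi'⟩
    · rintro ⟨q, hq | ⟨hq, i, hi, hi'⟩, h⟩
      · exact ⟨q, hq, Or.inl h⟩
      · exact ⟨i, hi', Or.inr ⟨hi, q, hq, h⟩⟩

/-- The qubits reached from qubit `q` when the gates are followed from the first to the last. -/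
def Circuit.future (K : Circuit n) (q : Fin n) : Finset (Fin n) := Circuit.cone K.reverse {q}

theorem Circuit.mem_future_iff {K : Circuit n} {q j : Fin n} :
    j ∈ K.future q ↔ q ∈ K.cone {j} := by
  have h := K.exists_mem_cone_reverse {j} {q}
  simp only [Finset.mem_singleton, exists_eq_left] at h
  exact h.symm

theorem Circuit.mem_future_self (K : Circuit n) (q : Fin n) : q ∈ K.future q :=
  Circuit.subset_cone _ _ (Finset.mem_singleton_self q)

theorem Circuit.mem_cone_iff_future {K : Circuit n} {q : Fin n} :
    q ∈ K.cone S ↔ ∃ k ∈ S, k ∈ K.future q := by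
  rw [K.mem_cone_iff]
  simp only [Circuit.mem_future_iff]

theorem Gate.conj_eq_self (g : Gate n) (hM : ActsOn S M) (h : Disjoint g.support S) :
    g.toOpᴴ * M * g.toOp = M := by
  rw [Matrix.mul_assoc, ← (g.actsOn_toOp.commute hM h).eq, ← Matrix.mul_assoc,
    ← Matrix.star_eq_conjTranspose, Matrix.mem_unitaryGroup_iff'.1 g.toOp_mem_unitaryGroup,
    Matrix.one_mul]

theorem Gate.actsOn_conj (g : Gate n) (hM : ActsOn S M) :
    ActsOn (g.spread S) (g.toOpᴴ * M * g.toOp) := by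
  rw [Gate.spread]
  split_ifs with h
  · have := (g.actsOn_toOp.conjTranspose.mul hM).mul g.actsOn_toOp
    exact this.mono (by intro k; simp only [Finset.mem_union]; tauto)
  · rw [g.conj_eq_self hM]
    · exact hM
    · rwa [Finset.disjoint_iff_inter_eq_empty, ← Finset.not_nonempty_iff_eq_empty]

theorem Circuit.conj_cons (g : Gate n) (K : Circuit n) (M : Op n) :
    (Circuit.toOp (g :: K))ᴴ * M * Circuit.toOp (g :: K) =
      g.toOpᴴ * (K.toOpᴴ * M * K.toOp) * g.toOp := by
  simp only [Circuit.toOp, Matrix.conjTranspose_mul, Matrix.mul_assoc]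

theorem Circuit.actsOn_conj (K : Circuit n) (hM : ActsOn S M) :
    ActsOn (K.cone S) (K.toOpᴴ * M * K.toOp) := by
  induction K with
  | nil => simpa [Circuit.toOp, Circuit.cone] using hM
  | cons g K ih =>
    rw [Circuit.conj_cons]
    exact g.actsOn_conj ih

/-- A gate that touches the current cone is absorbed by it and so lies in `Q`. A gate not contained
in `Q` therefore meets an operator with disjoint support and cancels against its adjoint. -/
theorem Circuit.conj_filter (K : Circuit n) (hM : ActsOn S M) (hQ : K.cone S ⊆ Q) :
    (Circuit.toOp (K.filter fun g => g.support ⊆ Q))ᴴ * M *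
      Circuit.toOp (K.filter fun g => g.support ⊆ Q) = K.toOpᴴ * M * K.toOp := by
  induction K with
  | nil => rfl
  | cons g K ih =>
    have hQ' : Circuit.cone K S ⊆ Q := (g.subset_spread _).trans hQ
    by_cases hg : g.support ⊆ Q
    · rw [List.filter_cons_of_pos (by simpa using hg), Circuit.conj_cons, Circuit.conj_cons, ih hQ']
    · rw [List.filter_cons_of_neg (by simpa using hg), ih hQ', Circuit.conj_cons]
      refine (g.conj_eq_self (Circuit.actsOn_conj K hM) ?_).symm
      by_contra hd
      refine hg (Finset.Subset.trans ?_ hQ)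
      simp only [Circuit.cone, Gate.spread]
      rw [Finset.disjoint_iff_inter_eq_empty, ← Ne, ← Finset.nonempty_iff_ne_empty] at hd
      rw [if_pos hd]
      exact Finset.subset_union_right

/-- Two qubits are adjacent if some qubit lies in the layout lightcones of both. -/
def Circuit.Adj (K : Circuit n) (j k : Fin n) : Prop := ∃ q, j ∈ K.future q ∧ k ∈ K.future q

theorem Circuit.card_cone_singleton_le (K : Circuit n) (j : Fin n) :
    (K.cone {j}).card ≤ K.ellOne := by
  refine le_trans ?_ (Finset.le_sup (f := fun j => max _ _) (Finset.mem_univ j))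
  refine le_trans ?_ (le_max_left _ _)
  simp [iterCone]

theorem Circuit.card_future_le (K : Circuit n) (j : Fin n) : (K.future j).card ≤ K.ellOne := by
  refine le_trans ?_ (Finset.le_sup (f := fun j => max _ _) (Finset.mem_univ j))
  refine le_trans ?_ (le_max_right _ _)
  simp [iterCone, Circuit.future]

theorem Circuit.one_le_ellOne (K : Circuit n) (hn : 1 ≤ n) : 1 ≤ K.ellOne :=
  (Finset.card_pos.2 ⟨_, K.mem_future_self ⟨0, hn⟩⟩).trans_le (K.card_future_le ⟨0, hn⟩)

theorem Circuit.card_cone_le (K : Circuit n) (S : Finset (Fin n)) :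
    (K.cone S).card ≤ S.card * K.ellOne := by
  have h : K.cone S = S.biUnion fun j => K.cone {j} := by
    ext q
    rw [K.mem_cone_iff, Finset.mem_biUnion]
  rw [h]
  exact Finset.card_biUnion_le_card_mul _ _ _ fun j _ => K.card_cone_singleton_le j

-- A neighbour is reached by going from `j` back to a qubit of its cone and forward again, with at
-- most `ellOne` choices at each step.
open scoped Classical in
theorem Circuit.card_adj_le (K : Circuit n) (j : Fin n) :
    (Finset.univ.filter fun k => K.Adj j k).card ≤ K.ellOne * K.ellOne := by
  have h : (Finset.univ.filter fun k => K.Adj j k) = (K.cone {j}).biUnion K.future := by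
    ext k
    simp [Circuit.Adj, Circuit.mem_future_iff]
  rw [h]
  exact (Finset.card_biUnion_le_card_mul _ _ _ fun q _ => K.card_future_le q).trans
    (Nat.mul_le_mul_right _ (K.card_cone_singleton_le j))

/-! ### Adjacency of qubits through lightcones of the unitary -/

theorem one_le_ell (hn : 1 ≤ n) (U : Op n) (c : ℕ) : 1 ≤ ell U c := by
  have h : ∀ (c : ℕ) (F B : Fin n → Finset (Fin n)), (∀ j, j ∈ F j) → (∀ j, j ∈ B j) →
      ∀ S : Finset (Fin n), S.Nonempty → (iterCone F B c S).Nonempty := by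
    intro c
    induction c with
    | zero => intro F B _ _ S hS; exact hS
    | succ c ih =>
      intro F B hF hB S hS
      refine ih B F hB hF _ ?_
      obtain ⟨j, hj⟩ := hS
      exact ⟨j, Finset.mem_biUnion.2 ⟨j, hj, hF j⟩⟩
  refine le_trans ?_ (Finset.le_sup (f := fun j => max _ _) (Finset.mem_univ (⟨0, hn⟩ : Fin n)))
  refine le_trans ?_ (le_max_left _ _)
  exact Finset.card_pos.2 (h c _ _ (mem_lightcone_self U) (mem_lightcone_self Uᴴ) _
    (Finset.singleton_nonempty _))

/-- Two qubits are adjacent if their lightcones meet. -/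
def ConeAdj (U : Op n) (j k : Fin n) : Prop := ∃ q, q ∈ lightcone U j ∧ q ∈ lightcone U k

open scoped Classical in
theorem card_coneAdj_le {U : Op n} (hU : U ∈ Matrix.unitaryGroup (Bits n) ℂ) (j : Fin n) :
    (Finset.univ.filter fun k => ConeAdj U j k).card ≤ ell U 4 := by
  refine le_trans ?_ (Finset.le_sup (f := fun j => max _ _) (Finset.mem_univ j))
  refine le_trans ?_ (le_max_left _ _)
  refine Finset.card_le_card fun k hk => ?_
  simp only [Finset.mem_filter, Finset.mem_univ, true_and] at hk
  obtain ⟨q, hj, hk⟩ := hk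
  simp only [iterCone, Finset.mem_biUnion, Finset.mem_singleton]
  -- One forward and one backward step lead from `j` to `k`; the other two of the four steps stay at
  -- `k`.
  exact ⟨k, ⟨k, ⟨q, ⟨j, rfl, hj⟩, mem_lightcone_conjTranspose hU hk⟩, mem_lightcone_self U k⟩,
    mem_lightcone_self Uᴴ k⟩

theorem weight_union_of_not_coneAdj {U : Op n} (hU : U ∈ Matrix.unitaryGroup (Bits n) ℂ)
    (O : Fin n → Matrix Bool Bool ℂ) (h : ∀ j ∈ S, ∀ k ∈ T, ¬ ConeAdj U j k) :
    weight U O (S ∪ T) = weight U O S * weight U O T := by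
  refine weight_union_of_actsOn hU O ?_ (actsOn_conj_partialTensor hU _ S)
    (actsOn_conj_partialTensor hU _ T) ?_
  · rw [Finset.disjoint_left]
    exact fun j hS hT => h j hS j hT ⟨j, mem_lightcone_self U j, mem_lightcone_self U j⟩
  · rw [Finset.disjoint_left]
    intro q hS hT
    obtain ⟨j, hj, hqj⟩ := Finset.mem_biUnion.1 hS
    obtain ⟨k, hk, hqk⟩ := Finset.mem_biUnion.1 hT
    exact h j hj k hk ⟨q, hqj, hqk⟩

theorem weight_union_of_not_adj (K : Circuit n) (O : Fin n → Matrix Bool Bool ℂ)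
    (h : ∀ j ∈ S, ∀ k ∈ T, ¬ K.Adj j k) :
    weight K.toOp O (S ∪ T) = weight K.toOp O S * weight K.toOp O T := by
  refine weight_union_of_actsOn K.toOp_mem_unitaryGroup O ?_
    (K.actsOn_conj (actsOn_partialTensor _ S)) (K.actsOn_conj (actsOn_partialTensor _ T)) ?_
  · rw [Finset.disjoint_left]
    exact fun j hS hT => h j hS j hT ⟨j, K.mem_future_self j, K.mem_future_self j⟩
  · rw [Finset.disjoint_left]
    intro q hS hT
    obtain ⟨j, hj, hqj⟩ := Circuit.mem_cone_iff_future.1 hS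
    obtain ⟨k, hk, hqk⟩ := Circuit.mem_cone_iff_future.1 hT
    exact h j hj k hk ⟨q, hqj, hqk⟩

end Circuits

/-! ## Functions of a set with the union product -/

section SetFunctions

variable {V : Type*} [Fintype V] [DecidableEq V]

/-- The Möbius transform of a function of a set. -/
def mobius (F : Finset V → ℂ) (S : Finset V) : ℂ :=
  ∑ T ∈ S.powerset, (-1) ^ (S \ T).card * F T

theorem sum_mobius (F : Finset V → ℂ) (T : Finset V) : ∑ S ∈ T.powerset, mobius F S = F T := by
  have h1 : ∑ S ∈ T.powerset, mobius F S = ∑ R ∈ T.powerset,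
      ∑ S ∈ T.powerset.filter (fun S => R ⊆ S), (-1) ^ (S \ R).card * F R := by
    refine Finset.sum_comm' fun S R => ?_
    simp only [Finset.mem_powerset, Finset.mem_filter]
    exact ⟨fun ⟨h, h'⟩ => ⟨⟨h, h'⟩, h'.trans h⟩, fun ⟨⟨h, h'⟩, _⟩ => ⟨h, h'⟩⟩
  -- The alternating sum over the sets between `R` and `T` vanishes unless `R = T`.
  have h2 : ∀ R ∈ T.powerset,
      ∑ S ∈ T.powerset.filter (fun S => R ⊆ S), (-1) ^ (S \ R).card * F R =
        if R = T then F R else 0 := by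
    intro R hR
    rw [Finset.mem_powerset] at hR
    rw [← Finset.sum_mul]
    have h3 : ∑ S ∈ T.powerset.filter (fun S => R ⊆ S), (-1 : ℂ) ^ (S \ R).card =
        ∑ W ∈ (T \ R).powerset, (-1 : ℂ) ^ W.card := by
      refine Finset.sum_nbij' (fun S => S \ R) (fun W => W ∪ R) ?_ ?_ ?_ ?_ ?_
      · intro S hS
        simp only [Finset.mem_filter, Finset.mem_powerset] at hS ⊢
        exact Finset.sdiff_subset_sdiff hS.1 subset_rfl
      · intro W hW
        simp only [Finset.mem_filter, Finset.mem_powerset] at hW ⊢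
        exact ⟨Finset.union_subset (hW.trans Finset.sdiff_subset) hR, Finset.subset_union_right⟩
      · intro S hS
        simp only [Finset.mem_filter, Finset.mem_powerset] at hS
        exact Finset.sdiff_union_of_subset hS.2
      · intro W hW
        rw [Finset.mem_powerset] at hW
        have hd : Disjoint W R := Finset.disjoint_of_subset_left hW Finset.sdiff_disjoint
        exact Finset.union_sdiff_cancel_right hd
      · intro S _
        rfl
    have h4 : ∑ W ∈ (T \ R).powerset, (-1 : ℂ) ^ W.card = if T \ R = ∅ then 1 else 0 := by
      have := Finset.sum_powerset_neg_one_pow_card (x := T \ R)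
      exact_mod_cast this
    rw [h3, h4]
    by_cases he : R = T
    · subst he; simp
    · rw [if_neg he, if_neg, zero_mul]
      intro h
      exact he (Finset.Subset.antisymm hR (Finset.sdiff_eq_empty_iff_subset.1 h))
  rw [h1, Finset.sum_congr rfl h2, Finset.sum_ite_eq']
  simp

theorem mobius_eq {F φ : Finset V → ℂ} (h : ∀ T, F T = ∑ S ∈ T.powerset, φ S) :
    mobius F = φ := by
  ext S
  induction S using Finset.strongInduction with
  | H S ih =>
    have h1 := (sum_mobius F S).trans (h S)
    rw [← Finset.add_sum_erase _ _ (Finset.mem_powerset_self S),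
      ← Finset.add_sum_erase _ φ (Finset.mem_powerset_self S)] at h1
    rw [Finset.sum_congr rfl fun T hT => ih T ?_] at h1
    · exact add_right_cancel h1
    · rw [Finset.mem_erase, Finset.mem_powerset] at hT
      exact hT.2.ssubset_of_ne hT.1

/-- The norm `∑ 2^|S| |φ S|` of a function `T ↦ ∑_{S ⊆ T} φ S`. -/
def setNorm (F : Finset V → ℂ) : ℝ := ∑ S, 2 ^ S.card * ‖mobius F S‖

theorem setNorm_nonneg (F : Finset V → ℂ) : 0 ≤ setNorm F :=
  Finset.sum_nonneg fun _ _ => by positivity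

theorem setNorm_eq {F φ : Finset V → ℂ} (h : ∀ T, F T = ∑ S ∈ T.powerset, φ S) :
    setNorm F = ∑ S, 2 ^ S.card * ‖φ S‖ := by
  rw [setNorm, mobius_eq h]

theorem norm_apply_le_setNorm (F : Finset V → ℂ) (T : Finset V) : ‖F T‖ ≤ setNorm F := by
  rw [← sum_mobius F T]
  refine (norm_sum_le _ _).trans ?_
  refine (Finset.sum_le_sum_of_subset_of_nonneg (Finset.subset_univ _)
    fun _ _ _ => norm_nonneg _).trans ?_
  refine Finset.sum_le_sum fun S _ => ?_
  exact le_mul_of_one_le_left (norm_nonneg _) (one_le_pow₀ one_le_two)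

theorem setNorm_add_le (F G : Finset V → ℂ) :
    setNorm (fun T => F T + G T) ≤ setNorm F + setNorm G := by
  rw [setNorm_eq (φ := fun S => mobius F S + mobius G S)
    fun T => by rw [Finset.sum_add_distrib, sum_mobius, sum_mobius],
    setNorm, setNorm, ← Finset.sum_add_distrib]
  refine Finset.sum_le_sum fun S _ => ?_
  rw [← mul_add]
  exact mul_le_mul_of_nonneg_left (norm_add_le _ _) (by positivity)

theorem setNorm_const_mul (c : ℂ) (F : Finset V → ℂ) :
    setNorm (fun T => c * F T) = ‖c‖ * setNorm F := by
  rw [setNorm_eq (φ := fun S => c * mobius F S) fun T => by rw [← Finset.mul_sum, sum_mobius],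
    setNorm, Finset.mul_sum]
  refine Finset.sum_congr rfl fun S _ => ?_
  rw [norm_mul]; ring

theorem setNorm_zero : setNorm (fun _ : Finset V => 0) = 0 := by
  rw [setNorm_eq (φ := fun _ => 0) fun T => by simp]
  simp

theorem setNorm_indicator (C : Finset V) :
    setNorm (fun T => if C ⊆ T then 1 else 0) = 2 ^ C.card := by
  rw [setNorm_eq (φ := fun S => if S = C then 1 else 0) fun T => by simp]
  rw [Finset.sum_eq_single C] <;> simp +contextual

theorem setNorm_one : setNorm (fun _ : Finset V => 1) = 1 := by
  have := setNorm_indicator (∅ : Finset V)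
  simpa using this

theorem setNorm_sum_le {ι : Type*} (s : Finset ι) (F : ι → Finset V → ℂ) :
    setNorm (fun T => ∑ i ∈ s, F i T) ≤ ∑ i ∈ s, setNorm (F i) := by
  classical
  induction s using Finset.induction_on with
  | empty => simp [setNorm_zero]
  | insert i s hi ih =>
    simp only [Finset.sum_insert hi]
    exact (setNorm_add_le _ _).trans (add_le_add_right ih _)

/-- The coefficient of the product at `S` collects the pairs with union `S`. Since `|P ∪ Q| ≤ |P| +
|Q|`, the weights `2 ^ |S|` are submultiplicative. -/
theorem setNorm_mul_le (F G : Finset V → ℂ) :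
    setNorm (fun T => F T * G T) ≤ setNorm F * setNorm G := by
  have h : ∀ T, F T * G T = ∑ S ∈ T.powerset,
      ∑ p ∈ (Finset.univ : Finset (Finset V × Finset V)).filter (fun p => p.1 ∪ p.2 = S),
        mobius F p.1 * mobius G p.2 := by
    intro T
    conv_lhs => rw [← sum_mobius F T, ← sum_mobius G T, Finset.sum_mul_sum, ← Finset.sum_product']
    rw [← Finset.sum_fiberwise_of_maps_to (s := T.powerset ×ˢ T.powerset) (t := T.powerset)
      (g := fun p => p.1 ∪ p.2)]
    · refine Finset.sum_congr rfl fun S hS => Finset.sum_congr ?_ fun _ _ => rfl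
      rw [Finset.mem_powerset] at hS
      ext p
      simp only [Finset.mem_filter, Finset.mem_product, Finset.mem_powerset, Finset.mem_univ,
        true_and, and_iff_right_iff_imp]
      rintro rfl
      exact ⟨Finset.subset_union_left.trans hS, Finset.subset_union_right.trans hS⟩
    · intro p hp
      simp only [Finset.mem_product, Finset.mem_powerset] at hp ⊢
      exact Finset.union_subset hp.1 hp.2
  rw [setNorm_eq h, setNorm, setNorm, Finset.sum_mul_sum, ← Finset.sum_product',
    Finset.univ_product_univ,
    ← Finset.sum_fiberwise (Finset.univ : Finset (Finset V × Finset V)) (fun p => p.1 ∪ p.2)]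
  refine Finset.sum_le_sum fun S _ => ?_
  refine (mul_le_mul_of_nonneg_left (norm_sum_le _ _) (by positivity)).trans ?_
  rw [Finset.mul_sum]
  refine Finset.sum_le_sum fun p hp => ?_
  rw [Finset.mem_filter] at hp
  rw [norm_mul]
  have h2 : (2 : ℝ) ^ S.card ≤ 2 ^ p.1.card * 2 ^ p.2.card := by
    rw [← pow_add, ← hp.2]
    exact pow_le_pow_right₀ one_le_two (Finset.card_union_le _ _)
  calc (2 : ℝ) ^ S.card * (‖mobius F p.1‖ * ‖mobius G p.2‖)
      ≤ (2 ^ p.1.card * 2 ^ p.2.card) * (‖mobius F p.1‖ * ‖mobius G p.2‖) := by gcongr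
    _ = _ := by ring

theorem setNorm_pow_le (F : Finset V → ℂ) (k : ℕ) :
    setNorm (fun T => F T ^ k) ≤ setNorm F ^ k := by
  induction k with
  | zero => simp [setNorm_one]
  | succ k ih =>
    simp only [pow_succ]
    exact (setNorm_mul_le _ _).trans (mul_le_mul_of_nonneg_right ih (setNorm_nonneg F))

theorem ne_zero_of_setNorm_sub_one_lt {F : Finset V → ℂ} (h : setNorm (fun T => F T - 1) < 1)
    (T : Finset V) : F T ≠ 0 := by
  intro h0
  have := (norm_apply_le_setNorm (fun T => F T - 1) T).trans_lt h
  simp [h0] at this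

/-- No series is needed: `F⁻¹ = 1 - (F - 1) F⁻¹` bounds the norm of `F⁻¹`, which is a real number in
any case, by `1 + c` times itself. -/
theorem setNorm_inv_le {F : Finset V → ℂ} {c : ℝ} (h : setNorm (fun T => F T - 1) ≤ c)
    (hc : c < 1) : setNorm (fun T => (F T)⁻¹) ≤ 1 / (1 - c) := by
  have h0 := ne_zero_of_setNorm_sub_one_lt (h.trans_lt hc)
  have e : (fun T => (F T)⁻¹) = fun T => 1 + (-1) * ((F T - 1) * (F T)⁻¹) := by
    ext T
    field_simp [h0 T]
    ring
  have h1 : setNorm (fun T => (F T)⁻¹) ≤ 1 + c * setNorm (fun T => (F T)⁻¹) := by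
    conv_lhs => rw [e]
    refine (setNorm_add_le _ _).trans ?_
    rw [setNorm_one, setNorm_const_mul, norm_neg, norm_one, one_mul]
    refine add_le_add_right ((setNorm_mul_le _ _).trans ?_) _
    exact mul_le_mul_of_nonneg_right h (setNorm_nonneg _)
  rw [le_div_iff₀ (by linarith)]
  linarith

theorem continuous_setNorm : Continuous (setNorm : (Finset V → ℂ) → ℝ) := by
  unfold setNorm mobius
  fun_prop

/-- The Taylor series of the logarithm converges pointwise, and the norm is continuous because there
are finitely many sets. The partial sums are bounded by the geometric series without its constant
term. -/
theorem setNorm_log_le {F : Finset V → ℂ} {c : ℝ} (h : setNorm (fun T => F T - 1) ≤ c)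
    (hc : c < 1) : setNorm (fun T => Complex.log (F T)) ≤ c / (1 - c) := by
  have hc0 : 0 ≤ c := (setNorm_nonneg _).trans h
  have ht : Filter.Tendsto (fun N T => ∑ k ∈ Finset.range (N + 1),
      (-1) ^ (k + 1) * (F T - 1) ^ k / k) Filter.atTop (nhds fun T => Complex.log (F T)) := by
    rw [tendsto_pi_nhds]
    intro T
    have h1 : ‖F T - 1‖ < 1 := (norm_apply_le_setNorm (fun T => F T - 1) T).trans_lt
      (h.trans_lt hc)
    have h2 := (Complex.hasSum_taylorSeries_log h1).tendsto_sum_nat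
    rw [add_sub_cancel] at h2
    exact (Filter.tendsto_add_atTop_iff_nat 1).2 h2
  refine le_of_tendsto ((continuous_setNorm.tendsto _).comp ht) (Filter.Eventually.of_forall ?_)
  intro N
  refine (setNorm_sum_le _ _).trans ?_
  have hterm : ∀ k : ℕ, setNorm (fun T => (-1) ^ (k + 1) * (F T - 1) ^ k / k) ≤
      if k = 0 then 0 else c ^ k := by
    intro k
    have e : (fun T => (-1) ^ (k + 1) * (F T - 1) ^ k / k) =
        fun T => ((-1) ^ (k + 1) / k : ℂ) * (F T - 1) ^ k := by
      ext T; ring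
    rw [e, setNorm_const_mul]
    split_ifs with hk
    · simp [hk]
    · have h1 : ‖((-1) ^ (k + 1) / k : ℂ)‖ ≤ 1 := by
        rw [norm_div, norm_pow, norm_neg, norm_one, one_pow, Complex.norm_natCast]
        rw [div_le_one (by positivity)]
        exact_mod_cast Nat.one_le_iff_ne_zero.2 hk
      have h2 := (setNorm_pow_le (fun T => F T - 1) k).trans
        (pow_le_pow_left₀ (setNorm_nonneg _) h k)
      calc _ ≤ 1 * c ^ k := mul_le_mul h1 h2 (setNorm_nonneg _) zero_le_one
        _ = _ := one_mul _
  refine (Finset.sum_le_sum fun k _ => hterm k).trans ?_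
  rw [Finset.sum_range_succ']
  simp only [Nat.succ_ne_zero, if_false, if_true, add_zero, pow_succ]
  rw [← Finset.sum_mul, div_eq_inv_mul]
  refine mul_le_mul_of_nonneg_right ?_ hc0
  rw [← tsum_geometric_of_lt_one hc0 hc]
  exact (summable_geometric_of_lt_one hc0 hc).sum_le_tsum _ fun _ _ => by positivity

end SetFunctions

/-! ## Cluster expansion -/

section Clusters

open scoped Classical in
/-- The connected component of `v` in the subgraph that is induced on `R`. -/
def component {V : Type*} [Fintype V] (a : V → V → Prop) (R : Finset V) (v : V) : Finset V :=
  Finset.univ.filter (Relation.ReflTransGen (fun x y => a x y ∧ y ∈ R) v)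

open scoped Classical in
/-- The neighbours of the elements of `C`. -/
def nbhd {V : Type*} [Fintype V] (a : V → V → Prop) (C : Finset V) : Finset V :=
  Finset.univ.filter fun u => ∃ x ∈ C, a x u

variable {V : Type*} [Fintype V] {a : V → V → Prop} {R C T : Finset V} {u v x : V}

theorem mem_component : u ∈ component a R v ↔
    Relation.ReflTransGen (fun x y => a x y ∧ y ∈ R) v u := by
  simp [component]

theorem mem_nbhd : u ∈ nbhd a C ↔ ∃ x ∈ C, a x u := by
  simp [nbhd]

variable [DecidableEq V]

/-- The paths restrict only the endpoints of their steps, so `v` belongs to its component even if it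
is not in `R`. Hence `component a C v = C` says that `C` contains `v` and is reached from `v` inside
`C`. -/
theorem mem_component_self : v ∈ component a R v := mem_component.2 .refl

theorem component_subset (hv : v ∈ R) : component a R v ⊆ R := by
  intro u hu
  rw [mem_component] at hu
  cases hu with
  | refl => exact hv
  | tail _ h => exact h.2

theorem mem_component_of_adj (hx : x ∈ component a R v) (hu : u ∈ R) (hxu : a x u) :
    u ∈ component a R v := by
  rw [mem_component] at *
  exact hx.tail ⟨hxu, hu⟩

theorem component_mono {R' : Finset V} (h : R ⊆ R') : component a R v ⊆ component a R' v := by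
  intro u hu
  rw [mem_component] at *
  induction hu with
  | refl => exact .refl
  | tail _ h2 ih => exact ih.tail ⟨h2.1, h h2.2⟩

theorem component_component : component a (component a R v) v = component a R v := by
  refine Finset.Subset.antisymm (component_subset mem_component_self) ?_
  intro u hu
  rw [mem_component] at hu
  induction hu with
  | refl => exact mem_component_self
  | tail h1 h2 ih =>
    exact mem_component_of_adj ih (mem_component_of_adj (mem_component.2 h1) h2.2 h2.1) h2.1

theorem component_union {R' : Finset V} (hC : component a C v = C)
    (hR : Disjoint R' (nbhd a C)) : component a (C ∪ R') v = C := by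
  refine Finset.Subset.antisymm ?_ ?_
  · intro u hu
    rw [mem_component] at hu
    induction hu with
    | refl => rw [← hC]; exact mem_component_self
    | tail h1 h2 ih =>
      rcases Finset.mem_union.1 h2.2 with h | h
      · exact h
      · exact absurd (mem_nbhd.2 ⟨_, ih, h2.1⟩) (Finset.disjoint_left.1 hR h)
  · conv_lhs => rw [← hC]
    exact component_mono Finset.subset_union_left

theorem subset_nbhd (ha : ∀ x, a x x) : C ⊆ nbhd a C := fun x hx => mem_nbhd.2 ⟨x, hx, ha x⟩

theorem card_nbhd_le {D : ℕ} (hD : ∀ v, (nbhd a {v}).card ≤ D) (C : Finset V) :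
    (nbhd a C).card ≤ C.card * D := by
  have h : nbhd a C = C.biUnion fun x => nbhd a {x} := by
    ext u
    simp [mem_nbhd]
  rw [h]
  exact Finset.card_biUnion_le_card_mul _ _ _ fun v _ => hD v

/-- A sum over sets `R ∋ v` is grouped by the connected component of `v` in `R`. -/
theorem sum_eq_sum_component {E : Type*} [AddCommMonoid E] (ha : ∀ x, a x x) (f : Finset V → E) :
    ∑ R ∈ T.powerset.filter (fun R => v ∈ R), f R =
      ∑ C ∈ T.powerset.filter (fun C => component a C v = C),
        ∑ R ∈ (T \ nbhd a C).powerset, f (C ∪ R) := by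
  rw [← Finset.sum_fiberwise_of_maps_to (g := fun R => component a R v)
    (t := T.powerset.filter (fun C => component a C v = C))]
  · refine Finset.sum_congr rfl fun C hC => ?_
    simp only [Finset.mem_filter, Finset.mem_powerset] at hC
    refine Finset.sum_nbij' (fun R => R \ C) (fun R => C ∪ R) ?_ ?_ ?_ ?_ ?_
    · intro R hR
      simp only [Finset.mem_filter, Finset.mem_powerset] at hR ⊢
      intro u hu
      rw [Finset.mem_sdiff] at hu ⊢
      refine ⟨hR.1.1 hu.1, fun hn => hu.2 ?_⟩
      obtain ⟨x, hx, hxu⟩ := mem_nbhd.1 hn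
      rw [← hR.2] at hx ⊢
      exact mem_component_of_adj hx hu.1 hxu
    · intro R hR
      simp only [Finset.mem_filter, Finset.mem_powerset] at hR ⊢
      refine ⟨⟨Finset.union_subset hC.1 (hR.trans Finset.sdiff_subset), ?_⟩, ?_⟩
      · rw [← hC.2]
        exact Finset.mem_union_left _ mem_component_self
      · exact component_union hC.2 (Finset.disjoint_of_subset_left hR Finset.sdiff_disjoint)
    · intro R hR
      simp only [Finset.mem_filter, Finset.mem_powerset] at hR
      refine Finset.union_sdiff_of_subset ?_
      rw [← hR.2]
      exact component_subset hR.1.2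
    · intro R hR
      rw [Finset.mem_powerset] at hR
      refine Finset.union_sdiff_cancel_left ?_
      exact Finset.disjoint_of_subset_right hR
        (Finset.disjoint_of_subset_left (subset_nbhd ha) Finset.disjoint_sdiff)
    · intro R hR
      simp only [Finset.mem_filter, Finset.mem_powerset] at hR
      rw [Finset.union_sdiff_of_subset]
      rw [← hR.2]
      exact component_subset hR.1.2
  · intro R hR
    simp only [Finset.mem_filter, Finset.mem_powerset] at hR ⊢
    exact ⟨(component_subset hR.2).trans hR.1, component_component⟩

/-- The clusters of a site in site percolation have total probability one. -/
theorem sum_component_pow_le {D : ℕ} (ha : ∀ x, a x x) (hD : ∀ v, (nbhd a {v}).card ≤ D)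
    {p : ℝ} (hp0 : 0 ≤ p) (hp1 : p ≤ 1) (hv : v ∈ T) :
    ∑ C ∈ T.powerset.filter (fun C => component a C v = C), (p * (1 - p) ^ D) ^ C.card ≤ p := by
  have hall : ∀ S : Finset V,
      ∑ R ∈ S.powerset, p ^ R.card * (1 - p) ^ (S.card - R.card) = 1 := by
    intro S
    rw [Finset.sum_pow_mul_eq_add_pow]
    simp
  have h1 : ∑ R ∈ T.powerset.filter (fun R => v ∈ R), p ^ R.card * (1 - p) ^ (T.card - R.card)
      = p := by
    have h2 := Finset.sum_filter_add_sum_filter_not T.powerset (fun R => v ∈ R)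
      (fun R => p ^ R.card * (1 - p) ^ (T.card - R.card))
    rw [hall] at h2
    have h3 : ∑ R ∈ T.powerset.filter (fun R => v ∉ R),
        p ^ R.card * (1 - p) ^ (T.card - R.card) = 1 - p := by
      have h4 : T.powerset.filter (fun R => v ∉ R) = (T.erase v).powerset := by
        ext R
        simp only [Finset.mem_filter, Finset.mem_powerset, Finset.subset_erase]
      rw [h4]
      refine Eq.trans ?_ ((congrArg ((1 - p) * ·) (hall (T.erase v))).trans (mul_one _))
      simp only [Finset.mul_sum]
      refine Finset.sum_congr rfl fun R hR => ?_
      have h5 := Finset.card_le_card (Finset.mem_powerset.1 hR)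
      have h6 := Finset.card_erase_add_one hv
      rw [show T.card - R.card = (T.erase v).card - R.card + 1 by omega, pow_succ]
      ring
    linarith
  rw [sum_eq_sum_component (a := a) ha] at h1
  refine le_trans (Finset.sum_le_sum fun C hC => ?_) h1.le
  simp only [Finset.mem_filter, Finset.mem_powerset] at hC
  -- `C` is the cluster of `v` when `C` is occupied and the rest of its neighbourhood is empty. At
  -- most `|C| D` sites are forced to be empty, so this has probability at least `(p (1 - p) ^ D) ^
  -- |C|`.
  have hle : ∀ R ∈ (T \ nbhd a C).powerset,
      (p ^ C.card * (1 - p) ^ (C.card * D)) *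
        (p ^ R.card * (1 - p) ^ ((T \ nbhd a C).card - R.card)) ≤
      p ^ (C ∪ R).card * (1 - p) ^ (T.card - (C ∪ R).card) := by
    intro R hR
    rw [Finset.mem_powerset] at hR
    have hd : Disjoint C R := Finset.disjoint_of_subset_right hR
        (Finset.disjoint_of_subset_left (subset_nbhd ha) Finset.disjoint_sdiff)
    rw [Finset.card_union_of_disjoint hd]
    have e : (p ^ C.card * (1 - p) ^ (C.card * D)) *
        (p ^ R.card * (1 - p) ^ ((T \ nbhd a C).card - R.card)) =
        p ^ (C.card + R.card) *
          (1 - p) ^ (C.card * D + ((T \ nbhd a C).card - R.card)) := by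
      rw [pow_add, pow_add]; ring
    rw [e]
    refine mul_le_mul_of_nonneg_left ?_ (by positivity)
    refine pow_le_pow_of_le_one (by linarith) (by linarith) ?_
    have h7 := card_nbhd_le hD C
    have h8 : T.card ≤ (T \ nbhd a C).card + (nbhd a C).card := by
      rw [← Finset.card_sdiff_add_card_inter T (nbhd a C)]
      exact Nat.add_le_add_left (Finset.card_le_card Finset.inter_subset_right) _
    have h9 := Finset.card_le_card hR
    omega
  refine le_trans (le_of_eq ?_) (Finset.sum_le_sum hle)
  rw [← Finset.mul_sum, hall, mul_one, mul_pow, ← pow_mul, mul_comm D]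

/-- Bernoulli's inequality. With `p = 1 / (2D)` it gives `p (1 - p) ^ D ≥ 1 / (4D)`, the base of the
cluster estimates below. -/
theorem half_le_pow {D : ℕ} (hD : 1 ≤ D) : (1 / 2 : ℝ) ≤ (1 - 1 / (2 * D)) ^ D := by
  have hD' : (1 : ℝ) ≤ D := by exact_mod_cast hD
  have h := one_add_mul_le_pow (a := -(1 / (2 * D) : ℝ)) (by
    have : 1 / (2 * (D : ℝ)) ≤ 1 := by
      rw [div_le_one (by positivity)]; linarith
    linarith) D
  have e : (1 : ℝ) + D * -(1 / (2 * D)) = 1 / 2 := by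
    field_simp
    ring
  rw [e] at h
  exact h

theorem sum_component_inv_pow_le {D : ℕ} (hD1 : 1 ≤ D) (ha : ∀ x, a x x)
    (hD : ∀ v, (nbhd a {v}).card ≤ D) (hv : v ∈ T) :
    ∑ C ∈ T.powerset.filter (fun C => component a C v = C), (1 / (4 * D) : ℝ) ^ C.card ≤
      1 / (2 * D) := by
  have hD' : (1 : ℝ) ≤ D := by exact_mod_cast hD1
  refine le_trans (Finset.sum_le_sum fun C _ => ?_) (sum_component_pow_le ha hD
    (p := 1 / (2 * D)) (by positivity) ?_ hv)
  · refine pow_le_pow_left₀ (by positivity) ?_ _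
    calc (1 / (4 * D) : ℝ) = 1 / (2 * D) * (1 / 2) := by ring
      _ ≤ _ := mul_le_mul_of_nonneg_left (half_le_pow hD1) (by positivity)
  · rw [div_le_one (by positivity)]; linarith

/-- Each connected set counted here contributes at least `(4D) ^ (-k)` to the percolation sum, which
is at most 1. -/
theorem card_component_le {D : ℕ} (hD1 : 1 ≤ D) (ha : ∀ x, a x x)
    (hD : ∀ v, (nbhd a {v}).card ≤ D) (v : V) (k : ℕ) :
    ((Finset.univ : Finset (Finset V)).filter
      fun C => component a C v = C ∧ C.card ≤ k).card ≤ (4 * D) ^ k := by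
  have hD' : (1 : ℝ) ≤ D := by exact_mod_cast hD1
  have h := sum_component_inv_pow_le hD1 ha hD (Finset.mem_univ v)
  have h1 : ∑ C ∈ (Finset.univ : Finset (Finset V)).filter
      (fun C => component a C v = C ∧ C.card ≤ k), (1 / (4 * D) : ℝ) ^ k ≤ 1 := by
    refine le_trans ?_ (h.trans (by rw [div_le_one (by positivity)]; linarith))
    refine le_trans (Finset.sum_le_sum fun C hC => ?_)
      (Finset.sum_le_sum_of_subset_of_nonneg ?_ fun _ _ _ => by positivity)
    · simp only [Finset.mem_filter, Finset.mem_univ, true_and] at hC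
      exact pow_le_pow_of_le_one (by positivity)
        (by rw [div_le_one (by positivity)]; linarith) hC.2
    · intro C hC
      simp only [Finset.mem_filter, Finset.mem_univ, true_and, Finset.mem_powerset] at hC ⊢
      exact ⟨Finset.subset_univ _, hC.1⟩
  rw [Finset.sum_const, nsmul_eq_mul, one_div, inv_pow, ← div_eq_mul_inv,
    div_le_one (by positivity)] at h1
  exact_mod_cast h1

variable (w : Finset V → ℂ)

/-- The partition function with the weights `w` on subsets of `T`. -/
def partition (T : Finset V) : ℂ := ∑ R ∈ T.powerset, w R

variable {w}

/-- A set without `v` lies in `T.erase v`. Otherwise it consists of the component `C` of `v` and a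
remainder that avoids the neighbours of `C`, and the weight factorizes. -/
theorem partition_eq_add_sum (ha : ∀ x, a x x)
    (hw : ∀ A B : Finset V, (∀ x ∈ A, ∀ y ∈ B, ¬ a x y) → w (A ∪ B) = w A * w B) :
    partition w T = partition w (T.erase v) +
      ∑ C ∈ T.powerset.filter (fun C => component a C v = C),
        w C * partition w (T \ nbhd a C) := by
  have h4 : T.powerset.filter (fun R => v ∉ R) = (T.erase v).powerset := by
    ext R
    simp only [Finset.mem_filter, Finset.mem_powerset, Finset.subset_erase]
  rw [partition, ← Finset.sum_filter_add_sum_filter_not T.powerset (fun R => v ∈ R), add_comm, h4,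
    sum_eq_sum_component ha]
  congr 1
  refine Finset.sum_congr rfl fun C _ => ?_
  rw [partition, Finset.mul_sum]
  refine Finset.sum_congr rfl fun R hR => hw C R fun x hx y hy hxy => ?_
  rw [Finset.mem_powerset] at hR
  exact (Finset.mem_sdiff.1 (hR hy)).2 (mem_nbhd.2 ⟨x, hx, hxy⟩)

/-- The elements of `B \ A` are removed one at a time, each at the cost of the inverse of a ratio
that is within `ρ` of 1. -/
theorem setNorm_ratio_le {ρ : ℝ} (hρ : ρ < 1) {B : Finset V}
    (hne : ∀ B' ⊆ B, ∀ T, partition w (T ∩ B') ≠ 0)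
    (hr : ∀ B' ⊆ B, ∀ v ∈ B',
      setNorm (fun T => partition w (T ∩ B') / partition w (T ∩ B'.erase v) - 1) ≤ ρ)
    {A : Finset V} (hA : A ⊆ B) :
    setNorm (fun T => partition w (T ∩ A) / partition w (T ∩ B)) ≤
      (1 / (1 - ρ)) ^ (B \ A).card := by
  induction B using Finset.strongInduction with
  | H B ih =>
    by_cases hAB : A = B
    · subst hAB
      simp only [div_self (hne A subset_rfl _)]
      simp [setNorm_one]
    · obtain ⟨u, huB, huA⟩ := Finset.exists_of_ssubset (hA.ssubset_of_ne hAB)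
      have hA' : A ⊆ B.erase u := Finset.subset_erase.2 ⟨hA, huA⟩
      have h1 := ih (B.erase u) (Finset.erase_ssubset huB)
        (fun B' hB' => hne B' (hB'.trans (Finset.erase_subset _ _)))
        (fun B' hB' => hr B' (hB'.trans (Finset.erase_subset _ _))) hA'
      have h2 := setNorm_inv_le (hr B subset_rfl u huB) hρ
      have e : (fun T => partition w (T ∩ A) / partition w (T ∩ B)) = fun T =>
          (partition w (T ∩ A) / partition w (T ∩ B.erase u)) *
            (partition w (T ∩ B) / partition w (T ∩ B.erase u))⁻¹ := by
        ext T
        have h3 := hne _ (Finset.erase_subset u B) T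
        have h4 := hne _ subset_rfl T
        field_simp
      have hcard : (B \ A).card = (B.erase u \ A).card + 1 := by
        rw [Finset.erase_sdiff_comm, Finset.card_erase_add_one]
        exact Finset.mem_sdiff.2 ⟨huB, huA⟩
      rw [e, hcard, pow_succ]
      refine (setNorm_mul_le _ _).trans (mul_le_mul h1 h2 (setNorm_nonneg _) ?_)
      have : 0 < 1 - ρ := by linarith
      positivity

/-- Convergence of the cluster expansion. -/
theorem partition_ne_zero_and_setNorm_le {D : ℕ} {ε : ℝ} (hD1 : 1 ≤ D) (ha : ∀ x, a x x)
    (hD : ∀ v, (nbhd a {v}).card ≤ D) (h0 : w ∅ = 1)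
    (hw : ∀ A B : Finset V, (∀ x ∈ A, ∀ y ∈ B, ¬ a x y) → w (A ∪ B) = w A * w B)
    (hε0 : 0 ≤ ε) (hε : 16 * D * ε ≤ 1) (hwε : ∀ R, ‖w R‖ ≤ ε ^ R.card) (W : Finset V) :
    (∀ T, partition w (T ∩ W) ≠ 0) ∧ ∀ v ∈ W,
      setNorm (fun T => partition w (T ∩ W) / partition w (T ∩ W.erase v) - 1) ≤
        1 / (2 * D) := by
  have hD' : (1 : ℝ) ≤ D := by exact_mod_cast hD1
  have hρ : 1 / (2 * (D : ℝ)) < 1 := by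
    rw [div_lt_one (by positivity)]; linarith
  induction W using Finset.strongInduction with
  | H W ih =>
    have hlt : ∀ v ∈ W, ∀ B ⊆ W.erase v, B ⊂ W := fun v hv B hB =>
      lt_of_le_of_lt hB (Finset.erase_ssubset hv)
    have key : ∀ v ∈ W,
        setNorm (fun T => partition w (T ∩ W) / partition w (T ∩ W.erase v) - 1) ≤
          1 / (2 * D) := by
      intro v hv
      -- The sum runs over connected subsets of `W` that do not depend on `T`; the indicator of `C ⊆
      -- T` selects those that occur. This makes the norm of a function of `T` applicable term by
      -- term.
      have e : (fun T => partition w (T ∩ W) / partition w (T ∩ W.erase v) - 1) = fun T =>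
          ∑ C ∈ W.powerset.filter (fun C => component a C v = C),
            w C * ((if C ⊆ T then 1 else 0) *
              (partition w (T ∩ (W \ nbhd a C)) / partition w (T ∩ W.erase v))) := by
        ext T
        have hne := (ih _ (hlt v hv _ subset_rfl)).1 T
        rw [sub_eq_iff_eq_add, div_eq_iff hne, add_mul, one_mul, Finset.sum_mul]
        have hcan : ∀ C, w C * ((if C ⊆ T then 1 else 0) *
              (partition w (T ∩ (W \ nbhd a C)) / partition w (T ∩ W.erase v))) *
              partition w (T ∩ W.erase v) =
            if C ⊆ T then w C * partition w (T ∩ (W \ nbhd a C)) else 0 := by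
          intro C
          split_ifs
          · field_simp
          · ring
        simp only [hcan]
        rw [← Finset.sum_filter, Finset.filter_filter, add_comm]
        rw [partition_eq_add_sum (T := T ∩ W) (v := v) ha hw, Finset.inter_erase]
        congr 1
        refine Finset.sum_congr ?_ fun C _ => ?_
        · ext C
          simp only [Finset.mem_filter, Finset.mem_powerset, Finset.subset_inter_iff]
          tauto
        · rw [Finset.inter_sdiff_assoc]
      rw [e]
      refine (setNorm_sum_le _ _).trans
        (le_trans (Finset.sum_le_sum fun C hC => ?_) (sum_component_inv_pow_le hD1 ha hD hv))
      simp only [Finset.mem_filter, Finset.mem_powerset] at hC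
      have hvC : v ∈ C := hC.2 ▸ mem_component_self
      have hsub : W \ nbhd a C ⊆ W.erase v := by
        intro x hx
        rw [Finset.mem_sdiff] at hx
        refine Finset.mem_erase.2 ⟨?_, hx.1⟩
        rintro rfl
        exact hx.2 (subset_nbhd ha hvC)
      have h1 := setNorm_ratio_le hρ (w := w) (B := W.erase v)
        (fun B' hB' => (ih B' (hlt v hv B' hB')).1) (fun B' hB' => (ih B' (hlt v hv B' hB')).2) hsub
      have hq : 0 < 1 - 1 / (2 * (D : ℝ)) := by linarith
      have h1q : 1 ≤ 1 / (1 - 1 / (2 * (D : ℝ))) := by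
        rw [le_div_iff₀ hq]
        have : 0 ≤ 1 / (2 * (D : ℝ)) := by positivity
        linarith
      -- At most `|C| D` sites separate the two partition functions, and `D` factors `1 / (1 - 1 /
      -- (2D))` multiply to at most 2.
      have h2 : (1 / (1 - 1 / (2 * (D : ℝ)))) ^ (W.erase v \ (W \ nbhd a C)).card ≤
          2 ^ C.card := by
        have hc : (W.erase v \ (W \ nbhd a C)).card ≤ C.card * D := by
          refine le_trans (Finset.card_le_card ?_) (card_nbhd_le hD C)
          intro x hx
          simp only [Finset.mem_sdiff, Finset.mem_erase, not_and, not_not] at hx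
          exact hx.2 hx.1.2
        refine (pow_le_pow_right₀ h1q hc).trans ?_
        rw [mul_comm C.card D, pow_mul]
        refine pow_le_pow_left₀ (by positivity) ?_ _
        rw [one_div, inv_pow]
        have := half_le_pow hD1
        refine inv_le_of_inv_le₀ (by norm_num) ?_
        linarith
      rw [setNorm_const_mul]
      -- One factor `2 ^ |C|` is the norm of the indicator, the other bounds the ratio. The
      -- condition `16 * D * ε ≤ 1` is exactly `4ε ≤ 1 / (4D)`, which leaves the percolation sum.
      calc _ ≤ ε ^ C.card * (2 ^ C.card * 2 ^ C.card) := by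
            refine mul_le_mul (hwε C) ((setNorm_mul_le _ _).trans ?_) (setNorm_nonneg _)
              (by positivity)
            rw [setNorm_indicator]
            exact mul_le_mul_of_nonneg_left (h1.trans h2) (by positivity)
        _ = (4 * ε) ^ C.card := by
            rw [← mul_pow, ← mul_pow]; ring
        _ ≤ _ := by
            refine pow_le_pow_left₀ (by positivity) ?_ _
            rw [le_div_iff₀ (by positivity)]
            linarith
    refine ⟨fun T => ?_, key⟩
    rcases W.eq_empty_or_nonempty with rfl | ⟨v, hv⟩
    · simp [partition, h0]
    · have h1 := ne_zero_of_setNorm_sub_one_lt ((key v hv).trans_lt hρ) T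
      exact fun h => h1 (by simp only [h, zero_div])

/-- Sites are added one by one. Each ratio has a principal logarithm of norm at most `c / (1 - c) ≤
1` with `c = 1 / (2D)`, so the sum of these is a logarithm of norm at most the number of sites. -/
theorem exists_log_partition {D : ℕ} {ε : ℝ} (hD1 : 1 ≤ D) (ha : ∀ x, a x x)
    (hD : ∀ v, (nbhd a {v}).card ≤ D) (h0 : w ∅ = 1)
    (hw : ∀ A B : Finset V, (∀ x ∈ A, ∀ y ∈ B, ¬ a x y) → w (A ∪ B) = w A * w B)
    (hε0 : 0 ≤ ε) (hε : 16 * D * ε ≤ 1) (hwε : ∀ R, ‖w R‖ ≤ ε ^ R.card) :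
    ∃ L : Finset V → ℂ, (∀ T, Complex.exp (L T) = partition w T) ∧
      setNorm L ≤ Fintype.card V := by
  have hD' : (1 : ℝ) ≤ D := by exact_mod_cast hD1
  have hρ : 1 / (2 * (D : ℝ)) < 1 := by
    rw [div_lt_one (by positivity)]; linarith
  have hmain := partition_ne_zero_and_setNorm_le hD1 ha hD h0 hw hε0 hε hwε
  have h : ∀ W : Finset V, ∃ L : Finset V → ℂ,
      (∀ T, Complex.exp (L T) = partition w (T ∩ W)) ∧ setNorm L ≤ W.card := by
    intro W
    induction W using Finset.induction_on with
    | empty =>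
      refine ⟨fun _ => 0, fun T => ?_, ?_⟩
      · simp [partition, h0]
      · simp [setNorm_zero]
    | insert v W hv ih =>
      obtain ⟨L, hL, hL'⟩ := ih
      have h1 := (hmain (insert v W)).2 v (Finset.mem_insert_self _ _)
      rw [Finset.erase_insert hv] at h1
      refine ⟨fun T => L T +
        Complex.log (partition w (T ∩ insert v W) / partition w (T ∩ W)), fun T => ?_, ?_⟩
      · have h2 := (hmain W).1 T
        rw [Complex.exp_add, hL, Complex.exp_log (ne_zero_of_setNorm_sub_one_lt
          (h1.trans_lt hρ) T)]
        field_simp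
      · refine (setNorm_add_le _ _).trans ?_
        rw [Finset.card_insert_of_notMem hv]
        push_cast
        refine add_le_add hL' ((setNorm_log_le h1 hρ).trans ?_)
        rw [div_le_one (by linarith)]
        have : 1 / (2 * (D : ℝ)) ≤ 1 / 2 := by
          rw [div_le_div_iff₀ (by positivity) (by norm_num)]
          linarith
        linarith
  obtain ⟨L, hL, hL'⟩ := h Finset.univ
  refine ⟨L, fun T => ?_, ?_⟩
  · rw [hL, Finset.inter_univ]
  · exact hL'

/-! ### Connected sets -/

/-- Connected sets of vertices, including the empty set. -/
inductive Grown {V : Type*} [DecidableEq V] (a : V → V → Prop) : Finset V → Prop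
  | empty : Grown a ∅
  | insert {S : Finset V} {j : V} : Grown a S → j ∉ S → (S = ∅ ∨ ∃ k ∈ S, a k j) →
      Grown a (insert j S)

theorem Grown.exists_component_eq {S : Finset V} (h : Grown a S) (hS : S.Nonempty) :
    ∃ v, component a S v = S := by
  induction h with
  | empty => exact absurd hS (by simp)
  | @insert S j h hj hadj ih =>
    rcases hadj with rfl | ⟨k, hk, hkj⟩
    · refine ⟨j, Finset.Subset.antisymm (component_subset (by simp)) ?_⟩
      intro x hx
      obtain rfl : x = j := by simpa using hx
      exact mem_component_self
    · obtain ⟨v, hv⟩ := ih ⟨k, hk⟩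
      have hvS : v ∈ S := hv ▸ mem_component_self
      refine ⟨v, Finset.Subset.antisymm (component_subset (Finset.mem_insert_of_mem hvS)) ?_⟩
      have hsub : S ⊆ component a (Insert.insert j S) v := by
        conv_lhs => rw [← hv]
        exact component_mono (Finset.subset_insert _ _)
      refine Finset.insert_subset ?_ hsub
      exact mem_component_of_adj (hsub hk) (Finset.mem_insert_self _ _) hkj

/-- A set that is not connected splits into two nonempty sets without adjacent elements. -/
def Splits (a : V → V → Prop) (S : Finset V) : Prop :=
  ∃ A B : Finset V, A.Nonempty ∧ B.Nonempty ∧ (∀ x ∈ A, ∀ y ∈ B, ¬ a x y) ∧ A ∪ B = S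

/-- A largest nonempty connected subset is not all of `S`, and no element of the rest is adjacent to
it, by maximality. -/
theorem splits_of_not_grown {S : Finset V} (h : ¬ Grown a S) : Splits a S := by
  classical
  have hS : S.Nonempty := by
    rw [Finset.nonempty_iff_ne_empty]
    rintro rfl
    exact h .empty
  obtain ⟨v, hv⟩ := hS
  have hfin : (S.powerset.filter fun C => Grown a C ∧ C.Nonempty).Nonempty := by
    refine ⟨{v}, ?_⟩
    simp only [Finset.mem_filter, Finset.mem_powerset, Finset.singleton_subset_iff,
      Finset.singleton_nonempty, and_true]
    exact ⟨hv, by simpa using Grown.insert (j := v) (Grown.empty (a := a)) (by simp) (Or.inl rfl)⟩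
  obtain ⟨C, hC, hmax⟩ := Finset.exists_max_image _ Finset.card hfin
  simp only [Finset.mem_filter, Finset.mem_powerset] at hC hmax
  refine ⟨C, S \ C, hC.2.2, ?_, ?_, Finset.union_sdiff_of_subset hC.1⟩
  · rw [Finset.sdiff_nonempty]
    intro hSC
    exact h ((Finset.Subset.antisymm hC.1 hSC) ▸ hC.2.1)
  · intro x hx y hy hxy
    rw [Finset.mem_sdiff] at hy
    have := hmax (insert y C) ⟨Finset.insert_subset hy.1 hC.1,
      hC.2.1.insert hy.2 (Or.inr ⟨x, hx, hxy⟩), Finset.insert_nonempty _ _⟩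
    rw [Finset.card_insert_of_notMem hy.2] at this
    omega

-- A nonempty connected set is the component of the vertex from which it was grown, so the count of
-- components through a fixed vertex applies.
open scoped Classical in
theorem card_grown_le {D : ℕ} (hD1 : 1 ≤ D) (ha : ∀ x, a x x)
    (hD : ∀ v, (nbhd a {v}).card ≤ D) (k : ℕ) :
    ((Finset.univ : Finset (Finset V)).filter fun C => Grown a C ∧ C.card ≤ k).card ≤
      Fintype.card V * (4 * D) ^ k + 1 := by
  have h : ((Finset.univ : Finset (Finset V)).filter fun C => Grown a C ∧ C.card ≤ k) ⊆
      insert ∅ ((Finset.univ : Finset V).biUnion fun v => (Finset.univ : Finset (Finset V)).filter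
        fun C => component a C v = C ∧ C.card ≤ k) := by
    intro C hC
    simp only [Finset.mem_filter, Finset.mem_univ, true_and, Finset.mem_insert,
      Finset.mem_biUnion] at hC ⊢
    rcases C.eq_empty_or_nonempty with h | h
    · exact Or.inl h
    · obtain ⟨v, hv⟩ := hC.1.exists_component_eq h
      exact Or.inr ⟨v, hv, hC.2⟩
  refine (Finset.card_le_card h).trans ((Finset.card_insert_le _ _).trans ?_)
  refine Nat.add_le_add_right ?_ 1
  exact Finset.card_biUnion_le_card_mul _ _ _ fun v _ => card_component_le hD1 ha hD v k

theorem partition_union {A B : Finset V} (ha : ∀ x, a x x)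
    (hw : ∀ A B : Finset V, (∀ x ∈ A, ∀ y ∈ B, ¬ a x y) → w (A ∪ B) = w A * w B)
    (hAB : ∀ x ∈ A, ∀ y ∈ B, ¬ a x y) :
    partition w (A ∪ B) = partition w A * partition w B := by
  have hd : Disjoint A B := Finset.disjoint_left.2 fun x hA hB => hAB x hA x hB (ha x)
  rw [partition, partition, partition, Finset.sum_mul_sum, ← Finset.sum_product']
  refine Finset.sum_nbij' (fun R => (R ∩ A, R ∩ B)) (fun p => p.1 ∪ p.2) ?_ ?_ ?_ ?_ ?_
  · intro R _
    simp
  · intro p hp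
    simp only [Finset.mem_product, Finset.mem_powerset] at hp ⊢
    exact Finset.union_subset_union hp.1 hp.2
  · intro R hR
    rw [Finset.mem_powerset] at hR
    simp only
    rw [← Finset.inter_union_distrib_left, Finset.inter_eq_left.2 hR]
  · rintro ⟨P, Q⟩ hp
    simp only [Finset.mem_product, Finset.mem_powerset] at hp
    ext x
    · simp only [Finset.mem_inter, Finset.mem_union]
      exact ⟨fun h => h.1.resolve_right fun hx => Finset.disjoint_left.1 hd h.2 (hp.2 hx),
        fun h => ⟨Or.inl h, hp.1 h⟩⟩
    · simp only [Finset.mem_inter, Finset.mem_union]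
      exact ⟨fun h => h.1.resolve_left fun hx => Finset.disjoint_left.1 hd (hp.1 hx) h.2,
        fun h => ⟨Or.inr h, hp.2 h⟩⟩
  · intro R hR
    rw [Finset.mem_powerset] at hR
    rw [← hw]
    · simp only
      rw [← Finset.inter_union_distrib_left, Finset.inter_eq_left.2 hR]
    · intro x hx y hy
      exact hAB x (Finset.mem_inter.1 hx).2 y (Finset.mem_inter.1 hy).2

/-- Compare `partition w (A ∪ B)` with the product of those of `A` and `B`. Proper subsets that meet
both parts split again and have factor 1 by induction, so every factor cancels except the one at `A
∪ B`. -/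
theorem eq_one_of_splits {E : Finset V → ℂ} (ha : ∀ x, a x x)
    (hw : ∀ A B : Finset V, (∀ x ∈ A, ∀ y ∈ B, ¬ a x y) → w (A ∪ B) = w A * w B)
    (h0 : E ∅ = 1) (hE : ∀ S, E S ≠ 0) (hEw : ∀ T, partition w T = ∏ S ∈ T.powerset, E S)
    {S : Finset V} (hS : Splits a S) : E S = 1 := by
  induction S using Finset.strongInduction with
  | H S ih =>
    obtain ⟨A, B, hA, hB, hAB, rfl⟩ := hS
    have hd : Disjoint A B := Finset.disjoint_left.2 fun x hA hB => hAB x hA x hB (ha x)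
    have h1 := partition_union ha hw hAB
    rw [hEw, hEw, hEw, ← Finset.mul_prod_erase _ _ (Finset.mem_powerset_self (A ∪ B))] at h1
    have h2 : ∏ T ∈ (A ∪ B).powerset.erase (A ∪ B), E T =
        ∏ T ∈ A.powerset ∪ B.powerset, E T := by
      refine (Finset.prod_subset ?_ ?_).symm
      · intro T hT
        simp only [Finset.mem_union, Finset.mem_powerset, Finset.mem_erase] at hT ⊢
        rcases hT with hT | hT
        · refine ⟨?_, hT.trans Finset.subset_union_left⟩
          rintro rfl
          obtain ⟨y, hy⟩ := hB
          exact Finset.disjoint_left.1 hd (hT (Finset.mem_union_right _ hy)) hy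
        · refine ⟨?_, hT.trans Finset.subset_union_right⟩
          rintro rfl
          obtain ⟨y, hy⟩ := hA
          exact Finset.disjoint_left.1 hd hy (hT (Finset.mem_union_left _ hy))
      · intro T hT hT'
        simp only [Finset.mem_union, Finset.mem_powerset, Finset.mem_erase, not_or] at hT hT'
        refine ih T (hT.2.ssubset_of_ne hT.1) ⟨T ∩ A, T ∩ B, ?_, ?_, ?_, ?_⟩
        · obtain ⟨x, hx, hxB⟩ := Finset.not_subset.1 hT'.2
          exact ⟨x, Finset.mem_inter.2 ⟨hx, (Finset.mem_union.1 (hT.2 hx)).resolve_right hxB⟩⟩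
        · obtain ⟨x, hx, hxA⟩ := Finset.not_subset.1 hT'.1
          exact ⟨x, Finset.mem_inter.2 ⟨hx, (Finset.mem_union.1 (hT.2 hx)).resolve_left hxA⟩⟩
        · intro x hx y hy
          exact hAB x (Finset.mem_inter.1 hx).2 y (Finset.mem_inter.1 hy).2
        · rw [← Finset.inter_union_distrib_left, Finset.inter_eq_left.2 hT.2]
    have h3 : A.powerset ∩ B.powerset = {∅} := by
      ext T
      simp only [Finset.mem_inter, Finset.mem_powerset, Finset.mem_singleton]
      refine ⟨fun h => ?_, by rintro rfl; simp⟩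
      exact Finset.subset_empty.1 ((Finset.subset_inter h.1 h.2).trans
        (Finset.disjoint_iff_inter_eq_empty.1 hd).subset)
    have h4 := Finset.prod_union_inter (s₁ := A.powerset) (s₂ := B.powerset) (f := E)
    rw [h3, Finset.prod_singleton, h0, mul_one] at h4
    rw [h2, h4] at h1
    have h5 : (∏ T ∈ A.powerset, E T) * ∏ T ∈ B.powerset, E T ≠ 0 :=
      mul_ne_zero (Finset.prod_ne_zero_iff.2 fun _ _ => hE _)
        (Finset.prod_ne_zero_iff.2 fun _ _ => hE _)
    exact mul_right_cancel₀ h5 (by rw [h1, one_mul])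

/-- The partition function is approximated by a product over connected sets of bounded size. -/
theorem exists_factors {a' : V → V → Prop} {D : ℕ} {ε : ℝ} (hD1 : 1 ≤ D) (ha : ∀ x, a x x)
    (hD : ∀ v, (nbhd a {v}).card ≤ D) (h0 : w ∅ = 1)
    (hw : ∀ A B : Finset V, (∀ x ∈ A, ∀ y ∈ B, ¬ a x y) → w (A ∪ B) = w A * w B)
    (hε0 : 0 ≤ ε) (hε : 16 * D * ε ≤ 1) (hwε : ∀ R, ‖w R‖ ≤ ε ^ R.card) (ha' : ∀ x, a' x x)
    (hw' : ∀ A B : Finset V, (∀ x ∈ A, ∀ y ∈ B, ¬ a' x y) → w (A ∪ B) = w A * w B) :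
    ∃ E : Finset V → ℂ, (∀ S, E S ≠ 0) ∧ (∀ T, partition w T = ∏ S ∈ T.powerset, E S) ∧
      (∀ S, ¬ Grown a' S → E S = 1) ∧
      ∀ (k : ℕ) (δ : ℝ), Fintype.card V ≤ δ * 2 ^ k → ∀ s : Finset (Finset V),
        (∀ S, S ∈ s ↔ Grown a' S ∧ S.card ≤ k) →
        LogClose (partition w Finset.univ) (∏ S ∈ s, E S) δ := by
  classical
  -- The relation `a` enters only through the bound on the norm of `L`; connectedness in the
  -- conclusion refers to `a'`.
  obtain ⟨L, hL, hLn⟩ := exists_log_partition hD1 ha hD h0 hw hε0 hε hwε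
  have hprod : ∀ T, partition w T = ∏ S ∈ T.powerset, Complex.exp (mobius L S) := by
    intro T
    rw [← hL, ← sum_mobius L T, Complex.exp_sum]
  have hne : ∀ S, Complex.exp (mobius L S) ≠ 0 := fun S => Complex.exp_ne_zero _
  have hempty : Complex.exp (mobius L ∅) = 1 := by
    have := hprod ∅
    simp only [Finset.powerset_empty, Finset.prod_singleton] at this
    rw [← this]
    simp [partition, h0]
  have hone : ∀ S, ¬ Grown a' S → Complex.exp (mobius L S) = 1 := fun S hS =>
    eq_one_of_splits ha' hw' hempty hne hprod (splits_of_not_grown hS)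
  refine ⟨fun S => Complex.exp (mobius L S), hne, hprod, hone, ?_⟩
  intro k δ hk s hs
  -- For a small disconnected set only the exponential of the coefficient is known to be trivial.
  -- Such sets are left out of both sums, which is a choice of branch for the logarithm.
  refine ⟨∑ S ∈ s ∪ Finset.univ.filter (fun S => k < S.card), mobius L S,
    ∑ S ∈ s, mobius L S, ?_, Complex.exp_sum _ _, ?_⟩
  · rw [Complex.exp_sum, hprod Finset.univ]
    refine Finset.prod_subset (by simp) ?_
    intro S _ hS
    simp only [Finset.mem_union, hs, Finset.mem_filter, Finset.mem_univ, true_and, not_or,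
      not_lt] at hS
    exact hone S fun hg => hS.1 ⟨hg, hS.2⟩
  · rw [Finset.sum_union, add_sub_cancel_left]
    -- On the discarded sets the weight in `setNorm` is at least `2 ^ k`.
    · have h1 : (2 : ℝ) ^ k * ‖∑ S ∈ Finset.univ.filter (fun S : Finset V => k < S.card),
          mobius L S‖ ≤ setNorm L := by
        refine (mul_le_mul_of_nonneg_left (norm_sum_le _ _) (by positivity)).trans ?_
        rw [Finset.mul_sum, setNorm]
        refine (Finset.sum_le_sum fun S hS => ?_).trans
          (Finset.sum_le_sum_of_subset_of_nonneg (Finset.filter_subset _ _)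
            fun _ _ _ => by positivity)
        refine mul_le_mul_of_nonneg_right (pow_le_pow_right₀ one_le_two ?_) (norm_nonneg _)
        exact (Finset.mem_filter.1 hS).2.le
      have h2 : (0 : ℝ) < 2 ^ k := by positivity
      have h3 := (h1.trans hLn).trans hk
      rw [mul_comm] at h3
      exact le_of_mul_le_mul_right h3 h2
    · rw [Finset.disjoint_left]
      intro S hS hS'
      rw [hs] at hS
      simp only [Finset.mem_filter, Finset.mem_univ, true_and] at hS'
      omega

end Clusters

/-! ## Structured programs with time bounds -/

/-- Programs whose loops are marked as ordinary (`false`) or as loops over the gates (`true`). -/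
inductive Cmd where
  | skip
  | setN (a : ℕ) (i e : NExpr)
  | setC (a : ℕ) (i : NExpr) (z : CExpr)
  | seq (p q : Cmd)
  | ite (b : Test) (p q : Cmd)
  | loop (g : Bool) (b : Test) (p : Cmd)

namespace Cmd

def toProg : Cmd → Prog
  | skip => .skip
  | setN a i e => .setNat a i e
  | setC a i z => .setCpx a i z
  | seq p q => .seq p.toProg q.toProg
  | ite b p q => .ite b p.toProg q.toProg
  | loop _ b p => .while b p.toProg

/-- A bound on the running time if ordinary loops have at most `N` and gate loops at most `M`
iterations. -/
def bound (N M : ℕ) : Cmd → ℕ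
  | skip => 1
  | setN _ i e => i.cost + e.cost + 1
  | setC _ i z => i.cost + z.cost + 1
  | seq p q => p.bound N M + q.bound N M
  | ite b p q => b.cost + (p.bound N M + q.bound N M)
  | loop g b p => (bif g then M else N) * (b.cost + p.bound N M) + b.cost

/-- The length of a program. -/
def size : Cmd → ℕ
  | skip => 1
  | setN _ i e => i.cost + e.cost + 1
  | setC _ i z => i.cost + z.cost + 1
  | seq p q => p.size + q.size
  | ite b p q => b.cost + (p.size + q.size)
  | loop _ b p => b.cost + p.size

/-- The nesting depth of ordinary loops (`false`) or of gate loops (`true`). -/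
def depth (k : Bool) : Cmd → ℕ
  | skip => 0
  | setN _ _ _ => 0
  | setC _ _ _ => 0
  | seq p q => max (p.depth k) (q.depth k)
  | ite _ p q => max (p.depth k) (q.depth k)
  | loop g _ p => p.depth k + bif g == k then 1 else 0

/-- The time is polynomial with the nesting depths as exponents. A gate depth of 1 for the whole
program therefore makes its running time linear in the number of gates. -/
theorem bound_le (N M : ℕ) (c : Cmd) :
    c.bound N M ≤ c.size * ((N + 1) ^ c.depth false * (M + 1) ^ c.depth true) := by
  have hpos : ∀ a b : ℕ, 1 ≤ (N + 1) ^ a * (M + 1) ^ b := fun a b =>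
    Nat.one_le_iff_ne_zero.2 (by positivity)
  have hmono : ∀ a b a' b' : ℕ, a ≤ a' → b ≤ b' →
      (N + 1) ^ a * (M + 1) ^ b ≤ (N + 1) ^ a' * (M + 1) ^ b' := fun a b a' b' h h' =>
    Nat.mul_le_mul (Nat.pow_le_pow_right (Nat.succ_pos N) h)
      (Nat.pow_le_pow_right (Nat.succ_pos M) h')
  induction c with
  | skip => simp [bound, size, depth]
  | setN a i e => simp [bound, size, depth]
  | setC a i z => simp [bound, size, depth]
  | seq p q hp hq =>
    simp only [bound, size, depth, add_mul]
    exact Nat.add_le_add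
      (hp.trans (Nat.mul_le_mul_left _ (hmono _ _ _ _ (le_max_left _ _) (le_max_left _ _))))
      (hq.trans (Nat.mul_le_mul_left _ (hmono _ _ _ _ (le_max_right _ _) (le_max_right _ _))))
  | ite b p q hp hq =>
    simp only [bound, size, depth, add_mul]
    refine Nat.add_le_add (Nat.le_mul_of_pos_right _ (hpos _ _)) (Nat.add_le_add
      (hp.trans (Nat.mul_le_mul_left _ (hmono _ _ _ _ (le_max_left _ _) (le_max_left _ _))))
      (hq.trans (Nat.mul_le_mul_left _ (hmono _ _ _ _ (le_max_right _ _) (le_max_right _ _)))))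
  | loop g b p hp =>
    have h1 : b.cost + p.bound N M ≤ (b.cost + p.size) *
        ((N + 1) ^ p.depth false * (M + 1) ^ p.depth true) := by
      rw [add_mul]
      exact Nat.add_le_add (Nat.le_mul_of_pos_right _ (hpos _ _)) hp
    have h2 : (bif g then M else N) * (b.cost + p.bound N M) + b.cost ≤
        ((bif g then M else N) + 1) * (b.cost + p.bound N M) := by
      rw [add_mul, one_mul]
      exact Nat.add_le_add_left (Nat.le_add_right _ _) _
    refine h2.trans ((Nat.mul_le_mul_left _ h1).trans (le_of_eq ?_))
    cases g <;> simp [size, depth] <;> ring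

/-- Whether the natural-number array `a` is written. -/
def writesN (a : ℕ) : Cmd → Bool
  | skip => false
  | setN b _ _ => a == b
  | setC _ _ _ => false
  | seq p q => p.writesN a || q.writesN a
  | ite _ p q => p.writesN a || q.writesN a
  | loop _ _ p => p.writesN a

/-- Whether the complex array `a` is written. -/
def writesC (a : ℕ) : Cmd → Bool
  | skip => false
  | setN _ _ _ => false
  | setC b _ _ => a == b
  | seq p q => p.writesC a || q.writesC a
  | ite _ p q => p.writesC a || q.writesC a
  | loop _ _ p => p.writesC a

/-- `s'` differs from `s` at most in the arrays that `c` writes. -/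
structure Frame (c : Cmd) (s s' : Mem) : Prop where
  nat : ∀ a, c.writesN a = false → s'.nat a = s.nat a
  cpx : ∀ a, c.writesC a = false → s'.cpx a = s.cpx a

theorem Frame.refl (c : Cmd) (s : Mem) : c.Frame s s := ⟨fun _ _ => rfl, fun _ _ => rfl⟩

theorem Frame.trans {c : Cmd} {s s' s'' : Mem} (h : c.Frame s s') (h' : c.Frame s' s'') :
    c.Frame s s'' :=
  ⟨fun a ha => (h'.nat a ha).trans (h.nat a ha), fun a ha => (h'.cpx a ha).trans (h.cpx a ha)⟩

end Cmd

@[simp] theorem Mem.setNat_cpx (s : Mem) (a i v : ℕ) : (s.setNat a i v).cpx = s.cpx := rfl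

@[simp] theorem Mem.setCpx_nat (s : Mem) (a i : ℕ) (v : ℂ) : (s.setCpx a i v).nat = s.nat := rfl

@[simp] theorem Mem.setNat_nat_self (s : Mem) (a i v : ℕ) :
    (s.setNat a i v).nat a = Function.update (s.nat a) i v := by simp [Mem.setNat]

@[simp] theorem Mem.setCpx_cpx_self (s : Mem) (a i : ℕ) (v : ℂ) :
    (s.setCpx a i v).cpx a = Function.update (s.cpx a) i v := by simp [Mem.setCpx]

@[simp] theorem Mem.setNat_nat_of_ne (s : Mem) {a b : ℕ} (h : b ≠ a) (i v : ℕ) :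
    (s.setNat a i v).nat b = s.nat b := by simp [Mem.setNat, h]

@[simp] theorem Mem.setCpx_cpx_of_ne (s : Mem) {a b : ℕ} (h : b ≠ a) (i : ℕ) (v : ℂ) :
    (s.setCpx a i v).cpx b = s.cpx b := by simp [Mem.setCpx, h]

/-- The program `c` halts from `s` within its time bound, changes only the arrays that it writes,
and the final memory satisfies `Q`. -/
def Run (N M : ℕ) (c : Cmd) (s : Mem) (Q : Mem → Prop) : Prop :=
  ∃ t s', Exec c.toProg s t s' ∧ t ≤ c.bound N M ∧ c.Frame s s' ∧ Q s'

namespace Run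

variable {N M : ℕ} {c p q : Cmd} {s : Mem} {Q Q' : Mem → Prop}

theorem mono (h : Run N M c s Q) (hQ : ∀ s', c.Frame s s' → Q s' → Q' s') : Run N M c s Q' := by
  obtain ⟨t, s', h1, h2, h3, h4⟩ := h
  exact ⟨t, s', h1, h2, h3, hQ s' h3 h4⟩

theorem skip (h : Q s) : Run N M .skip s Q :=
  ⟨1, s, .skip s, le_rfl, .refl _ _, h⟩

theorem setN {a : ℕ} {i e : NExpr} (h : Q (s.setNat a (i.eval s) (e.eval s))) :
    Run N M (.setN a i e) s Q := by
  refine ⟨_, _, .setNat a i e s, le_rfl, ⟨fun b hb => ?_, fun b _ => rfl⟩, h⟩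
  exact Mem.setNat_nat_of_ne s (by simpa [Cmd.writesN] using hb) _ _

theorem setC {a : ℕ} {i : NExpr} {z : CExpr} (h : Q (s.setCpx a (i.eval s) (z.eval s))) :
    Run N M (.setC a i z) s Q := by
  refine ⟨_, _, .setCpx a i z s, le_rfl, ⟨fun b _ => rfl, fun b hb => ?_⟩, h⟩
  exact Mem.setCpx_cpx_of_ne s (by simpa [Cmd.writesC] using hb) _ _

theorem seq (h : Run N M p s fun s' => Run N M q s' Q) : Run N M (.seq p q) s Q := by
  obtain ⟨t, s', h1, h2, h3, t', s'', h1', h2', h3', h⟩ := h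
  refine ⟨_, _, .seq h1 h1', Nat.add_le_add h2 h2', ?_, h⟩
  refine ⟨fun a ha => ?_, fun a ha => ?_⟩
  · simp only [Cmd.writesN, Bool.or_eq_false_iff] at ha
    exact (h3'.nat a ha.2).trans (h3.nat a ha.1)
  · simp only [Cmd.writesC, Bool.or_eq_false_iff] at ha
    exact (h3'.cpx a ha.2).trans (h3.cpx a ha.1)

theorem ite {b : Test} (h1 : b.holds s → Run N M p s Q) (h2 : ¬ b.holds s → Run N M q s Q) :
    Run N M (.ite b p q) s Q := by
  by_cases hb : b.holds s
  · obtain ⟨t, s', h1, h2, h3, h⟩ := h1 hb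
    refine ⟨_, _, .iteTrue hb h1, ?_, ⟨fun a ha => ?_, fun a ha => ?_⟩, h⟩
    · exact Nat.add_le_add_left (h2.trans (Nat.le_add_right _ _)) _
    · simp only [Cmd.writesN, Bool.or_eq_false_iff] at ha
      exact h3.nat a ha.1
    · simp only [Cmd.writesC, Bool.or_eq_false_iff] at ha
      exact h3.cpx a ha.1
  · obtain ⟨t, s', h1, h2, h3, h⟩ := h2 hb
    refine ⟨_, _, .iteFalse hb h1, ?_, ⟨fun a ha => ?_, fun a ha => ?_⟩, h⟩
    · exact Nat.add_le_add_left (h2.trans (Nat.le_add_left _ _)) _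
    · simp only [Cmd.writesN, Bool.or_eq_false_iff] at ha
      exact h3.nat a ha.2
    · simp only [Cmd.writesC, Bool.or_eq_false_iff] at ha
      exact h3.cpx a ha.2

/-- The invariant is indexed by the number of completed iterations and must force `k < B` whenever
the test succeeds. It thus yields termination and the time bound together, by induction on the
number of iterations that remain. -/
theorem loop {g : Bool} {b : Test} (B : ℕ) (I : ℕ → Mem → Prop) (hB : B ≤ bif g then M else N)
    (h0 : I 0 s)
    (hstep : ∀ k s', p.Frame s s' → I k s' → b.holds s' → k < B ∧ Run N M p s' (I (k + 1)))
    (hend : ∀ k s', p.Frame s s' → I k s' → ¬ b.holds s' → Q s') :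
    Run N M (.loop g b p) s Q := by
  have key : ∀ j k s', p.Frame s s' → I k s' → B ≤ j + k →
      ∃ t s'', Exec (Cmd.loop g b p).toProg s' t s'' ∧ t ≤ j * (b.cost + p.bound N M) + b.cost ∧
        p.Frame s s'' ∧ Q s'' := by
    intro j
    induction j with
    | zero =>
      intro k s' hf hI hk
      have hb : ¬ b.holds s' := fun hb => by
        have := (hstep k s' hf hI hb).1
        omega
      exact ⟨_, _, .whileFalse hb, by simp, hf, hend k s' hf hI hb⟩
    | succ j ih =>
      intro k s' hf hI hk
      by_cases hb : b.holds s'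
      · obtain ⟨t, s1, h1, h2, h3, h⟩ := (hstep k s' hf hI hb).2
        obtain ⟨t', s2, h1', h2', h3', h'⟩ := ih (k + 1) s1 (hf.trans h3) h (by omega)
        refine ⟨_, _, .whileTrue hb h1 h1', ?_, h3', h'⟩
        rw [Nat.succ_mul]
        omega
      · exact ⟨_, _, .whileFalse hb, Nat.le_add_left _ _, hf, hend k s' hf hI hb⟩
  obtain ⟨t, s', h1, h2, h3, h⟩ := key B 0 s (.refl _ _) h0 (by simp)
  refine ⟨t, s', h1, h2.trans ?_, ⟨h3.nat, h3.cpx⟩, h⟩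
  exact Nat.add_le_add_right (Nat.mul_le_mul_right _ hB) _

end Run

/-- The entry `0` of the array `a`, used as a register. -/
abbrev NExpr.reg (a : ℕ) : NExpr := .get a (.const 0)

/-- Assignment to a register. -/
abbrev Cmd.setR (a : ℕ) (e : NExpr) : Cmd := .setN a (.const 0) e

/-- `for v < e do p`; the flag `g` marks loops over the gates. -/
def Cmd.for (g : Bool) (v : ℕ) (e : NExpr) (p : Cmd) : Cmd :=
  .seq (.setR v (.const 0))
    (.loop g (.natLt (.reg v) e) (.seq p (.setR v (.add (.reg v) (.const 1)))))

/-- The body has to establish the invariant for the memory in which the counter already holds `k +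
1`, since the increment comes last. The bound `e` is evaluated anew at each test and must keep its
value. -/
theorem Run.for {N M : ℕ} {p : Cmd} {s : Mem} {Q : Mem → Prop} {g : Bool} {v : ℕ} {e : NExpr}
    (B : ℕ) (I : ℕ → Mem → Prop) (hB : B ≤ bif g then M else N) (hv : p.writesN v = false)
    (he : ∀ s', (Cmd.for g v e p).Frame s s' → e.eval s' = B)
    (h0 : I 0 (s.setNat v 0 0))
    (hstep : ∀ k s', k < B → (Cmd.for g v e p).Frame s s' → s'.nat v 0 = k → I k s' →
      Run N M p s' fun s'' => I (k + 1) (s''.setNat v 0 (k + 1)))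
    (hend : ∀ s', (Cmd.for g v e p).Frame s s' → I B s' → Q s') :
    Run N M (Cmd.for g v e p) s Q := by
  have hfr : ∀ s', (Cmd.seq p (.setR v (.add (.reg v) (.const 1)))).Frame (s.setNat v 0 0) s' →
      (Cmd.for g v e p).Frame s s' := by
    intro s' h
    refine ⟨fun a ha => ?_, fun a ha => ?_⟩
    · simp only [Cmd.for, Cmd.writesN, Bool.or_eq_false_iff] at ha
      rw [h.nat a (by simp only [Cmd.writesN, Bool.or_eq_false_iff]; exact ha.2)]
      exact Mem.setNat_nat_of_ne _ (by simpa using ha.1) _ _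
    · simp only [Cmd.for, Cmd.writesC, Bool.or_eq_false_iff] at ha
      rw [h.cpx a (by simp only [Cmd.writesC, Bool.or_eq_false_iff]; exact ha.2)]
      rfl
  refine Run.seq (Run.setN ?_)
  refine Run.loop B (fun k s' => s'.nat v 0 = k ∧ k ≤ B ∧ I k s') hB
    ⟨by simp [NExpr.eval], Nat.zero_le _, h0⟩ ?_ ?_
  · intro k s' hf hI hb
    have hk : k < B := by
      simp only [Test.holds, NExpr.eval, hI.1, he s' (hfr s' hf)] at hb
      exact hb
    refine ⟨hk, Run.seq ((hstep k s' hk (hfr s' hf) hI.1 hI.2.2).mono fun s'' hf' h => ?_)⟩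
    have hk' : s''.nat v 0 = k := by rw [hf'.nat v hv, hI.1]
    refine Run.setN ⟨?_, hk, ?_⟩
    · simp [NExpr.eval, hk']
    · simpa only [NExpr.eval, hk'] using h
  · intro k s' hf hI hb
    simp only [Test.holds, NExpr.eval, hI.1, he s' (hfr s' hf)] at hb
    obtain rfl : k = B := by omega
    exact hend s' (hfr s' hf) hI.2.2

theorem Run.forN {N M : ℕ} {p : Cmd} {s : Mem} {Q : Mem → Prop} {v : ℕ} {e : NExpr}
    (B : ℕ) (I : ℕ → Mem → Prop) (hB : B ≤ N) (hv : p.writesN v = false)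
    (he : ∀ s', (Cmd.for false v e p).Frame s s' → e.eval s' = B)
    (h0 : I 0 (s.setNat v 0 0))
    (hstep : ∀ k s', k < B → (Cmd.for false v e p).Frame s s' → s'.nat v 0 = k → I k s' →
      Run N M p s' fun s'' => I (k + 1) (s''.setNat v 0 (k + 1)))
    (hend : ∀ s', (Cmd.for false v e p).Frame s s' → I B s' → Q s') :
    Run N M (Cmd.for false v e p) s Q :=
  Run.for B I hB hv he h0 hstep hend

theorem Run.forG {N M : ℕ} {p : Cmd} {s : Mem} {Q : Mem → Prop} {v : ℕ} {e : NExpr}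
    (B : ℕ) (I : ℕ → Mem → Prop) (hB : B ≤ M) (hv : p.writesN v = false)
    (he : ∀ s', (Cmd.for true v e p).Frame s s' → e.eval s' = B)
    (h0 : I 0 (s.setNat v 0 0))
    (hstep : ∀ k s', k < B → (Cmd.for true v e p).Frame s s' → s'.nat v 0 = k → I k s' →
      Run N M p s' fun s'' => I (k + 1) (s''.setNat v 0 (k + 1)))
    (hend : ∀ s', (Cmd.for true v e p).Frame s s' → I B s' → Q s') :
    Run N M (Cmd.for true v e p) s Q :=
  Run.for B I hB hv he h0 hstep hend

/-- The test `0 < e`. -/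
abbrev Test.pos (e : NExpr) : Test := .natLt (.const 0) e

/-! ## Data structures -/

section Data

variable {n : ℕ}

theorem getD_flatMap {α β : Type*} (L : List α) (f : α → List β) (d : β) {i j : ℕ}
    (hi : i < L.length) (hj : j < (f L[i]).length) :
    (L.flatMap f).getD (((L.take i).map fun x => (f x).length).sum + j) d = (f L[i]).getD j d := by
  induction L generalizing i with
  | nil => simp at hi
  | cons x L ih =>
    rw [List.flatMap_cons]
    cases i with
    | zero =>
      simp only [List.getElem_cons_zero] at hj ⊢
      simp [List.getElem?_append_left hj]
    | succ i =>
      simp only [List.getElem_cons_succ] at hj ⊢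
      have := ih (by simpa using hi) hj
      simp only [List.take_succ_cons, List.map_cons, List.sum_cons]
      rw [add_assoc, List.getD_append_right _ _ _ _ (Nat.le_add_right _ _), Nat.add_sub_cancel_left]
      exact this

/-- The position of the description of the gate `i` in the discrete input. -/
def natPos (K : Circuit n) (i : ℕ) : ℕ := 2 + ((K.take i).map fun g => g.arity + 1).sum

/-- The position of the entries of the gate `i` in the numerical input. -/
def cpxPos (K : Circuit n) (i : ℕ) : ℕ :=
  4 * n + 1 + ((K.take i).map fun g => 2 ^ g.arity * 2 ^ g.arity).sum

theorem natPos_succ (K : Circuit n) {i : ℕ} (hi : i < K.length) :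
    natPos K (i + 1) = natPos K i + (K[i].arity + 1) := by
  rw [natPos, natPos, List.take_add_one, List.getElem?_eq_getElem hi, Option.toList_some, List.map_append,
    List.sum_append]
  simp only [List.map_cons, List.map_nil, List.sum_cons, List.sum_nil]
  omega

theorem cpxPos_succ (K : Circuit n) {i : ℕ} (hi : i < K.length) :
    cpxPos K (i + 1) = cpxPos K i + 2 ^ K[i].arity * 2 ^ K[i].arity := by
  rw [cpxPos, cpxPos, List.take_add_one, List.getElem?_eq_getElem hi, Option.toList_some, List.map_append,
    List.sum_append]
  simp only [List.map_cons, List.map_nil, List.sum_cons, List.sum_nil]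
  omega

theorem natInput_getD (K : Circuit n) {i j : ℕ} (hi : i < K.length) (hj : j ≤ K[i].arity) :
    (natInput K).getD (natPos K i + j) 0 =
      (K[i].arity :: List.ofFn fun l => (K[i].qubits l : ℕ)).getD j 0 := by
  have h := getD_flatMap K (fun g => g.arity :: List.ofFn fun l => (g.qubits l : ℕ)) 0 hi
    (j := j) (by simp; omega)
  rw [← h, natInput, natPos]
  simp only [List.length_cons, List.length_ofFn]
  rw [show 2 + (List.map (fun g => g.arity + 1) (List.take i K)).sum + j =
    ((List.map (fun g => g.arity + 1) (List.take i K)).sum + j) + 1 + 1 by ring]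
  rw [List.getD_cons_succ, List.getD_cons_succ]

theorem natInput_arity (K : Circuit n) {i : ℕ} (hi : i < K.length) :
    (natInput K).getD (natPos K i) 0 = K[i].arity := by
  simpa using natInput_getD K hi (j := 0) (Nat.zero_le _)

theorem natInput_qubits (K : Circuit n) {i : ℕ} (hi : i < K.length) (j : Fin K[i].arity) :
    (natInput K).getD (natPos K i + 1 + j) 0 = K[i].qubits j := by
  rw [add_assoc, natInput_getD K hi (by omega), add_comm 1, List.getD_cons_succ]
  simp

theorem Gate.length_entries (g : Gate n) : g.entries.length = 2 ^ g.arity * 2 ^ g.arity := by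
  simp [Gate.entries]

theorem Gate.entries_getD (g : Gate n) {r c : ℕ} (hr : r < 2 ^ g.arity) (hc : c < 2 ^ g.arity) :
    g.entries.getD (r * 2 ^ g.arity + c) 0 = g.mat (bits g.arity r) (bits g.arity c) := by
  have h := getD_flatMap (List.range (2 ^ g.arity)) (fun r => (List.range (2 ^ g.arity)).map
    fun c => g.mat (bits g.arity r) (bits g.arity c)) 0 (i := r) (j := c)
    (by simpa using hr) (by simpa using hc)
  have e : ((List.take r (List.range (2 ^ g.arity))).map fun _ => 2 ^ g.arity).sum =
      r * 2 ^ g.arity := by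
    rw [List.map_const', List.sum_replicate, List.length_take, List.length_range,
      min_eq_left hr.le, smul_eq_mul]
  simp only [List.length_map, List.length_range] at h
  rw [e] at h
  rw [Gate.entries, h]
  simp [hc]

theorem cpxInput_tensor (K : Circuit n) (O : Fin n → Matrix Bool Bool ℂ) (δ : ℝ) (j : Fin n)
    {b : ℕ} (hb : b < 4) :
    (cpxInput K O δ).getD (1 + (j + j + j + j) + b) 0 =
      [O j false false, O j false true, O j true false, O j true true].getD b 0 := by
  have h := getD_flatMap (List.finRange n) (fun j =>
    [O j false false, O j false true, O j true false, O j true true]) 0 (i := j) (j := b)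
    (by simp) (by simpa using hb)
  have e : ((List.take j (List.finRange n)).map fun _ : Fin n => (4 : ℕ)).sum = (j : ℕ) * 4 := by
    rw [List.map_const', List.sum_replicate, List.length_take, List.length_finRange,
      min_eq_left j.isLt.le, smul_eq_mul]
  simp only [List.length_cons, List.length_nil, List.getElem_finRange, Fin.cast_mk, Fin.eta,
    Nat.reduceAdd] at h
  rw [e] at h
  rw [cpxInput, show 1 + ((j : ℕ) + j + j + j) + b = (j * 4 + b) + 1 by ring, List.getD_cons_succ,
    List.getD_append _ _ _ _ ?_, h]
  have := j.isLt
  simp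
  omega

theorem cpxInput_gate (K : Circuit n) (O : Fin n → Matrix Bool Bool ℂ) (δ : ℝ) {i : ℕ}
    (hi : i < K.length) {r c : ℕ} (hr : r < 2 ^ K[i].arity) (hc : c < 2 ^ K[i].arity) :
    (cpxInput K O δ).getD (cpxPos K i + r * 2 ^ K[i].arity + c) 0 =
      K[i].mat (bits K[i].arity r) (bits K[i].arity c) := by
  have hlt : r * 2 ^ K[i].arity + c < 2 ^ K[i].arity * 2 ^ K[i].arity := by
    calc _ < r * 2 ^ K[i].arity + 2 ^ K[i].arity := by omega
      _ = (r + 1) * 2 ^ K[i].arity := by ring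
      _ ≤ _ := Nat.mul_le_mul_right _ hr
  have h := getD_flatMap K Gate.entries 0 hi (j := r * 2 ^ K[i].arity + c)
    (by rwa [Gate.length_entries])
  rw [Gate.entries_getD _ hr hc] at h
  rw [← h, cpxInput, cpxPos]
  simp only [Gate.length_entries]
  rw [show ∀ x : ℕ, 4 * n + 1 + x + r * 2 ^ K[i].arity + c =
    (4 * n + (x + (r * 2 ^ K[i].arity + c))) + 1 by intro x; ring, List.getD_cons_succ,
    List.getD_append_right _ _ _ _ (by simp; omega)]
  congr 1
  simp
  omega

/-- The array contains, in row `q`, the indicator function of the set `A q`. -/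
def IsTable (n : ℕ) (f : ℕ → ℕ) (A : ℕ → Finset (Fin n)) : Prop :=
  ∀ (q : ℕ) (k : Fin n), f (q * n + k) = if k ∈ A q then 1 else 0

theorem row_index_eq_iff {q q' : ℕ} {k k' : Fin n} :
    q * n + k = q' * n + k' ↔ q = q' ∧ k = k' := by
  have hn : 0 < n := k.pos
  constructor
  · intro h
    have h1 := congrArg (· / n) h
    have h2 := congrArg (· % n) h
    simp only [Nat.mul_comm _ n, Nat.mul_add_div hn, Nat.div_eq_of_lt k.isLt,
      Nat.div_eq_of_lt k'.isLt, add_zero] at h1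
    simp only [Nat.mul_comm _ n, Nat.mul_add_mod, Nat.mod_eq_of_lt k.isLt,
      Nat.mod_eq_of_lt k'.isLt] at h2
    exact ⟨h1, Fin.ext h2⟩
  · rintro ⟨rfl, rfl⟩; rfl

theorem IsTable.insert {f : ℕ → ℕ} {A : ℕ → Finset (Fin n)} (h : IsTable n f A) (q : ℕ)
    (k : Fin n) :
    IsTable n (Function.update f (q * n + k) 1) (Function.update A q (insert k (A q))) := by
  intro q' k'
  simp only [Function.update_apply, row_index_eq_iff]
  by_cases hq : q' = q
  · subst hq
    by_cases hk : k' = k <;> simp [hk, h q' k']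
  · simp [hq, h q' k']

theorem IsTable.pos_iff {f : ℕ → ℕ} {A : ℕ → Finset (Fin n)} (h : IsTable n f A) {q : ℕ}
    {k : Fin n} : 0 < f (q * n + k) ↔ k ∈ A q := by
  rw [h q k]
  split_ifs with hk <;> simp [hk]

/-- The array `p` contains the positions of the gates in the discrete input `f`. -/
def IsLayout (K : Circuit n) (f p : ℕ → ℕ) : Prop :=
  ∀ (i : ℕ) (hi : i < K.length), f (p i) = K[i].arity ∧
    ∀ j : Fin K[i].arity, f (p i + 1 + j) = K[i].qubits j

theorem Gate.arity_le (g : Gate n) : g.arity ≤ n := by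
  simpa using Fintype.card_le_of_embedding g.qubits

end Data

/-! ## Layout lightcones of all qubits -/

section Futures

variable {n N M : ℕ} {K : Circuit n}

/-- The arity of the gate whose number is in the register `g`. -/
def arityExpr (g : ℕ) : NExpr := .get 0 (.get 13 (.reg g))

/-- The qubit of the gate in register `g` whose number is in the register `i`. -/
def qubitExpr (g i : ℕ) : NExpr := .get 0 (.add (.add (.get 13 (.reg g)) (.const 1)) (.reg i))

/-- The entry `k` of the row `q` of the table of layout lightcones. -/
def futureExpr (q k : NExpr) : NExpr := .get 23 (.add (.get 20 q) k)

/-- One pass decides whether the gate touches row `q`, and a second one adds its qubits; the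
decision must be made on the old row. Addresses need products with `n`, which are looked up in the
array `20` because the machine has no multiplication of natural numbers. -/
def spreadCmd : Cmd :=
  .seq (.setR 26 (.const 0)) <|
  .seq (.for false 27 (arityExpr 25)
    (.ite (.pos (futureExpr (.reg 24) (qubitExpr 25 27))) (.setR 26 (.const 1)) .skip)) <|
  .ite (.pos (.reg 26))
    (.for false 27 (arityExpr 25)
      (.setN 23 (.add (.get 20 (.reg 24)) (qubitExpr 25 27)) (.const 1))) .skip

theorem run_spreadCmd (hN : n ≤ N) {s : Mem} {i q : ℕ} (hi : i < K.length) (h25 : s.nat 25 0 = i)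
    (h24 : s.nat 24 0 = q) (hoff : s.nat 20 q = q * n) (hL : IsLayout K (s.nat 0) (s.nat 13))
    {A : ℕ → Finset (Fin n)} (hA : IsTable n (s.nat 23) A) :
    Run N M spreadCmd s fun s' =>
      IsTable n (s'.nat 23) (Function.update A q (K[i].spread (A q))) := by
  obtain ⟨har, hqu⟩ := hL i hi
  refine Run.seq (Run.setN (Run.seq ((Run.forN K[i].arity (fun k s' => (0 < s'.nat 26 0 ↔
    ∃ j : Fin K[i].arity, (j : ℕ) < k ∧ K[i].qubits j ∈ A q)) (K[i].arity_le.trans hN) rfl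
    ?_ ?_ ?_ fun s' _ h => h).mono ?_)))
  · intro s' hf
    simp [arityExpr, NExpr.eval, hf.nat 0 rfl, hf.nat 13 rfl, hf.nat 25 rfl, h25, har]
  · simp [NExpr.eval]
  · intro k s' hk hf h27 hI
    have hnew : (∃ j : Fin K[i].arity, (j : ℕ) < k + 1 ∧ K[i].qubits j ∈ A q) ↔
        (∃ j : Fin K[i].arity, (j : ℕ) < k ∧ K[i].qubits j ∈ A q) ∨ K[i].qubits ⟨k, hk⟩ ∈ A q := by
      constructor
      · rintro ⟨j, hj, h⟩
        rcases Nat.lt_succ_iff_lt_or_eq.1 hj with hj | hj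
        · exact Or.inl ⟨j, hj, h⟩
        · exact Or.inr (by convert h; exact hj.symm)
      · rintro (⟨j, hj, h⟩ | h)
        · exact ⟨j, by omega, h⟩
        · exact ⟨⟨k, hk⟩, by simp, h⟩
    have ht : (Test.pos (futureExpr (.reg 24) (qubitExpr 25 27))).holds s' ↔
        K[i].qubits ⟨k, hk⟩ ∈ A q := by
      have := hqu ⟨k, hk⟩
      simp only at this
      simp [Test.holds, futureExpr, qubitExpr, NExpr.eval, hf.nat 0 rfl, hf.nat 13 rfl,
        hf.nat 25 rfl, h25, hf.nat 24 rfl, h24, hf.nat 20 rfl, hoff, hf.nat 23 rfl, h27, this,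
        hA.pos_iff]
    refine Run.ite (fun hb => Run.setN ?_) (fun hb => Run.skip ?_)
    · rw [ht] at hb
      rw [hnew]
      simp [NExpr.eval, hb]
    · rw [ht] at hb
      rw [hnew]
      simpa [hb] using hI
  · intro s' hf hI
    have hI' : 0 < s'.nat 26 0 ↔ ∃ j : Fin K[i].arity, K[i].qubits j ∈ A q := by
      rw [hI]
      exact ⟨fun ⟨j, _, h⟩ => ⟨j, h⟩, fun ⟨j, h⟩ => ⟨j, j.isLt, h⟩⟩
    have hmem : (∃ j : Fin K[i].arity, K[i].qubits j ∈ A q) ↔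
        (K[i].support ∩ A q).Nonempty := by
      constructor
      · rintro ⟨j, h⟩
        exact ⟨_, Finset.mem_inter.2 ⟨Gate.mem_support.2 ⟨j, rfl⟩, h⟩⟩
      · rintro ⟨x, hx⟩
        rw [Finset.mem_inter, Gate.mem_support] at hx
        obtain ⟨⟨j, rfl⟩, h⟩ := hx
        exact ⟨j, h⟩
    refine Run.ite (fun hb => ?_) (fun hb => Run.skip ?_)
    · simp only [Test.holds, NExpr.eval, hI', hmem] at hb
      refine Run.forN K[i].arity (fun k s' => IsTable n (s'.nat 23) (Function.update A q
        (A q ∪ (Finset.univ.filter fun j : Fin K[i].arity => (j : ℕ) < k).map K[i].qubits)))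
        (K[i].arity_le.trans hN) rfl ?_ ?_ ?_ ?_
      · intro s'' hf'
        simp [arityExpr, NExpr.eval, hf.nat 0 rfl, hf.nat 13 rfl, hf.nat 25 rfl, h25, har,
          hf'.nat 0 rfl, hf'.nat 13 rfl, hf'.nat 25 rfl]
      · simpa [hf.nat 23 rfl] using hA
      · intro k s'' hk hf' h27 hI
        refine Run.setN ?_
        have h1 := hqu ⟨k, hk⟩
        simp only at h1
        have h2 := hI.insert q (K[i].qubits ⟨k, hk⟩)
        rw [Function.update_self, Function.update_idem, ← Finset.union_insert] at h2
        have h3 : insert (K[i].qubits ⟨k, hk⟩)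
            ((Finset.univ.filter fun j : Fin K[i].arity => (j : ℕ) < k).map K[i].qubits) =
            (Finset.univ.filter fun j : Fin K[i].arity => (j : ℕ) < k + 1).map K[i].qubits := by
          rw [← Finset.map_insert]
          congr 1
          ext j
          simp only [Finset.mem_insert, Finset.mem_filter, Finset.mem_univ, true_and, Fin.ext_iff]
          omega
        rw [h3] at h2
        simpa [NExpr.eval, qubitExpr, hf'.nat 24 rfl, hf'.nat 0 rfl, hf'.nat 13 rfl,
          hf'.nat 25 rfl, hf'.nat 20 rfl, hf.nat 24 rfl, hf.nat 0 rfl, hf.nat 13 rfl,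
          hf.nat 25 rfl, hf.nat 20 rfl, h24, h25, h27, hoff, h1] using h2
      · intro s'' _ hI
        have h1 : (Finset.univ.filter fun j : Fin K[i].arity => (j : ℕ) < K[i].arity) =
            Finset.univ := by ext j; simp
        rw [h1] at hI
        rw [Gate.spread, if_pos hb]
        exact hI
    · simp only [Test.holds, NExpr.eval, hI', hmem] at hb
      rw [Gate.spread, if_neg hb, Function.update_eq_self, hf.nat 23 rfl]
      simpa using hA

end Futures

/-! ### Tables computed from the input, and the choice of the cutoff. -/

section Preparation

variable {n N M : ℕ} {K : Circuit n} {s : Mem}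

/-- Row `q` of the table of layout lightcones. -/
def futureRow (K : Circuit n) (q : ℕ) : Finset (Fin n) :=
  if h : q < n then K.future ⟨q, h⟩ else ∅

def futuresCmd : Cmd :=
  .for false 24 (.reg 0) <|
    .seq (.setN 23 (.add (.get 20 (.reg 24)) (.reg 24)) (.const 1)) <|
    .for true 25 (.get 0 (.const 1)) spreadCmd

theorem run_futuresCmd (hN : n ≤ N) (hM : K.length ≤ M) (h0 : s.nat 0 0 = n)
    (h1 : s.nat 0 1 = K.length) (hL : IsLayout K (s.nat 0) (s.nat 13))
    (hoff : ∀ q < n, s.nat 20 q = q * n) (hz : ∀ i, s.nat 23 i = 0) :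
    Run N M futuresCmd s fun s' => IsTable n (s'.nat 23) (futureRow K) := by
  refine Run.forN n (fun k s' => IsTable n (s'.nat 23)
    (fun q => if q < k then futureRow K q else ∅)) hN rfl ?_ ?_ ?_ ?_
  · intro s' hf
    simp [NExpr.eval, hf.nat 0 rfl, h0]
  · intro q k
    simp [hz]
  · intro k s' hk hf h24 hI
    set A : ℕ → Finset (Fin n) := fun q => if q < k then futureRow K q else ∅ with hA
    have hAk : A k = ∅ := by simp [hA]
    refine Run.seq (Run.setN ?_)
    refine Run.forG K.length (fun i s'' => IsTable n (s''.nat 23)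
      (Function.update A k (Circuit.cone (K.take i).reverse {⟨k, hk⟩}))) hM rfl ?_ ?_ ?_ ?_
    · intro s'' hf'
      simp [NExpr.eval, hf'.nat 0 rfl, hf.nat 0 rfl, h1]
    · have h2 := hI.insert k ⟨k, hk⟩
      rw [hAk, insert_empty_eq] at h2
      simpa [NExpr.eval, h24, hf.nat 20 rfl, hoff k hk, Circuit.cone] using h2
    · intro i s'' hi hf' h25 hI'
      refine (run_spreadCmd (K := K) (q := k) hN hi h25 ?_ ?_ ?_ hI').mono ?_
      · simp [hf'.nat 24 rfl, h24]
      · simp [hf'.nat 20 rfl, hf.nat 20 rfl, hoff k hk]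
      · simpa [hf'.nat 0 rfl, hf'.nat 13 rfl, hf.nat 0 rfl, hf.nat 13 rfl] using hL
      · intro s3 _ h3
        rw [Function.update_self, Function.update_idem] at h3
        have e : K[i].spread (Circuit.cone (K.take i).reverse {⟨k, hk⟩}) =
            Circuit.cone (K.take (i + 1)).reverse {⟨k, hk⟩} := by
          rw [List.take_add_one, List.getElem?_eq_getElem hi, Option.toList_some,
            List.reverse_append]
          rfl
        rw [e] at h3
        simpa using h3
    · intro s'' _ hI'
      rw [List.take_length] at hI'
      have e : Function.update A k (Circuit.cone K.reverse {⟨k, hk⟩}) =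
          fun q => if q < k + 1 then futureRow K q else ∅ := by
        ext1 q
        by_cases hq : q = k
        · subst hq
          simp [futureRow, hk, Circuit.future]
        · have : q < k + 1 ↔ q < k := by omega
          simp only [Function.update_of_ne hq, hA, this]
      rw [e] at hI'
      simpa using hI'
  · intro s' _ hI
    have e : (fun q => if q < n then futureRow K q else ∅) = futureRow K := by
      ext1 q
      by_cases hq : q < n <;> simp [futureRow, hq]
    rwa [e] at hI

/-- The gates have descriptions of different lengths, so their positions are accumulated: `13` for
the discrete input and `14` for the matrix entries. Register `15` is quadrupled once per qubit and
ends as the number of entries of the gate matrix. -/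
def parseCmd : Cmd :=
  .seq (.setR 10 (.const 2)) <|
  .seq (.setR 11 (.add (.add (.add (.reg 0) (.reg 0)) (.add (.reg 0) (.reg 0))) (.const 1))) <|
  .for true 12 (.get 0 (.const 1)) <|
    .seq (.setN 13 (.reg 12) (.reg 10)) <|
    .seq (.setN 14 (.reg 12) (.reg 11)) <|
    .seq (.setR 15 (.const 1)) <|
    .seq (.for false 16 (.get 0 (.reg 10))
      (.setR 15 (.add (.add (.reg 15) (.reg 15)) (.add (.reg 15) (.reg 15))))) <|
    .seq (.setR 11 (.add (.reg 11) (.reg 15)))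
      (.setR 10 (.add (.reg 10) (.add (.get 0 (.reg 10)) (.const 1))))

theorem run_parseCmd (hN : n ≤ N) (hM : K.length ≤ M)
    (h0 : s.nat 0 = fun i => (natInput K).getD i 0) :
    Run N M parseCmd s fun s' => ∀ i < K.length, s'.nat 13 i = natPos K i ∧
      s'.nat 14 i = cpxPos K i := by
  have hn : s.nat 0 0 = n := by simp [h0, natInput]
  have hm : s.nat 0 1 = K.length := by simp [h0, natInput]
  refine Run.seq (Run.setN (Run.seq (Run.setN ?_)))
  refine Run.forG K.length (fun k s' => (s'.nat 10 0 = natPos K k ∧ s'.nat 11 0 = cpxPos K k) ∧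
    ∀ i < k, s'.nat 13 i = natPos K i ∧ s'.nat 14 i = cpxPos K i) hM rfl ?_ ?_ ?_ ?_
  · intro s' hf
    simp [NExpr.eval, hf.nat 0 rfl, hm]
  · simp [NExpr.eval, hn, natPos, cpxPos]
    ring
  · intro k s' hk hf h12 hI
    have hs0 : s'.nat 0 = s.nat 0 := by simp [hf.nat 0 rfl]
    have har : s'.nat 0 (natPos K k) = K[k].arity := by
      rw [hs0, h0]
      exact natInput_arity K hk
    obtain ⟨⟨h10, h11⟩, hI⟩ := hI
    refine Run.seq (Run.setN (Run.seq (Run.setN (Run.seq (Run.setN (Run.seq ?_))))))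
    refine (Run.forN K[k].arity (fun j s'' => s''.nat 15 0 = 2 ^ j * 2 ^ j)
      (K[k].arity_le.trans hN) rfl ?_ ?_ ?_ fun s'' _ h => h).mono ?_
    · intro s'' hf'
      simp [NExpr.eval, hf'.nat 0 rfl, hf'.nat 10 rfl, h10, har]
    · simp [NExpr.eval]
    · intro j s'' _ _ _ hj
      refine Run.setN ?_
      simp [NExpr.eval, hj]
      ring
    · intro s'' hf' h15
      refine Run.seq (Run.setN (Run.setN ?_))
      have h13 : s''.nat 13 = Function.update (s'.nat 13) k (natPos K k) := by
        simp [hf'.nat 13 rfl, NExpr.eval, h12, h10]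
      have h14 : s''.nat 14 = Function.update (s'.nat 14) k (cpxPos K k) := by
        simp [hf'.nat 14 rfl, NExpr.eval, h12, h11]
      refine ⟨⟨?_, ?_⟩, ?_⟩
      · simp [NExpr.eval, hf'.nat 10 rfl, hf'.nat 0 rfl, h10, har, natPos_succ K hk]
      · simp [NExpr.eval, hf'.nat 11 rfl, h11, h15, cpxPos_succ K hk]
      · intro i hi
        rcases Nat.lt_succ_iff_lt_or_eq.1 hi with hi | rfl
        · simp [h13, h14, hi.ne, hI i hi]
        · simp [h13, h14]
  · intro s' _ hI
    exact hI.2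

theorem isLayout_of_natPos {p : ℕ → ℕ} (hp : ∀ i < K.length, p i = natPos K i) :
    IsLayout K (fun i => (natInput K).getD i 0) p := by
  intro i hi
  rw [hp i hi]
  exact ⟨natInput_arity K hi, fun j => natInput_qubits K hi j⟩

/-- A real number cannot be converted to a natural number, so the cutoff is found by doubling `δ`
until it reaches `n` and counting the doublings in register `1`. -/
def levelsCmd : Cmd :=
  .seq (.setC 2 (.const 0) (.get 0 (.const 0))) <|
  .loop false (.reLt (.get 2 (.const 0)) (.ofNat (.reg 0))) <|
    .seq (.setC 2 (.const 0) (.add (.get 2 (.const 0)) (.get 2 (.const 0))))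
      (.setR 1 (.add (.reg 1) (.const 1)))

theorem run_levelsCmd {δ : ℝ} (h0 : s.nat 0 0 = n) (h1 : s.nat 1 0 = 0) (hδ : s.cpx 0 0 = δ)
    (hN : ∀ p : ℕ, δ * 2 ^ p < n → p < N) :
    Run N M levelsCmd s fun s' => (n : ℝ) ≤ δ * 2 ^ s'.nat 1 0 ∧
      ∀ p < s'.nat 1 0, δ * 2 ^ p < n := by
  refine Run.seq (Run.setC ?_)
  refine Run.loop N (fun k s' => s'.nat 1 0 = k ∧ s'.cpx 2 0 = (δ * 2 ^ k : ℝ) ∧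
    ∀ p < k, δ * 2 ^ p < n) le_rfl ?_ ?_ ?_
  · simp [NExpr.eval, CExpr.eval, h1, hδ]
  · intro k s' hf ⟨hk, hX, hp⟩ hb
    simp only [Test.holds, CExpr.eval, NExpr.eval, hX, hf.nat 0 rfl, Mem.setCpx_nat, h0,
      Complex.ofReal_re, Complex.natCast_re] at hb
    refine ⟨hN k hb, Run.seq (Run.setC (Run.setN ⟨?_, ?_, ?_⟩))⟩
    · simp [NExpr.eval, hk]
    · simp only [NExpr.eval, CExpr.eval, Mem.setNat_cpx, Mem.setCpx_cpx_self,
        Function.update_self, hX]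
      push_cast
      ring
    · intro p hp'
      rcases Nat.lt_succ_iff_lt_or_eq.1 hp' with hp' | rfl
      · exact hp p hp'
      · exact hb
  · intro k s' hf ⟨hk, hX, hp⟩ hb
    simp only [Test.holds, CExpr.eval, NExpr.eval, hX, hf.nat 0 rfl, Mem.setCpx_nat, h0,
      Complex.ofReal_re, Complex.natCast_re, not_lt] at hb
    rw [hk]
    exact ⟨hb, hp⟩

/-- Row offsets and powers of two are tabulated by repeated addition; they serve as addresses and as
masks of single qubits. -/
def tablesCmd : Cmd :=
  .seq (.setN 20 (.const 0) (.const 0)) <|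
  .seq (.setN 21 (.const 0) (.const 1)) <|
  .for false 17 (.reg 0) <|
    .seq (.setN 20 (.add (.reg 17) (.const 1)) (.add (.get 20 (.reg 17)) (.reg 0)))
      (.setN 21 (.add (.reg 17) (.const 1)) (.add (.get 21 (.reg 17)) (.get 21 (.reg 17))))

theorem run_tablesCmd (hN : n ≤ N) (h0 : s.nat 0 0 = n) :
    Run N M tablesCmd s fun s' => ∀ q ≤ n, s'.nat 20 q = q * n ∧ s'.nat 21 q = 2 ^ q := by
  refine Run.seq (Run.setN (Run.seq (Run.setN ?_)))
  refine Run.forN n (fun k s' => ∀ q ≤ k, s'.nat 20 q = q * n ∧ s'.nat 21 q = 2 ^ q) hN rfl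
    ?_ ?_ ?_ ?_
  · intro s' hf
    simp [NExpr.eval, hf.nat 0 rfl, h0]
  · intro q hq
    obtain rfl : q = 0 := by omega
    simp [NExpr.eval]
  · intro k s' hk hf h17 hI
    have hs0 : s'.nat 0 0 = n := by simp [hf.nat 0 rfl, h0]
    obtain ⟨h20, h21⟩ := hI k le_rfl
    refine Run.seq (Run.setN (Run.setN ?_))
    intro q hq
    rcases Nat.le_succ_iff.1 hq with hq | rfl
    · have : q ≠ k + 1 := by omega
      simp [NExpr.eval, h17, this, hI q hq]
    · simp [NExpr.eval, h17, h20, h21, hs0]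
      constructor <;> ring
  · intro s' _ hI
    exact hI

end Preparation

/-- A register that is only ever raised computes an existential statement; nested uses give nested
quantifiers. -/
theorem Run.flag {N M : ℕ} {p : Cmd} {s : Mem} {f v : ℕ} {e : NExpr} (B : ℕ) (P : ℕ → Prop)
    (hB : B ≤ N) (hfv : f ≠ v) (hv : p.writesN v = false)
    (he : ∀ s', (Cmd.for false v e p).Frame s s' → e.eval s' = B)
    (hstep : ∀ k s', k < B → (Cmd.for false v e p).Frame s s' → s'.nat v 0 = k →
      Run N M p s' fun s'' => (0 < s''.nat f 0 ↔ 0 < s'.nat f 0 ∨ P k)) :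
    Run N M (Cmd.for false v e p) s fun s' =>
      (0 < s'.nat f 0 ↔ 0 < s.nat f 0 ∨ ∃ k < B, P k) := by
  refine Run.forN B (fun k s' => (0 < s'.nat f 0 ↔ 0 < s.nat f 0 ∨ ∃ j < k, P j)) hB hv he
    ?_ ?_ fun s' _ h => h
  · simp [hfv]
  · intro k s' hk hf hvk hI
    refine (hstep k s' hk hf hvk).mono fun s'' _ h => ?_
    rw [Mem.setNat_nat_of_ne _ hfv, h, hI, or_assoc]
    refine or_congr_right ?_
    constructor
    · rintro (⟨j, hj, hP⟩ | hP)
      · exact ⟨j, by omega, hP⟩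
      · exact ⟨k, by omega, hP⟩
    · rintro ⟨j, hj, hP⟩
      rcases Nat.lt_succ_iff_lt_or_eq.1 hj with hj | hj
      · exact Or.inl ⟨j, hj, hP⟩
      · exact Or.inr (hj ▸ hP)

theorem Run.setFlag {N M : ℕ} {s : Mem} {f : ℕ} {b : Test} {P : Prop} (hb : b.holds s ↔ P) :
    Run N M (.ite b (.setR f (.const 1)) .skip) s fun s' =>
      (0 < s'.nat f 0 ↔ 0 < s.nat f 0 ∨ P) := by
  refine Run.ite (fun h => Run.setN ?_) (fun h => Run.skip ?_)
  · rw [hb] at h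
    simp [NExpr.eval, h]
  · rw [hb] at h
    simp [h]

/-! ### Sets of qubits encoded as binary numbers. -/

section Masks

variable {n : ℕ}

/-- The number whose binary digits are the indicator function of `S`. -/
def setMask (S : Finset (Fin n)) : ℕ := ∑ j ∈ S, 2 ^ (j : ℕ)

theorem testBit_setMask (S : Finset (Fin n)) (j : Fin n) :
    (setMask S).testBit j = decide (j ∈ S) := by
  have h1 : setMask S = ∑ i ∈ S.map Fin.valEmbedding, 2 ^ i := by
    rw [setMask, Finset.sum_map]; rfl
  have h2 : (j : ℕ) ∈ (setMask S).bitIndices.toFinset ↔ j ∈ S := by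
    rw [h1, Finset.toFinset_bitIndices_sum_two_pow]
    simp [Fin.val_inj]
  rw [List.mem_toFinset, Nat.mem_bitIndices] at h2
  by_cases h : j ∈ S <;> simp_all

theorem setMask_injective : Function.Injective (setMask : Finset (Fin n) → ℕ) := by
  intro S T h
  ext j
  have h1 := testBit_setMask S j
  rw [h, testBit_setMask] at h1
  exact (decide_eq_decide.1 h1).symm

theorem setMask_insert {S : Finset (Fin n)} {j : Fin n} (hj : j ∉ S) :
    setMask (insert j S) = setMask S + 2 ^ (j : ℕ) := by
  rw [setMask, Finset.sum_insert hj, add_comm]; rfl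

theorem setMask_empty : setMask (∅ : Finset (Fin n)) = 0 := rfl

theorem filter_val_lt_succ (A : Finset (Fin n)) {k : ℕ} (hk : k < n) :
    (A.filter fun i : Fin n => (i : ℕ) < k + 1) =
      if (⟨k, hk⟩ : Fin n) ∈ A then insert ⟨k, hk⟩ (A.filter fun i : Fin n => (i : ℕ) < k)
      else A.filter fun i : Fin n => (i : ℕ) < k := by
  ext i
  rcases lt_trichotomy (i : ℕ) k with h | h | h
  · have h1 : i ≠ ⟨k, hk⟩ := fun e => by simp [e] at h
    split_ifs <;> simp [h1, h, h.le]
  · obtain rfl : i = ⟨k, hk⟩ := Fin.ext h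
    split_ifs with h2 <;> simp [h2]
  · have h1 : i ≠ ⟨k, hk⟩ := fun e => by simp [e] at h
    split_ifs <;> simp [h1, h.not_ge, h.not_gt]

theorem filter_val_lt_self (A : Finset (Fin n)) : (A.filter fun i : Fin n => (i : ℕ) < n) = A := by
  ext i; simp

theorem filter_val_lt_zero (A : Finset (Fin n)) : (A.filter fun i : Fin n => (i : ℕ) < 0) = ∅ := by
  ext i; simp

end Masks

/-! ## The list of connected sets -/

section Enumeration

variable {n N M : ℕ} {K : Circuit n} {s : Mem} {L : List (Finset (Fin n))}

/-- The arrays `rows`, `ro`, `mask`, `seen` and the counter `cnt` represent the list `L` of sets. -/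
structure IsList (L : List (Finset (Fin n))) (rows ro mask seen : ℕ → ℕ) (cnt : ℕ) : Prop where
  cnt : cnt = L.length
  rows : IsTable n rows fun e => L.getD e ∅
  ro : ∀ e ≤ L.length, ro e = e * n
  mask : ∀ e < L.length, mask e = setMask (L.getD e ∅)
  seen : ∀ x, 0 < seen x ↔ ∃ S ∈ L, setMask S = x

abbrev Mem.IsList (L : List (Finset (Fin n))) (s : Mem) : Prop :=
  MeanValue.IsList L (s.nat 30) (s.nat 22) (s.nat 31) (s.nat 32) (s.nat 33 0)

/-- The membership of `k` in the set number `e`. -/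
def rowExpr (e k : NExpr) : NExpr := .get 30 (.add (.get 22 e) k)

def maskExpr : NExpr := .add (.get 31 (.reg 36)) (.get 21 (.reg 37))

def appendCmd : Cmd :=
  .seq (.for false 41 (.reg 0) (.ite (.pos (rowExpr (.reg 36) (.reg 41)))
    (.setN 30 (.add (.get 22 (.reg 33)) (.reg 41)) (.const 1)) .skip)) <|
  .seq (.setN 30 (.add (.get 22 (.reg 33)) (.reg 37)) (.const 1)) <|
  .seq (.setN 31 (.reg 33) maskExpr) <|
  .seq (.setN 32 maskExpr (.const 1)) <|
  .seq (.setN 22 (.add (.reg 33) (.const 1)) (.add (.get 22 (.reg 33)) (.reg 0)))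
    (.setR 33 (.add (.reg 33) (.const 1)))

theorem run_appendCmd (hN : n ≤ N) (h0 : s.nat 0 0 = n) (hpw : ∀ q ≤ n, s.nat 21 q = 2 ^ q)
    {e : ℕ} (he : e < L.length) (h36 : s.nat 36 0 = e) {j : Fin n} (h37 : s.nat 37 0 = j)
    (hj : j ∉ L.getD e ∅) (hL : s.IsList L) :
    Run N M appendCmd s fun s' => s'.IsList (L ++ [insert j (L.getD e ∅)]) := by
  -- The default value `∅` says that rows beyond the end of the list are still zero, so copying a
  -- set has to write only its ones.
  refine Run.seq ((Run.forN n (fun k s' => IsTable n (s'.nat 30) (Function.update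
    (fun e => L.getD e ∅) L.length ((L.getD e ∅).filter fun i : Fin n => (i : ℕ) < k))) hN rfl ?_ ?_ ?_
    fun s' _ h => h).mono ?_)
  · intro s' hf
    simp [NExpr.eval, hf.nat 0 rfl, h0]
  · have e : Function.update (fun e => L.getD e ∅) L.length
        ((L.getD e ∅).filter fun i : Fin n => (i : ℕ) < 0) = fun e => L.getD e ∅ := by
      simp
    rw [e]
    simpa using hL.rows
  · intro k s' hk hf h41 hI
    have ht : (Test.pos (rowExpr (.reg 36) (.reg 41))).holds s' ↔ (⟨k, hk⟩ : Fin n) ∈ L.getD e ∅ := by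
      have h := hI.pos_iff (q := e) (k := ⟨k, hk⟩)
      rw [Function.update_of_ne he.ne] at h
      simpa [Test.holds, rowExpr, NExpr.eval, hf.nat 36 rfl, h36, hf.nat 22 rfl,
        hL.ro e he.le, h41] using h
    refine Run.ite (fun hb => Run.setN ?_) (fun hb => Run.skip ?_)
    · rw [ht] at hb
      rw [filter_val_lt_succ _ hk, if_pos hb]
      have h := hI.insert L.length ⟨k, hk⟩
      rw [Function.update_self, Function.update_idem] at h
      simpa [NExpr.eval, hf.nat 22 rfl, hf.nat 33 rfl, hL.cnt, hL.ro, h41] using h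
    · rw [ht] at hb
      rw [filter_val_lt_succ _ hk, if_neg hb]
      simpa using hI
  · intro s' hf hI
    rw [filter_val_lt_self] at hI
    have h21 : s'.nat 21 = s.nat 21 := hf.nat 21 rfl
    have h22 : s'.nat 22 = s.nat 22 := hf.nat 22 rfl
    have h31 : s'.nat 31 = s.nat 31 := hf.nat 31 rfl
    have h32 : s'.nat 32 = s.nat 32 := hf.nat 32 rfl
    have h33 : s'.nat 33 = s.nat 33 := hf.nat 33 rfl
    have h36' : s'.nat 36 0 = e := by rw [hf.nat 36 rfl, h36]
    have h37' : s'.nat 37 0 = j := by rw [hf.nat 37 rfl, h37]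
    have h0' : s'.nat 0 0 = n := by rw [hf.nat 0 rfl, h0]
    have hmask : s.nat 31 e + s.nat 21 j = setMask (insert j (L.getD e ∅)) := by
      rw [setMask_insert hj, hL.mask e he, hpw j j.isLt.le]
    have hgetD : ∀ i, (L ++ [insert j (L.getD e ∅)]).getD i ∅ =
        Function.update (fun e => L.getD e ∅) L.length (insert j (L.getD e ∅)) i := by
      intro i
      rcases lt_trichotomy i L.length with h | h | h
      · rw [List.getD_append _ _ _ _ h, Function.update_of_ne h.ne]
      · subst h
        rw [List.getD_append_right _ _ _ _ le_rfl]
        simp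
      · rw [Function.update_of_ne h.ne', List.getD_eq_default _ _ h.le,
          List.getD_eq_default _ _ (by simpa using h)]
    refine Run.seq (Run.setN (Run.seq (Run.setN (Run.seq (Run.setN (Run.seq (Run.setN
      (Run.setN ?_))))))))
    constructor
    · simp [NExpr.eval, h33, hL.cnt]
    · have h := hI.insert L.length j
      rw [Function.update_self, Function.update_idem] at h
      simp only [hgetD]
      simpa [NExpr.eval, h33, h22, h37', hL.cnt, hL.ro] using h
    · intro i hi
      rw [List.length_append, List.length_singleton] at hi
      by_cases h : i = L.length + 1
      · subst h
        simp [NExpr.eval, h33, h22, h0', hL.cnt, hL.ro]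
        ring
      · simp [NExpr.eval, h33, h22, hL.cnt, h, hL.ro i (by omega)]
    · intro i hi
      rw [List.length_append, List.length_singleton] at hi
      rw [hgetD]
      by_cases h : i = L.length
      · subst h
        simpa [NExpr.eval, maskExpr, h33, h31, h21, h36', h37', hL.cnt] using hmask
      · rw [Function.update_of_ne h]
        simpa [NExpr.eval, maskExpr, h33, h31, h21, h36', h37', hL.cnt, h] using
          hL.mask i (by omega)
    · intro x
      have h1 := hL.seen x
      have h2 : e ≠ L.length := he.ne
      by_cases hx : x = setMask (insert j (L.getD e ∅))
      · subst hx
        simp only [List.getD_eq_getElem?_getD] at hmask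
        simp [NExpr.eval, maskExpr, h33, h31, h32, h21, h36', h37', hL.cnt, hmask, h2]
      · rw [← hmask] at hx
        have hx' : setMask (insert j (L.getD e ∅)) ≠ x := by rw [← hmask]; exact Ne.symm hx
        simp only [List.getD_eq_getElem?_getD] at hx'
        simp [NExpr.eval, maskExpr, h33, h31, h32, h21, h36', h37', hL.cnt, hx, h2, h1, or_and_right,
          exists_or, hx']

/-- Set number 0 is the empty set; the first test lets every single qubit start a connected set. The
loops then look for a witness `q` whose future contains both the new qubit and a member of the set.
-/
def adjCmd : Cmd :=
  .seq (.setR 38 (.const 0)) <|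
  .seq (.ite (.natLt (.reg 36) (.const 1)) (.setR 38 (.const 1)) .skip) <|
  .for false 39 (.reg 0) <| .for false 40 (.reg 0) <|
    .ite (.and (.pos (futureExpr (.reg 39) (.reg 37))) (.and (.pos (futureExpr (.reg 39) (.reg 40)))
      (.pos (rowExpr (.reg 36) (.reg 40))))) (.setR 38 (.const 1)) .skip

theorem run_adjCmd (hN : n ≤ N) (h0 : s.nat 0 0 = n) (hoff : ∀ q < n, s.nat 20 q = q * n)
    (hF : IsTable n (s.nat 23) (futureRow K))
    {e : ℕ} (he : e < L.length) (h36 : s.nat 36 0 = e) {j : Fin n} (h37 : s.nat 37 0 = j)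
    (hL : s.IsList L) :
    Run N M adjCmd s fun s' => (0 < s'.nat 38 0 ↔ e = 0 ∨ ∃ k ∈ L.getD e ∅, K.Adj k j) := by
  refine Run.seq (Run.setN (Run.seq ((Run.setFlag (f := 38) (P := e = 0) ?_).mono ?_)))
  · simp [Test.holds, NExpr.eval, h36]
  · intro s1 hf1 h1
    refine (Run.flag (f := 38) n (fun q => ∃ k < n, ∃ (hq : q < n) (hk : k < n),
      j ∈ K.future ⟨q, hq⟩ ∧ (⟨k, hk⟩ : Fin n) ∈ K.future ⟨q, hq⟩ ∧ (⟨k, hk⟩ : Fin n) ∈ L.getD e ∅)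
      hN (by decide) rfl ?_ ?_).mono ?_
    · intro s2 hf2
      simp [NExpr.eval, hf2.nat 0 rfl, hf1.nat 0 rfl, h0]
    · intro q s2 hq hf2 h39
      refine Run.flag (f := 38) n _ hN (by decide) rfl ?_ ?_
      · intro s3 hf3
        simp [NExpr.eval, hf3.nat 0 rfl, hf2.nat 0 rfl, hf1.nat 0 rfl, h0]
      · intro k s3 hk hf3 h40
        refine Run.setFlag ?_
        have hr : futureRow K q = K.future ⟨q, hq⟩ := by simp [futureRow, hq]
        have e1 := hF.pos_iff (q := q) (k := j)
        have e2 := hF.pos_iff (q := q) (k := ⟨k, hk⟩)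
        have e3 := hL.rows.pos_iff (q := e) (k := ⟨k, hk⟩)
        rw [hr] at e1 e2
        simp only [Test.holds, futureExpr, rowExpr, NExpr.eval, hf3.nat 39 rfl,
          hf3.nat 37 rfl, hf3.nat 36 rfl, hf3.nat 20 rfl, hf3.nat 23 rfl, hf3.nat 22 rfl,
          hf3.nat 30 rfl, hf2.nat 37 rfl, hf2.nat 36 rfl, hf2.nat 20 rfl, hf2.nat 23 rfl,
          hf2.nat 22 rfl, hf2.nat 30 rfl, hf1.nat 37 rfl, hf1.nat 36 rfl, hf1.nat 20 rfl,
          hf1.nat 23 rfl, hf1.nat 22 rfl, hf1.nat 30 rfl, h39, h40]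
        simp only [ne_eq, Nat.reduceEqDiff, not_false_eq_true,
          Mem.setNat_nat_of_ne, h37, h36, hoff q hq, hL.ro e he.le, e1, e2, e3]
        exact ⟨fun h => ⟨hq, hk, h⟩, fun ⟨_, _, h⟩ => h⟩
    · intro s2 _ h2
      rw [h2, h1]
      simp only [Mem.setNat_nat_self, NExpr.eval, Function.update_self, lt_irrefl, false_or]
      refine or_congr_right ⟨?_, ?_⟩
      · rintro ⟨q, _, k, _, hq, hk, h3, h4, h5⟩
        exact ⟨⟨k, hk⟩, h5, ⟨q, hq⟩, h4, h3⟩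
      · rintro ⟨k, hk, q, h3, h4⟩
        exact ⟨q, q.isLt, k, k.isLt, q.isLt, k.isLt, h4, h3, hk⟩

def extendCmd : Cmd :=
  .ite (.and (.not (.pos (rowExpr (.reg 36) (.reg 37)))) (.not (.pos (.get 32 maskExpr))))
    (.seq adjCmd (.ite (.pos (.reg 38)) appendCmd .skip)) .skip

/-- The qubit `j` can be added to the set number `e`. -/
def Extends (K : Circuit n) (L : List (Finset (Fin n))) (e : ℕ) (j : Fin n) : Prop :=
  j ∉ L.getD e ∅ ∧ (e = 0 ∨ ∃ k ∈ L.getD e ∅, K.Adj k j)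

theorem run_extendCmd (hN : n ≤ N) (h0 : s.nat 0 0 = n) (hoff : ∀ q < n, s.nat 20 q = q * n)
    (hpw : ∀ q ≤ n, s.nat 21 q = 2 ^ q) (hF : IsTable n (s.nat 23) (futureRow K))
    {e : ℕ} (he : e < L.length) (h36 : s.nat 36 0 = e) {j : Fin n} (h37 : s.nat 37 0 = j)
    (hL : s.IsList L) :
    Run N M extendCmd s fun s' =>
      (s'.IsList L ∧ (Extends K L e j → insert j (L.getD e ∅) ∈ L)) ∨
      (s'.IsList (L ++ [insert j (L.getD e ∅)]) ∧ Extends K L e j ∧ insert j (L.getD e ∅) ∉ L) := by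
  have ht1 : (Test.pos (rowExpr (.reg 36) (.reg 37))).holds s ↔ j ∈ L.getD e ∅ := by
    have h := hL.rows.pos_iff (q := e) (k := j)
    simpa only [Test.holds, rowExpr, NExpr.eval, h36, h37, hL.ro e he.le] using h
  -- Adding `2 ^ j` to a mask describes the enlarged set only if `j` is new. Looking up the sum in
  -- the array `32` then detects duplicates without comparing sets.
  have ht2 : j ∉ L.getD e ∅ →
      ((Test.pos (.get 32 maskExpr)).holds s ↔ insert j (L.getD e ∅) ∈ L) := by
    intro hj
    have h : s.nat 31 e + s.nat 21 j = setMask (insert j (L.getD e ∅)) := by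
      rw [setMask_insert hj, hL.mask e he, hpw j j.isLt.le]
    simp only [Test.holds, maskExpr, NExpr.eval, h36, h37, h, hL.seen]
    constructor
    · rintro ⟨S, hS, h⟩
      rwa [← setMask_injective h]
    · exact fun h => ⟨_, h, rfl⟩
  refine Run.ite (fun hb => ?_) (fun hb => Run.skip (Or.inl ⟨hL, fun hext => ?_⟩))
  · obtain ⟨hb1, hb2⟩ := hb
    have hj : j ∉ L.getD e ∅ := fun h => hb1 (ht1.2 h)
    have hnew : insert j (L.getD e ∅) ∉ L := fun h => hb2 ((ht2 hj).2 h)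
    refine Run.seq ((run_adjCmd hN h0 hoff hF he h36 h37 hL).mono fun s1 hf1 h38 => ?_)
    have hL1 : s1.IsList L := by
      simpa only [Mem.IsList, hf1.nat 30 rfl, hf1.nat 22 rfl, hf1.nat 31 rfl, hf1.nat 32 rfl,
        hf1.nat 33 rfl] using hL
    refine Run.ite (fun hb => ?_) (fun hb => Run.skip (Or.inl ⟨hL1, fun hext => ?_⟩))
    · refine (run_appendCmd hN (by rw [hf1.nat 0 rfl, h0]) (by rwa [hf1.nat 21 rfl]) he
        (by rw [hf1.nat 36 rfl, h36]) (by rw [hf1.nat 37 rfl, h37]) hj hL1).mono ?_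
      intro s2 _ h2
      exact Or.inr ⟨h2, ⟨hj, h38.1 hb⟩, hnew⟩
    · exact absurd (h38.2 hext.2) hb
  · by_contra hnew
    exact hb ⟨fun h => hext.1 (ht1.1 h), fun h => hnew ((ht2 hext.1).1 h)⟩

/-- The list contains the connected sets of size at most `r`, sorted by size. -/
structure IsComplete (K : Circuit n) (r : ℕ) (L : List (Finset (Fin n))) : Prop where
  head : L.getD 0 ∅ = ∅
  nodup : L.Nodup
  sorted : L.Pairwise fun S T => S.card ≤ T.card
  mem : ∀ S, S ∈ L ↔ Grown K.Adj S ∧ S.card ≤ r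

theorem isComplete_zero (K : Circuit n) : IsComplete K 0 [∅] := by
  refine ⟨rfl, by simp, by simp, fun S => ?_⟩
  rw [List.mem_singleton]
  constructor
  · rintro rfl
    exact ⟨.empty, by simp⟩
  · intro h
    exact Finset.card_eq_zero.1 (Nat.le_zero.1 h.2)

/-- Extensions of the sets in the complete list `L` by the pairs in `P`. -/
structure IsPartial (K : Circuit n) (r : ℕ) (L X : List (Finset (Fin n)))
    (P : ℕ → Fin n → Prop) : Prop where
  nodup : (L ++ X).Nodup
  grown : ∀ S ∈ X, Grown K.Adj S ∧ S.card = r + 1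
  mem : ∀ e < L.length, ∀ j, P e j → Extends K L e j → insert j (L.getD e ∅) ∈ L ++ X

theorem IsComplete.grown_insert {r : ℕ} (hL : IsComplete K r L) {e : ℕ} (he : e < L.length)
    {j : Fin n} (h : Extends K L e j) : Grown K.Adj (insert j (L.getD e ∅)) := by
  have hmem : L.getD e ∅ ∈ L := by
    rw [List.getD_eq_getElem _ _ he]
    exact List.getElem_mem he
  refine ((hL.mem _).1 hmem).1.insert h.1 (h.2.imp (fun h0 => ?_) id)
  rw [h0, hL.head]

theorem IsComplete.succ {r : ℕ} {X : List (Finset (Fin n))} (hL : IsComplete K r L)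
    (hX : IsPartial K r L X fun _ _ => True) : IsComplete K (r + 1) (L ++ X) := by
  have h0 : 0 < L.length := List.length_pos_of_mem ((hL.mem ∅).2 ⟨.empty, by simp⟩)
  refine ⟨?_, hX.nodup, ?_, fun S => ⟨fun h => ?_, fun h => ?_⟩⟩
  · rw [List.getD_append _ _ _ _ h0, hL.head]
  · rw [List.pairwise_append]
    refine ⟨hL.sorted, ?_, fun S hS T hT => ?_⟩
    · exact List.pairwise_of_forall_mem_list fun S hS T hT => by
        rw [(hX.grown S hS).2, (hX.grown T hT).2]
    · rw [(hX.grown T hT).2]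
      exact ((hL.mem S).1 hS).2.trans (Nat.le_succ r)
  · rcases List.mem_append.1 h with h | h
    · exact ⟨((hL.mem S).1 h).1, ((hL.mem S).1 h).2.trans (Nat.le_succ r)⟩
    · exact ⟨(hX.grown S h).1, (hX.grown S h).2.le⟩
  · obtain ⟨hg, hc⟩ := h
    cases hg with
    | empty => exact List.mem_append_left _ ((hL.mem ∅).2 ⟨.empty, by simp⟩)
    | @insert T j hg hj hadj =>
      rw [Finset.card_insert_of_notMem hj] at hc
      obtain ⟨e, he, heT⟩ := List.mem_iff_getElem.1 ((hL.mem T).2 ⟨hg, by omega⟩)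
      have hT : L.getD e ∅ = T := by rw [List.getD_eq_getElem _ _ he, heT]
      have := hX.mem e he j trivial ⟨by rwa [hT], ?_⟩
      · rwa [hT] at this
      · rw [hT]
        refine hadj.imp (fun hempty => ?_) id
        have h1 : L[0] = ∅ := by
          have := hL.head
          rwa [List.getD_eq_getElem _ _ h0] at this
        exact (List.Nodup.getElem_inj_iff hL.nodup).1 (by rw [heT, hempty, h1])

def roundsCmd : Cmd :=
  .seq (.setR 33 (.const 1)) <|
  .seq (.setN 32 (.const 0) (.const 1)) <|
  .seq (.setN 22 (.const 1) (.reg 0)) <|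
  .for false 34 (.add (.reg 1) (.const 1)) <|
    -- The length is frozen for the round: sets appended during it are not extended before the next
    -- one.
    .seq (.setR 35 (.reg 33)) <|
    .for false 36 (.reg 35) <| .for false 37 (.reg 0) extendCmd

theorem run_roundsCmd {p : ℕ} (hN : n ≤ N) (hp : p + 1 ≤ N)
    (hcard : ∀ L : List (Finset (Fin n)), L.Nodup →
      (∀ S ∈ L, Grown K.Adj S ∧ S.card ≤ p + 1) → L.length ≤ N)
    (h0 : s.nat 0 0 = n) (h1 : s.nat 1 0 = p) (hoff : ∀ q < n, s.nat 20 q = q * n)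
    (hpw : ∀ q ≤ n, s.nat 21 q = 2 ^ q) (hF : IsTable n (s.nat 23) (futureRow K))
    (h30 : ∀ i, s.nat 30 i = 0) (h22 : ∀ i, s.nat 22 i = 0) (h31 : ∀ i, s.nat 31 i = 0)
    (h32 : ∀ i, s.nat 32 i = 0) :
    Run N M roundsCmd s fun s' => ∃ L, s'.IsList L ∧ IsComplete K (p + 1) L := by
  refine Run.seq (Run.setN (Run.seq (Run.setN (Run.seq (Run.setN ?_)))))
  refine Run.forN (p + 1) (fun r s' => ∃ L, s'.IsList L ∧ IsComplete K r L) hp rfl ?_ ?_ ?_ ?_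
  · intro s' hf
    simp [NExpr.eval, hf.nat 1 rfl, h1]
  · refine ⟨[∅], ⟨?_, ?_, ?_, ?_, ?_⟩, isComplete_zero K⟩
    · simp [NExpr.eval]
    · intro q k
      have : ([∅] : List (Finset (Fin n))).getD q ∅ = ∅ := by
        cases q <;> simp
      simp only [this]
      simp [h30]
    · intro e he
      simp only [List.length_singleton] at he
      interval_cases e <;> simp [NExpr.eval, h0, h22]
    · intro e he
      obtain rfl : e = 0 := by simpa using he
      simp [h31, setMask_empty]
    · intro x
      by_cases hx : x = 0
      · subst hx
        simp [NExpr.eval, setMask_empty]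
      · simp [NExpr.eval, setMask_empty, h32, hx, Ne.symm hx]
  · intro r s1 hr hf1 _ ⟨L, hL, hC⟩
    have hLN : L.length ≤ N := hcard L hC.nodup fun S hS =>
      ⟨((hC.mem S).1 hS).1, ((hC.mem S).1 hS).2.trans hr.le⟩
    refine Run.seq (Run.setN ?_)
    refine Run.forN L.length (fun e s' => ∃ X, s'.IsList (L ++ X) ∧
      IsPartial K r L X fun e' _ => e' < e) hLN rfl ?_ ?_ ?_ ?_
    · intro s2 hf2
      simp [NExpr.eval, hf2.nat 35 rfl, hL.cnt]
    · exact ⟨[], by simpa [Mem.IsList] using hL, by simpa using hC.nodup, by simp, by simp⟩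
    · intro e s2 he hf2 h36 ⟨X, hX, hP⟩
      refine Run.forN n (fun j s' => ∃ X, s'.IsList (L ++ X) ∧
        IsPartial K r L X fun e' j' => e' < e ∨ (e' = e ∧ (j' : ℕ) < j)) hN rfl ?_ ?_ ?_ ?_
      · intro s3 hf3
        simp [NExpr.eval, hf3.nat 0 rfl, hf2.nat 0 rfl, hf1.nat 0 rfl, h0]
      · exact ⟨X, by simpa [Mem.IsList] using hX, hP.nodup, hP.grown, fun e' he' j h =>
          hP.mem e' he' j (by simpa using h)⟩
      · intro j s3 hj hf3 h37 ⟨X, hX, hP⟩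
        have heX : e < (L ++ X).length := by rw [List.length_append]; omega
        have hget : (L ++ X).getD e ∅ = L.getD e ∅ := List.getD_append _ _ _ _ he
        have hext : Extends K (L ++ X) e ⟨j, hj⟩ ↔ Extends K L e ⟨j, hj⟩ := by
          simp only [Extends, hget]
        refine (run_extendCmd (K := K) (L := L ++ X) (e := e) (j := ⟨j, hj⟩) hN ?_ ?_ ?_ ?_ heX
          ?_ h37 hX).mono ?_
        · simp [hf3.nat 0 rfl, hf2.nat 0 rfl, hf1.nat 0 rfl, h0]
        · simpa [hf3.nat 20 rfl, hf2.nat 20 rfl, hf1.nat 20 rfl] using hoff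
        · simpa [hf3.nat 21 rfl, hf2.nat 21 rfl, hf1.nat 21 rfl] using hpw
        · simpa [hf3.nat 23 rfl, hf2.nat 23 rfl, hf1.nat 23 rfl] using hF
        · simp [hf3.nat 36 rfl, h36]
        · intro s4 _ h4
          rw [hget, hext] at h4
          rcases h4 with ⟨h4, h5⟩ | ⟨h4, h5, h6⟩
          · refine ⟨X, by simpa [Mem.IsList] using h4, hP.nodup, hP.grown, ?_⟩
            intro e' he' j' hj' hx
            rcases hj' with hj' | ⟨rfl, hj'⟩
            · exact hP.mem e' he' j' (Or.inl hj') hx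
            · rcases Nat.lt_succ_iff_lt_or_eq.1 hj' with hj' | hj'
              · exact hP.mem e' he' j' (Or.inr ⟨rfl, hj'⟩) hx
              · obtain rfl : j' = ⟨j, hj⟩ := Fin.ext hj'
                exact h5 hx
          · rw [List.append_assoc] at h4
            have hg := hC.grown_insert he h5
            refine ⟨X ++ [insert ⟨j, hj⟩ (L.getD e ∅)], by simpa [Mem.IsList] using h4, ?_, ?_, ?_⟩
            · rw [← List.append_assoc]
              exact List.nodup_append.2 ⟨hP.nodup, by simp, fun S hS T hT => by
                rw [List.mem_singleton] at hT
                subst hT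
                rintro rfl
                exact h6 hS⟩
            · intro S hS
              rcases List.mem_append.1 hS with hS | hS
              · exact hP.grown S hS
              · rw [List.mem_singleton] at hS
                subst hS
                refine ⟨hg, le_antisymm ?_ ?_⟩
                · refine (Finset.card_insert_le _ _).trans (Nat.succ_le_succ ?_)
                  refine ((hC.mem _).1 ?_).2
                  rw [List.getD_eq_getElem _ _ he]
                  exact List.getElem_mem he
                -- A set with at most `r` elements would already be in the complete list, so a new
                -- set has exactly `r + 1`. This keeps the list sorted by size.
                · by_contra hlt
                  exact h6 (List.mem_append_left _ ((hC.mem _).2 ⟨hg, by omega⟩))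
            · intro e' he' j' hj' hx
              rw [← List.append_assoc]
              rcases hj' with hj' | ⟨rfl, hj'⟩
              · exact List.mem_append_left _ (hP.mem e' he' j' (Or.inl hj') hx)
              · rcases Nat.lt_succ_iff_lt_or_eq.1 hj' with hj' | hj'
                · exact List.mem_append_left _ (hP.mem e' he' j' (Or.inr ⟨rfl, hj'⟩) hx)
                · obtain rfl : j' = ⟨j, hj⟩ := Fin.ext hj'
                  simp
      · intro s3 _ ⟨X, hX, hP⟩
        refine ⟨X, by simpa [Mem.IsList] using hX, hP.nodup, hP.grown, fun e' he' j h => ?_⟩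
        refine hP.mem e' he' j ?_
        have := j.isLt
        omega
    · intro s2 _ ⟨X, hX, hP⟩
      refine ⟨L ++ X, by simpa [Mem.IsList] using hX, hC.succ ⟨hP.nodup, hP.grown, ?_⟩⟩
      exact fun e he j _ => hP.mem e he j he
  · intro s' _ h
    exact h

end Enumeration

/-! ## State vectors on a few qubits -/

section States

variable {n a : ℕ} {Q Y R : Finset (Fin n)} {v : Bits n → ℂ}

/-- The basis label with the ones at the qubits in `Y`. -/
def ind (Y : Finset (Fin n)) : Bits n := fun k => decide (k ∈ Y)

theorem bits_setMask (Y : Finset (Fin n)) : bits n (setMask Y) = ind Y := by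
  ext k
  exact testBit_setMask Y k

theorem ind_filter (x : Bits n) : ind (Finset.univ.filter fun k => x k = true) = x := by
  ext k
  simp [ind]

theorem injOn_bits (a : ℕ) : Set.InjOn (bits a) (Finset.range (2 ^ a)) := by
  intro c hc d hd h
  simp only [Finset.coe_range, Set.mem_Iio] at hc hd
  refine Nat.eq_of_testBit_eq fun i => ?_
  by_cases hi : i < a
  · exact congrFun h ⟨i, hi⟩
  · rw [Nat.testBit_eq_false_of_lt (hc.trans_le (Nat.pow_le_pow_right two_pos (not_lt.1 hi))),
      Nat.testBit_eq_false_of_lt (hd.trans_le (Nat.pow_le_pow_right two_pos (not_lt.1 hi)))]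

theorem image_bits (a : ℕ) : (Finset.range (2 ^ a)).image (bits a) = Finset.univ := by
  apply Finset.eq_univ_of_card
  rw [Finset.card_image_of_injOn (injOn_bits a)]
  simp

theorem exists_bits_eq (b : Bits a) : ∃ c < 2 ^ a, bits a c = b := by
  have h : b ∈ (Finset.range (2 ^ a)).image (bits a) := by rw [image_bits]; exact Finset.mem_univ b
  simpa using h

theorem sum_bits_eq (a : ℕ) (f : Bits a → ℂ) :
    ∑ c ∈ Finset.range (2 ^ a), f (bits a c) = ∑ c, f c := by
  rw [← Finset.sum_image (injOn_bits a), image_bits]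

/-- The qubits that the digits `c` select from the list `q`. -/
def picks (q : Fin a ↪ Fin n) (c : Bits a) : Finset (Fin n) :=
  (Finset.univ.filter fun i => c i = true).map q

theorem apply_mem_picks {q : Fin a ↪ Fin n} {c : Bits a} {i : Fin a} :
    q i ∈ picks q c ↔ c i = true := by
  simp [picks]

theorem picks_subset (q : Fin a ↪ Fin n) (c : Bits a) : picks q c ⊆ Finset.univ.map q :=
  Finset.map_subset_map.2 (Finset.filter_subset _ _)

theorem sdiff_union_picks (q : Fin a ↪ Fin n) (Y : Finset (Fin n)) :
    Y \ Finset.univ.map q ∪ picks q (fun i => ind Y (q i)) = Y := by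
  ext k
  by_cases hk : k ∈ Finset.univ.map q
  · obtain ⟨i, -, rfl⟩ := Finset.mem_map.1 hk
    simp [apply_mem_picks, ind]
  · have : k ∉ picks q (fun i => ind Y (q i)) := fun h => hk (picks_subset _ _ h)
    rw [Finset.mem_union, Finset.mem_sdiff]
    tauto

theorem extend_ind (q : Fin a ↪ Fin n) (c d : Bits a) (hY : Disjoint Y (Finset.univ.map q)) :
    Function.extend q c (ind (Y ∪ picks q d)) = ind (Y ∪ picks q c) := by
  ext k
  by_cases hk : k ∈ Set.range q
  · obtain ⟨i, rfl⟩ := hk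
    have : q i ∉ Y := fun h => Finset.disjoint_left.1 hY h (by simp)
    rw [q.injective.extend_apply]
    simp [ind, this, apply_mem_picks]
  · have h : ∀ e, k ∉ picks q e := fun e h => hk (by simpa using picks_subset _ _ h)
    rw [extend_apply_of_not_mem _ _ _ hk]
    simp [ind, h]

theorem embed_mulVec_ind (q : Fin a ↪ Fin n) (A : Matrix (Bits a) (Bits a) ℂ)
    (hY : Disjoint Y (Finset.univ.map q)) (d : Bits a) :
    (embed q A *ᵥ v) (ind (Y ∪ picks q d)) =
      ∑ c ∈ Finset.range (2 ^ a), A d (bits a c) * v (ind (Y ∪ picks q (bits a c))) := by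
  rw [embed_mulVec, sum_bits_eq a fun c => A d c * v (ind (Y ∪ picks q c))]
  refine Finset.sum_congr rfl fun c _ => ?_
  rw [extend_ind q c d hY]
  congr 2
  ext i
  have : q i ∉ Y := fun h => Finset.disjoint_left.1 hY h (by simp)
  simp [ind, this, apply_mem_picks]

/-- The vector `v` vanishes on the basis labels with a one outside of `Q`. -/
def SupportedOn (Q : Finset (Fin n)) (v : Bits n → ℂ) : Prop :=
  ∀ x, ∀ k ∉ Q, x k = true → v x = 0

theorem SupportedOn.embed_mulVec (h : SupportedOn Q v) {q : Fin a ↪ Fin n}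
    (A : Matrix (Bits a) (Bits a) ℂ) (hq : Finset.univ.map q ⊆ Q) :
    SupportedOn Q (embed q A *ᵥ v) := by
  intro x k hk hx
  rw [MeanValue.embed_mulVec]
  refine Finset.sum_eq_zero fun c _ => ?_
  rw [h _ k hk, mul_zero]
  rw [extend_apply_of_not_mem, hx]
  exact fun h => hk (hq (by simpa using h))

/-- The state vector of the zero state. -/
def zeroState (n : ℕ) : Bits n → ℂ := Pi.single (fun _ => false) 1

theorem supportedOn_zeroState (Q : Finset (Fin n)) : SupportedOn Q (zeroState n) := by
  intro x k _ hx
  rw [zeroState, Pi.single_eq_of_ne]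
  rintro rfl
  simp at hx

/-- Labels with a one outside `Q` have amplitude zero, so subsets of `Q` index the whole sum. -/
theorem meanValue_eq_sum (V A : Op n) (h : SupportedOn Q (V *ᵥ zeroState n)) :
    meanValue V A = ∑ Y ∈ Q.powerset, (starRingEnd ℂ) ((V *ᵥ zeroState n) (ind Y)) *
      (A *ᵥ (V *ᵥ zeroState n)) (ind Y) := by
  have h1 : ∀ x, (V *ᵥ zeroState n) x = V x fun _ => false := fun x => by
    simp [zeroState, Matrix.mulVec_single]
  have h2 : meanValue V A = ∑ x, (starRingEnd ℂ) ((V *ᵥ zeroState n) x) *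
      (A *ᵥ (V *ᵥ zeroState n)) x := by
    rw [meanValue, Matrix.mul_assoc, Matrix.mul_apply]
    refine Finset.sum_congr rfl fun x _ => ?_
    rw [h1, Matrix.conjTranspose_apply, Matrix.mul_apply, Matrix.mulVec, dotProduct]
    simp only [h1]
    rfl
  rw [h2]
  symm
  refine Finset.sum_of_injOn ind ?_ (by simp) ?_ fun _ _ => rfl
  · intro Y _ Z _ hYZ
    ext k
    simpa [ind] using congrFun hYZ k
  · intro x _ hx
    obtain ⟨k, hk, hxk⟩ : ∃ k, k ∉ Q ∧ x k = true := by
      by_contra hcon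
      push Not at hcon
      refine hx ⟨Finset.univ.filter fun k => x k = true, ?_, ind_filter x⟩
      rw [Finset.mem_coe, Finset.mem_powerset]
      intro k hk
      by_contra hkQ
      exact hcon k hkQ (by simpa using hk)
    rw [h x k hk hxk, map_zero, zero_mul]

/-- The one-qubit matrix `A` in the labelling of gate matrices. -/
def bitMat (A : Matrix Bool Bool ℂ) : Matrix (Bits 1) (Bits 1) ℂ := Matrix.of fun x y => A (x 0) (y 0)

/-- The list of the single qubit `j`. -/
def single (j : Fin n) : Fin 1 ↪ Fin n := ⟨fun _ => j, fun _ _ _ => Subsingleton.elim _ _⟩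

theorem partialTensor_singleton (O : Fin n → Matrix Bool Bool ℂ) (j : Fin n) :
    partialTensor O {j} = embed (single j) (bitMat (O j)) := by
  ext x y
  rw [partialTensor_singleton_apply, embed, Matrix.of_apply]
  have h : ∀ i, single j i = j := fun _ => rfl
  simp [h, bitMat, eq_comm]

theorem setMask_union {Y Z : Finset (Fin n)} (h : Disjoint Y Z) :
    setMask (Y ∪ Z) = setMask Y + setMask Z :=
  Finset.sum_union h

theorem Circuit.toOp_append (K K' : Circuit n) :
    Circuit.toOp (K ++ K') = Circuit.toOp K' * Circuit.toOp K := by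
  induction K with
  | nil => simp [Circuit.toOp]
  | cons g K ih => rw [List.cons_append, Circuit.toOp, Circuit.toOp, ih, Matrix.mul_assoc]

theorem SupportedOn.toOp_mulVec (h : SupportedOn Q v) (K : Circuit n)
    (hK : ∀ g ∈ K, g.support ⊆ Q) : SupportedOn Q (Circuit.toOp K *ᵥ v) := by
  induction K generalizing v with
  | nil => simpa [Circuit.toOp] using h
  | cons g K ih =>
    rw [Circuit.toOp, ← Matrix.mulVec_mulVec]
    exact ih (h.embed_mulVec g.mat (hK g (by simp))) fun g' hg' => hK g' (by simp [hg'])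

end States

/-! ## Simulation of a circuit on a few qubits -/

section Simulation

variable {n a N M : ℕ} {K : Circuit n} {s : Mem} {Q R : Finset (Fin n)}

/-- The array contains positive numbers at the qubits in `A` only. -/
def IsFlags (f : ℕ → ℕ) (A : Finset (Fin n)) : Prop := ∀ k : Fin n, 0 < f k ↔ k ∈ A

/-- The array lists the numbers that represent the subsets of `A`. -/
structure IsSubsets (f : ℕ → ℕ) (len : ℕ) (A : Finset (Fin n)) : Prop where
  length_eq : len = 2 ^ A.card
  sub : ∀ u < len, ∃ Y ⊆ A, f u = setMask Y
  all : ∀ Y ⊆ A, ∃ u < len, f u = setMask Y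

/-- A list of length `2 ^ |A|` that contains every subset contains none twice, so sums over the list
are sums over the subsets. -/
theorem IsSubsets.sum_eq {f : ℕ → ℕ} {len : ℕ} {A : Finset (Fin n)} (h : IsSubsets f len A)
    (g : ℕ → ℂ) : ∑ u ∈ Finset.range len, g (f u) = ∑ Y ∈ A.powerset, g (setMask Y) := by
  have himg : (Finset.range len).image f = A.powerset.image setMask := by
    ext x
    simp only [Finset.mem_image, Finset.mem_range, Finset.mem_powerset]
    constructor
    · rintro ⟨u, hu, rfl⟩
      obtain ⟨Y, hY, h⟩ := h.sub u hu
      exact ⟨Y, hY, h.symm⟩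
    · rintro ⟨Y, hY, rfl⟩
      exact h.all Y hY
  have hcard : (A.powerset.image (setMask : Finset (Fin n) → ℕ)).card = len := by
    rw [Finset.card_image_of_injective _ setMask_injective, Finset.card_powerset, h.length_eq]
  have hinj : Set.InjOn f (Finset.range len) := by
    apply Finset.injOn_of_card_image_eq
    rw [himg, hcard, Finset.card_range]
  rw [← Finset.sum_image hinj, himg, Finset.sum_image setMask_injective.injOn]

theorem IsSubsets.double {f : ℕ → ℕ} {len : ℕ} {A : Finset (Fin n)} (h : IsSubsets f len A)
    {j : Fin n} (hj : j ∉ A) {f' : ℕ → ℕ} (h1 : ∀ u < len, f' u = f u)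
    (h2 : ∀ u < len, f' (u + len) = f u + 2 ^ (j : ℕ)) :
    IsSubsets f' (len + len) (insert j A) := by
  refine ⟨?_, fun u hu => ?_, fun Y hY => ?_⟩
  · rw [Finset.card_insert_of_notMem hj, h.length_eq]
    ring
  · by_cases hul : u < len
    · obtain ⟨Y, hY, h⟩ := h.sub u hul
      exact ⟨Y, hY.trans (Finset.subset_insert _ _), by rw [h1 u hul, h]⟩
    · obtain ⟨w, rfl⟩ := Nat.exists_eq_add_of_le' (not_lt.1 hul)
      have hw : w < len := by omega
      obtain ⟨Y, hY, h⟩ := h.sub w hw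
      exact ⟨insert j Y, Finset.insert_subset_insert _ hY, by
        rw [h2 w hw, h, setMask_insert fun hm => hj (hY hm)]⟩
  · by_cases hjY : j ∈ Y
    · obtain ⟨u, hu, h⟩ := h.all (Y.erase j) (by
        rw [← Finset.subset_insert_iff]; exact hY)
      refine ⟨u + len, by omega, ?_⟩
      rw [h2 u hu, h, ← setMask_insert (Finset.notMem_erase j Y), Finset.insert_erase hjY]
    · obtain ⟨u, hu, h⟩ := h.all Y ((Finset.subset_insert_iff_of_notMem hjY).1 hY)
      exact ⟨u, by omega, by rw [h1 u hu, h]⟩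

/-- Appends to a list a copy shifted by `e`. With `e` the mask of a new qubit, the subsets without
it are followed by those with it. -/
def doubleCmd (v f l : ℕ) (e : NExpr) : Cmd :=
  .seq (.for false v (.reg l) (.setN f (.add (.reg v) (.reg l)) (.add (.get f (.reg v)) e)))
    (.setR l (.add (.reg l) (.reg l)))

theorem run_doubleCmd {v f l len x : ℕ} {e : NExpr} (hvf : v ≠ f) (hvl : v ≠ l) (hfl : f ≠ l)
    (hl : s.nat l 0 = len) (hlen : len ≤ N)
    (he : ∀ s', (∀ b, b ≠ v → b ≠ f → s'.nat b = s.nat b) → e.eval s' = x) :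
    Run N M (doubleCmd v f l e) s fun s' => s'.nat l 0 = len + len ∧
      (∀ u < len, s'.nat f u = s.nat f u) ∧ ∀ u < len, s'.nat f (u + len) = s.nat f u + x := by
  refine Run.seq ((Run.forN len (fun k s' => (∀ u < len, s'.nat f u = s.nat f u) ∧
    ∀ u < k, s'.nat f (u + len) = s.nat f u + x) hlen ?_ ?_ ?_ ?_ fun s' _ h => h).mono ?_)
  · simp [Cmd.writesN, hvf]
  · intro s' hf
    simp [NExpr.eval, hf.nat l (by simp [Cmd.for, Cmd.writesN, hvl.symm, hfl.symm]), hl]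
  · simp [hvf.symm]
  · intro k s' hk hf hv hI
    have hl' : s'.nat l 0 = len := by
      rw [hf.nat l (by simp [Cmd.for, Cmd.writesN, hvl.symm, hfl.symm]), hl]
    have he' : e.eval s' = x := he s' fun b h1 h2 =>
      hf.nat b (by simp [Cmd.for, Cmd.writesN, h1, h2])
    refine Run.setN ⟨fun u hu => ?_, fun u hu => ?_⟩
    · have : u ≠ k + len := by omega
      simp [NExpr.eval, hvf.symm, hl', hv, this, hI.1 u hu]
    · rcases Nat.lt_succ_iff_lt_or_eq.1 hu with hu | rfl
      · simp [NExpr.eval, hvf.symm, hl', hv, hu.ne, hI.2 u hu]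
      · simp [NExpr.eval, hvf.symm, hl', hv, he', hI.1 u hk]
  · intro s' hf hI
    refine Run.setN ⟨?_, ?_⟩
    · simp [NExpr.eval, hf.nat l (by simp [Cmd.for, Cmd.writesN, hvl.symm, hfl.symm]), hl]
    · simpa [hfl] using hI

def subsetsCmd : Cmd :=
  .seq (.setN 54 (.const 0) (.const 0)) <|
  .seq (.setR 55 (.const 1)) <|
  .for false 63 (.reg 0)
    (.ite (.pos (.get 57 (.reg 63))) (doubleCmd 64 54 55 (.get 21 (.reg 63))) .skip)

theorem run_subsetsCmd (hN : n ≤ N) (h0 : s.nat 0 0 = n) (hpw : ∀ q ≤ n, s.nat 21 q = 2 ^ q)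
    {A : Finset (Fin n)} (hA : IsFlags (s.nat 57) A) (hcard : 2 ^ A.card ≤ N) :
    Run N M subsetsCmd s fun s' => IsSubsets (s'.nat 54) (s'.nat 55 0) A := by
  refine Run.seq (Run.setN (Run.seq (Run.setN ?_)))
  refine Run.forN n (fun k s' => IsSubsets (s'.nat 54) (s'.nat 55 0)
    (A.filter fun i : Fin n => (i : ℕ) < k)) hN rfl ?_ ?_ ?_ ?_
  · intro s' hf
    simp [NExpr.eval, hf.nat 0 rfl, h0]
  · rw [filter_val_lt_zero]
    refine ⟨by simp [NExpr.eval], fun u hu => ⟨∅, le_rfl, ?_⟩, fun Y hY => ⟨0, ?_, ?_⟩⟩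
    · simp [NExpr.eval] at hu
      simp [hu, NExpr.eval, setMask_empty]
    · simp [NExpr.eval]
    · rw [Finset.subset_empty.1 hY]
      simp [NExpr.eval, setMask_empty]
  · intro k s' hk hf h63 hI
    have ht : (Test.pos (.get 57 (.reg 63))).holds s' ↔ (⟨k, hk⟩ : Fin n) ∈ A := by
      have := hA ⟨k, hk⟩
      simpa [Test.holds, NExpr.eval, h63, hf.nat 57 rfl] using this
    rw [filter_val_lt_succ A hk]
    refine Run.ite (fun hb => ?_) (fun hb => Run.skip ?_)
    · rw [ht] at hb
      rw [if_pos hb]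
      refine (run_doubleCmd (x := 2 ^ k) (by decide) (by decide) (by decide) rfl ?_ ?_).mono ?_
      · rw [hI.length_eq]
        exact (Nat.pow_le_pow_right two_pos (Finset.card_le_card (Finset.filter_subset _ _))).trans
          hcard
      · intro s'' h
        simp [NExpr.eval, h 21 (by decide) (by decide), h 63 (by decide) (by decide), h63,
          hf.nat 21 rfl, hpw k hk.le]
      · rintro s'' _ ⟨h1, h2, h3⟩
        have := hI.double (j := ⟨k, hk⟩) (by simp) h2 h3
        simpa [h1] using this
    · rw [ht] at hb
      rw [if_neg hb]
      simpa using hI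
  · intro s' _ hI
    rwa [filter_val_lt_self] at hI

/-- Copies the set `Q` from the array `52` to the array `57`. -/
def copyFlagsCmd : Cmd := .for false 63 (.reg 0) (.setN 57 (.reg 63) (.get 52 (.reg 63)))

theorem run_copyFlagsCmd (hN : n ≤ N) (h0 : s.nat 0 0 = n) (hQ : IsFlags (s.nat 52) Q) :
    Run N M copyFlagsCmd s fun s' => IsFlags (s'.nat 57) Q := by
  refine Run.forN n (fun k s' => ∀ i < k, s'.nat 57 i = s.nat 52 i) hN rfl ?_ ?_ ?_ ?_
  · intro s' hf
    simp [NExpr.eval, hf.nat 0 rfl, h0]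
  · simp
  · intro k s' _ hf h63 hI
    refine Run.setN fun i hi => ?_
    rcases Nat.lt_succ_iff_lt_or_eq.1 hi with hi | rfl
    · simp [NExpr.eval, h63, hi.ne, hI i hi]
    · simp [NExpr.eval, h63, hf.nat 52 rfl]
  · intro s' _ hI k
    rw [hI k k.isLt]
    exact hQ k

/-- Lists the subsets of `Q`. -/
def listCmd : Cmd := .seq copyFlagsCmd subsetsCmd

theorem run_listCmd (hN : n ≤ N) (h0 : s.nat 0 0 = n) (hpw : ∀ q ≤ n, s.nat 21 q = 2 ^ q)
    (hQ : IsFlags (s.nat 52) Q) (hcard : 2 ^ Q.card ≤ N) :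
    Run N M listCmd s fun s' => IsSubsets (s'.nat 54) (s'.nat 55 0) Q := by
  refine Run.seq ((run_copyFlagsCmd hN h0 hQ).mono fun s1 hf1 h1 => ?_)
  exact run_subsetsCmd hN (by rw [hf1.nat 0 rfl, h0]) (by rwa [hf1.nat 21 rfl]) h1 hcard

/-- Prepares the application of a matrix to the qubits listed in the array `73`: lists the subsets
of these qubits and of the other qubits in `Q`. -/
def selectCmd : Cmd :=
  .seq copyFlagsCmd <|
  .seq (.setN 65 (.const 0) (.const 0)) <|
  .seq (.setR 66 (.const 1)) <|
  .seq (.for false 76 (.reg 72)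
    (.seq (doubleCmd 77 65 66 (.get 21 (.get 73 (.reg 76))))
      (.setN 57 (.get 73 (.reg 76)) (.const 0))))
  subsetsCmd

/-- The qubits that the lowest `i` digits of `c` select from the list `q`. -/
def lowPicks (q : Fin a ↪ Fin n) (i c : ℕ) : Finset (Fin n) :=
  (Finset.univ.filter fun l : Fin a => (l : ℕ) < i ∧ c.testBit l = true).map q

theorem lowPicks_self (q : Fin a ↪ Fin n) (c : ℕ) : lowPicks q a c = picks q (bits a c) := by
  rw [lowPicks, picks]
  congr 1
  ext l
  simp only [Finset.mem_filter, Finset.mem_univ, true_and, l.isLt]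
  rfl

theorem lowPicks_succ_of_lt (q : Fin a ↪ Fin n) {i c : ℕ} (hc : c < 2 ^ i) :
    lowPicks q (i + 1) c = lowPicks q i c := by
  rw [lowPicks, lowPicks]
  congr 1
  ext l
  simp only [Finset.mem_filter, Finset.mem_univ, true_and]
  refine ⟨fun h => ⟨?_, h.2⟩, fun h => ⟨by omega, h.2⟩⟩
  by_contra hl
  have : (l : ℕ) = i := by omega
  rw [this, Nat.testBit_eq_false_of_lt hc] at h
  simp at h

/-- Doubling in the order of the listed qubits keeps the index equal to the binary digits of the
selection, which is the order of the rows and columns of a gate matrix. -/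
theorem lowPicks_add (q : Fin a ↪ Fin n) {i c : ℕ} (hi : i < a) (hc : c < 2 ^ i) :
    lowPicks q (i + 1) (c + 2 ^ i) = insert (q ⟨i, hi⟩) (lowPicks q i c) := by
  rw [lowPicks, lowPicks, ← Finset.map_insert]
  congr 1
  ext l
  simp only [Finset.mem_filter, Finset.mem_univ, true_and, Finset.mem_insert, Fin.ext_iff]
  rw [add_comm c]
  rcases lt_trichotomy (l : ℕ) i with h | h | h
  · rw [Nat.testBit_two_pow_add_gt h]
    simp [h, h.ne, Nat.lt_succ_of_lt h]
  · rw [h, Nat.testBit_two_pow_add_eq, Nat.testBit_eq_false_of_lt hc]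
    simp
  · have h1 : ¬ (l : ℕ) < i + 1 := by omega
    simp [h1, h.ne', h.le]

/-- The array lists the numbers that represent the selections from the list `q`. -/
def IsPicks (f : ℕ → ℕ) (len : ℕ) (q : Fin a ↪ Fin n) : Prop :=
  len = 2 ^ a ∧ ∀ c < 2 ^ a, f c = setMask (picks q (bits a c))

theorem run_selectCmd (hN : n ≤ N) (h0 : s.nat 0 0 = n) (hpw : ∀ q ≤ n, s.nat 21 q = 2 ^ q)
    (hQ : IsFlags (s.nat 52) Q) (hcard : 2 ^ Q.card ≤ N) (h72 : s.nat 72 0 = a)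
    {q : Fin a ↪ Fin n} (h73 : ∀ i, s.nat 73 (i : Fin a) = q i) (hq : Finset.univ.map q ⊆ Q) :
    Run N M selectCmd s fun s' => IsPicks (s'.nat 65) (s'.nat 66 0) q ∧
      IsSubsets (s'.nat 54) (s'.nat 55 0) (Q \ Finset.univ.map q) := by
  have haN : 2 ^ a ≤ N := by
    refine (Nat.pow_le_pow_right two_pos ?_).trans hcard
    simpa using Finset.card_le_card hq
  have han : a ≤ n := by simpa using Fintype.card_le_of_embedding q
  refine Run.seq ((run_copyFlagsCmd hN h0 hQ).mono fun s1 hf1 h1 => ?_)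
  refine Run.seq (Run.setN (Run.seq (Run.setN (Run.seq ?_))))
  refine (Run.forN a (fun i s' => (s'.nat 66 0 = 2 ^ i ∧
      ∀ c < 2 ^ i, s'.nat 65 c = setMask (lowPicks q i c)) ∧
      IsFlags (s'.nat 57) (Q \ (Finset.univ.filter fun l : Fin a => (l : ℕ) < i).map q))
    (han.trans hN) rfl ?_ ?_ ?_ fun s' _ h => h).mono ?_
  · intro s' hf
    simp [NExpr.eval, hf.nat 72 rfl, hf1.nat 72 rfl, h72]
  · refine ⟨⟨by simp [NExpr.eval], fun c hc => ?_⟩, ?_⟩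
    · obtain rfl : c = 0 := by simpa using hc
      simp [NExpr.eval, lowPicks, setMask_empty]
    · simpa using h1
  · rintro i s2 hi hf2 h76 ⟨⟨h66, h65⟩, h57⟩
    have hqi : s2.nat 73 i = q ⟨i, hi⟩ := by
      simpa [hf2.nat 73 rfl, hf1.nat 73 rfl] using h73 ⟨i, hi⟩
    refine Run.seq ((run_doubleCmd (x := 2 ^ (q ⟨i, hi⟩ : ℕ)) (by decide) (by decide) (by decide)
      h66 ((Nat.pow_le_pow_right two_pos hi.le).trans haN) ?_).mono ?_)
    · intro s3 h
      simp [NExpr.eval, h 21 (by decide) (by decide), h 73 (by decide) (by decide),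
        h 76 (by decide) (by decide), h76, hqi, hf2.nat 21 rfl, hf1.nat 21 rfl,
        hpw _ (q ⟨i, hi⟩).isLt.le]
    · rintro s3 hf3 ⟨h3, h4, h5⟩
      refine Run.setN ⟨⟨?_, fun c hc => ?_⟩, fun k => ?_⟩
      · simp [h3]
        ring
      · have hnew : q ⟨i, hi⟩ ∉ lowPicks q i (c - 2 ^ i) := by simp [lowPicks]
        by_cases hci : c < 2 ^ i
        · simp [h4 c hci, h65 c hci, lowPicks_succ_of_lt q hci]
        · obtain ⟨d, rfl⟩ := Nat.exists_eq_add_of_le' (not_lt.1 hci)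
          have hd : d < 2 ^ i := by rw [pow_succ] at hc; omega
          rw [Nat.add_sub_cancel] at hnew
          simp [h5 d hd, h65 d hd, lowPicks_add q hi hd, setMask_insert hnew]
      · have hk := h57 k
        have h6 : s3.nat 73 i = q ⟨i, hi⟩ := by rw [hf3.nat 73 rfl, hqi]
        have h7 : s3.nat 57 = s2.nat 57 := hf3.nat 57 rfl
        have h8 : s3.nat 76 0 = i := by rw [hf3.nat 76 rfl, h76]
        have h9 : ((Finset.univ.filter fun l : Fin a => (l : ℕ) < i + 1).map q) =
            insert (q ⟨i, hi⟩) ((Finset.univ.filter fun l : Fin a => (l : ℕ) < i).map q) := by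
          rw [← Finset.map_insert]
          congr 1
          ext l
          simp only [Finset.mem_insert, Finset.mem_filter, Finset.mem_univ, true_and, Fin.ext_iff]
          omega
        rw [h9, Finset.mem_sdiff, Finset.mem_insert]
        rw [Finset.mem_sdiff] at hk
        by_cases he : k = q ⟨i, hi⟩
        · simp [NExpr.eval, h8, h6, he]
        · have he' : (k : ℕ) ≠ q ⟨i, hi⟩ := fun h => he (Fin.ext h)
          simp only [Mem.setNat_nat_of_ne _ (by decide : 57 ≠ 76), Mem.setNat_nat_self, NExpr.eval,
            h8, h6, h7, Function.update_of_ne he', hk, he, false_or]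
  · rintro s2 hf2 ⟨⟨h66, h65⟩, h57⟩
    have hall : (Finset.univ.filter fun l : Fin a => (l : ℕ) < a) = Finset.univ := by ext l; simp
    rw [hall] at h57
    refine (run_subsetsCmd hN ?_ ?_ h57 ?_).mono fun s3 hf3 h3 => ⟨⟨?_, fun c hc => ?_⟩, h3⟩
    · simp [hf2.nat 0 rfl, hf1.nat 0 rfl, h0]
    · simpa [hf2.nat 21 rfl, hf1.nat 21 rfl] using hpw
    · exact (Nat.pow_le_pow_right two_pos (Finset.card_le_card Finset.sdiff_subset)).trans hcard
    · rw [hf3.nat 66 rfl, h66]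
    · rw [hf3.nat 65 rfl, h65 c hc, lowPicks_self]

end Simulation

/-! ### Applying gates and operators to the stored state vector. -/

section Evaluation

variable {n a N M : ℕ} {K : Circuit n} {O : Fin n → Matrix Bool Bool ℂ} {δ : ℝ}
  {L : List (Finset (Fin n))} {s : Mem} {Q R : Finset (Fin n)} {v : Bits n → ℂ}

/-- The array `f` contains the amplitudes of the vector `v` on the qubits `Q`. -/
def IsState (Q : Finset (Fin n)) (f : ℕ → ℂ) (v : Bits n → ℂ) : Prop :=
  ∀ Y ⊆ Q, f (setMask Y) = v (ind Y)

theorem update_apply_eq {f T : ℕ → ℂ} {x y : ℕ} (h : f y = T y) :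
    Function.update f x (T x) y = T y := by
  by_cases hxy : y = x
  · simp [hxy]
  · rw [Function.update_of_ne hxy, h]

/-- The memory location of an amplitude. -/
def ampExpr (r : ℕ) : NExpr := .add (.get 54 (.reg 68)) (.get 65 (.reg r))

/-- For each configuration of the other qubits in `Q`, a block of `2 ^ a` amplitudes is multiplied
by the matrix. Results go to the array `4`, since old amplitudes are still needed; register `69`
advances by one matrix row at a time. -/
def multiplyCmd : Cmd :=
  .for false 68 (.reg 55) <|
    .seq (.setR 69 (.reg 74)) <|
    .for false 70 (.reg 66) <|
      .seq (.setC 6 (.const 0) (.ofNat (.const 0))) <|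
      .seq (.for false 71 (.reg 66) (.setC 6 (.const 0) (.add (.get 6 (.const 0))
        (.mul (.get 0 (.add (.reg 69) (.reg 71))) (.get 3 (ampExpr 71)))))) <|
      .seq (.setC 4 (ampExpr 70) (.get 6 (.const 0)))
        (.setR 69 (.add (.reg 69) (.reg 66)))

def copyAmpsCmd : Cmd :=
  .for false 68 (.reg 55) <| .for false 70 (.reg 66) <|
    .setC 3 (ampExpr 70) (.get 4 (ampExpr 70))

theorem run_multiplyCmd {len : ℕ} (hlen : len ≤ N) (haN : 2 ^ a ≤ N) (h55 : s.nat 55 0 = len)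
    (h66 : s.nat 66 0 = 2 ^ a) {A : ℕ → ℕ → ℂ}
    (hA : ∀ r < 2 ^ a, ∀ c < 2 ^ a, s.cpx 0 (s.nat 74 0 + r * 2 ^ a + c) = A r c)
    {T : ℕ → ℂ}
    (hT : ∀ u < len, ∀ r < 2 ^ a, ∑ c ∈ Finset.range (2 ^ a),
      A r c * s.cpx 3 (s.nat 54 u + s.nat 65 c) = T (s.nat 54 u + s.nat 65 r)) :
    Run N M multiplyCmd s fun s' => ∀ u < len, ∀ r < 2 ^ a,
      s'.cpx 4 (s.nat 54 u + s.nat 65 r) = T (s.nat 54 u + s.nat 65 r) := by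
  refine Run.forN len (fun k s' => ∀ u < k, ∀ r < 2 ^ a,
      s'.cpx 4 (s.nat 54 u + s.nat 65 r) = T (s.nat 54 u + s.nat 65 r)) hlen rfl ?_ ?_ ?_
      fun s' _ h => h
  · intro s' hf
    simp [NExpr.eval, hf.nat 55 rfl, h55]
  · simp
  · intro u s1 hu hf1 h68 hI
    refine Run.seq (Run.setN ?_)
    refine Run.forN (2 ^ a) (fun k s' => (∀ w < u, ∀ r < 2 ^ a,
      s'.cpx 4 (s.nat 54 w + s.nat 65 r) = T (s.nat 54 w + s.nat 65 r)) ∧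
      (∀ r < k, s'.cpx 4 (s.nat 54 u + s.nat 65 r) = T (s.nat 54 u + s.nat 65 r)) ∧
      s'.nat 69 0 = s.nat 74 0 + k * 2 ^ a) haN rfl ?_ ?_ ?_ ?_
    · intro s2 hf2
      simp [NExpr.eval, hf2.nat 66 rfl, hf1.nat 66 rfl, h66]
    · exact ⟨by simpa using hI, by simp, by simp [NExpr.eval, hf1.nat 74 rfl]⟩
    · rintro r s2 hr hf2 h70 ⟨hI1, hI2, h69⟩
      refine Run.seq (Run.setC (Run.seq ((Run.forN (2 ^ a) (fun k s' => s'.cpx 6 0 =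
        ∑ c ∈ Finset.range k, A r c * s.cpx 3 (s.nat 54 u + s.nat 65 c)) haN rfl ?_ ?_ ?_
        fun s' _ h => h).mono ?_)))
      · intro s3 hf3
        simp [NExpr.eval, hf3.nat 66 rfl, hf2.nat 66 rfl, hf1.nat 66 rfl, h66]
      · simp [NExpr.eval, CExpr.eval]
      · intro c s3 hc hf3 h71 hI3
        refine Run.setC ?_
        have h := hA r hr c hc
        simp [NExpr.eval, CExpr.eval, ampExpr, hI3, Finset.sum_range_succ, h71, hf3.nat 69 rfl,
          h69, hf3.cpx 0 rfl, hf2.cpx 0 rfl, hf1.cpx 0 rfl, h, hf3.cpx 3 rfl, hf2.cpx 3 rfl,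
          hf1.cpx 3 rfl, hf3.nat 54 rfl, hf2.nat 54 rfl, hf1.nat 54 rfl, hf3.nat 65 rfl,
          hf2.nat 65 rfl, hf1.nat 65 rfl, hf3.nat 68 rfl, hf2.nat 68 rfl, h68]
      · intro s3 hf3 h6
        rw [hT u hu r hr] at h6
        have e54 : s3.nat 54 = s.nat 54 := by
          simp [hf3.nat 54 rfl, hf2.nat 54 rfl, hf1.nat 54 rfl]
        have e65 : s3.nat 65 = s.nat 65 := by
          simp [hf3.nat 65 rfl, hf2.nat 65 rfl, hf1.nat 65 rfl]
        have e66 : s3.nat 66 0 = 2 ^ a := by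
          simp [hf3.nat 66 rfl, hf2.nat 66 rfl, hf1.nat 66 rfl, h66]
        have e68 : s3.nat 68 0 = u := by simp [hf3.nat 68 rfl, hf2.nat 68 rfl, h68]
        have e70 : s3.nat 70 0 = r := by simp [hf3.nat 70 rfl, h70]
        have e69 : s3.nat 69 0 = s.nat 74 0 + r * 2 ^ a := by simp [hf3.nat 69 rfl, h69]
        have e4 : s3.cpx 4 = s2.cpx 4 := by simp [hf3.cpx 4 rfl]
        refine Run.seq (Run.setC (Run.setN ⟨fun u' hu' r' hr' => ?_, fun r' hr' => ?_, ?_⟩))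
        · simp only [NExpr.eval, CExpr.eval, ampExpr, Mem.setNat_cpx, Mem.setCpx_cpx_self, h6, e54,
            e65, e68, e70, e4]
          exact update_apply_eq (hI1 u' hu' r' hr')
        · simp only [NExpr.eval, CExpr.eval, ampExpr, Mem.setNat_cpx, Mem.setCpx_cpx_self, h6, e54,
            e65, e68, e70, e4]
          rcases Nat.lt_succ_iff_lt_or_eq.1 hr' with hr' | rfl
          · exact update_apply_eq (hI2 r' hr')
          · simp
        · simp [NExpr.eval, e69, e66]
          ring
    · rintro s2 hf2 ⟨hI1, hI2, -⟩ u' hu' r hr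
      rcases Nat.lt_succ_iff_lt_or_eq.1 hu' with hu' | rfl
      · exact hI1 u' hu' r hr
      · exact hI2 r hr

theorem run_copyAmpsCmd {len : ℕ} (hlen : len ≤ N) (haN : 2 ^ a ≤ N) (h55 : s.nat 55 0 = len)
    (h66 : s.nat 66 0 = 2 ^ a) {T : ℕ → ℂ}
    (hT : ∀ u < len, ∀ r < 2 ^ a,
      s.cpx 4 (s.nat 54 u + s.nat 65 r) = T (s.nat 54 u + s.nat 65 r)) :
    Run N M copyAmpsCmd s fun s' => ∀ u < len, ∀ r < 2 ^ a,
      s'.cpx 3 (s.nat 54 u + s.nat 65 r) = T (s.nat 54 u + s.nat 65 r) := by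
  refine Run.forN len (fun k s' => ∀ u < k, ∀ r < 2 ^ a,
      s'.cpx 3 (s.nat 54 u + s.nat 65 r) = T (s.nat 54 u + s.nat 65 r)) hlen rfl ?_ ?_ ?_
      fun s' _ h => h
  · intro s' hf
    simp [NExpr.eval, hf.nat 55 rfl, h55]
  · simp
  · intro u s1 hu hf1 h68 hI
    refine Run.forN (2 ^ a) (fun k s' => (∀ w < u, ∀ r < 2 ^ a,
      s'.cpx 3 (s.nat 54 w + s.nat 65 r) = T (s.nat 54 w + s.nat 65 r)) ∧
      (∀ r < k, s'.cpx 3 (s.nat 54 u + s.nat 65 r) = T (s.nat 54 u + s.nat 65 r))) haN rfl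
      ?_ ?_ ?_ ?_
    · intro s2 hf2
      simp [NExpr.eval, hf2.nat 66 rfl, hf1.nat 66 rfl, h66]
    · exact ⟨by simpa using hI, by simp⟩
    · rintro r s2 hr hf2 h70 ⟨hI1, hI2⟩
      have h4 := hT u hu r hr
      refine Run.setC ⟨fun u' hu' r' hr' => ?_, fun r' hr' => ?_⟩
      · simp only [NExpr.eval, CExpr.eval, ampExpr, Mem.setNat_cpx, Mem.setCpx_cpx_self,
          hf2.nat 54 rfl, hf1.nat 54 rfl, hf2.nat 65 rfl, hf1.nat 65 rfl, hf2.nat 68 rfl, h68, h70,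
          hf2.cpx 4 rfl, hf1.cpx 4 rfl, h4]
        exact update_apply_eq (hI1 u' hu' r' hr')
      · simp only [NExpr.eval, CExpr.eval, ampExpr, Mem.setNat_cpx, Mem.setCpx_cpx_self,
          hf2.nat 54 rfl, hf1.nat 54 rfl, hf2.nat 65 rfl, hf1.nat 65 rfl, hf2.nat 68 rfl, h68, h70,
          hf2.cpx 4 rfl, hf1.cpx 4 rfl, h4]
        rcases Nat.lt_succ_iff_lt_or_eq.1 hr' with hr' | rfl
        · exact update_apply_eq (hI2 r' hr')
        · simp
    · rintro s2 hf2 ⟨hI1, hI2⟩ u' hu' r hr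
      rcases Nat.lt_succ_iff_lt_or_eq.1 hu' with hu' | rfl
      · exact hI1 u' hu' r hr
      · exact hI2 r hr

/-- Applies a matrix to the state. -/
def applyCmd : Cmd := .seq selectCmd (.seq multiplyCmd copyAmpsCmd)

theorem run_applyCmd (hN : n ≤ N) (h0 : s.nat 0 0 = n) (hpw : ∀ q ≤ n, s.nat 21 q = 2 ^ q)
    (hQ : IsFlags (s.nat 52) Q) (hcard : 2 ^ Q.card ≤ N) (h72 : s.nat 72 0 = a)
    {q : Fin a ↪ Fin n} (h73 : ∀ i, s.nat 73 (i : Fin a) = q i) (hq : Finset.univ.map q ⊆ Q)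
    {A : Matrix (Bits a) (Bits a) ℂ}
    (hA : ∀ r < 2 ^ a, ∀ c < 2 ^ a,
      s.cpx 0 (s.nat 74 0 + r * 2 ^ a + c) = A (bits a r) (bits a c))
    (hv : IsState Q (s.cpx 3) v) :
    Run N M applyCmd s fun s' => IsState Q (s'.cpx 3) (embed q A *ᵥ v) := by
  have haN : 2 ^ a ≤ N := by
    refine (Nat.pow_le_pow_right two_pos ?_).trans hcard
    simpa using Finset.card_le_card hq
  refine Run.seq ((run_selectCmd hN h0 hpw hQ hcard h72 h73 hq).mono ?_)
  rintro s1 hf1 ⟨⟨h66, h65⟩, hS⟩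
  have hlen : s1.nat 55 0 ≤ N := by
    rw [hS.length_eq]
    exact (Nat.pow_le_pow_right two_pos (Finset.card_le_card Finset.sdiff_subset)).trans hcard
  have hamp : ∀ {Y} (_ : Y ⊆ Q \ Finset.univ.map q) {r} (_ : r < 2 ^ a),
      setMask Y + s1.nat 65 r = setMask (Y ∪ picks q (bits a r)) ∧ Y ∪ picks q (bits a r) ⊆ Q ∧
        Disjoint Y (Finset.univ.map q) := by
    intro Y hY r hr
    have hd : Disjoint Y (Finset.univ.map q) := Finset.disjoint_of_subset_left hY
      Finset.sdiff_disjoint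
    rw [h65 r hr, setMask_union (Finset.disjoint_of_subset_right (picks_subset _ _) hd)]
    exact ⟨rfl, Finset.union_subset (hY.trans Finset.sdiff_subset) ((picks_subset _ _).trans hq), hd⟩
  refine Run.seq ((run_multiplyCmd (A := fun r c => A (bits a r) (bits a c))
    (T := fun x => (embed q A *ᵥ v) (bits n x)) hlen haN rfl h66 ?_ ?_).mono fun s2 hf2 h2 => ?_)
  · simpa only [hf1.nat 74 rfl, hf1.cpx 0 rfl] using hA
  · intro u hu r hr
    obtain ⟨Y, hY, hYu⟩ := hS.sub u hu
    rw [hYu, (hamp hY hr).1, bits_setMask, embed_mulVec_ind q A (hamp hY hr).2.2]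
    refine Finset.sum_congr rfl fun c hc => ?_
    have h := hamp hY (Finset.mem_range.1 hc)
    rw [h.1, hf1.cpx 3 rfl, hv _ h.2.1]
  · refine (run_copyAmpsCmd (a := a) (T := fun x => (embed q A *ᵥ v) (bits n x)) hlen haN ?_ ?_
      ?_).mono fun s3 hf3 h3 Y hY => ?_
    · rw [hf2.nat 55 rfl]
    · rw [hf2.nat 66 rfl, h66]
    · rwa [hf2.nat 54 rfl, hf2.nat 65 rfl]
    · rw [hf2.nat 54 rfl, hf2.nat 65 rfl] at h3
      -- Every subset of `Q` is its part off the listed qubits together with a selection from them,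
      -- so its amplitude has been written.
      obtain ⟨r, hr, hrY⟩ := exists_bits_eq fun i => ind Y (q i)
      have hYs : Y \ Finset.univ.map q ⊆ Q \ Finset.univ.map q := Finset.sdiff_subset_sdiff hY le_rfl
      obtain ⟨u, hu, huY⟩ := hS.all _ hYs
      have h := h3 u hu r hr
      rwa [huY, (hamp hYs hr).1, hrY, sdiff_union_picks, bits_setMask] at h

/-- The results of the preparatory steps. -/
structure Ready (K : Circuit n) (O : Fin n → Matrix Bool Bool ℂ) (δ : ℝ)
    (L : List (Finset (Fin n))) (s : Mem) : Prop where
  nat : s.nat 0 = fun i => (natInput K).getD i 0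
  cpx : s.cpx 0 = fun i => (cpxInput K O δ).getD i 0
  natPos : ∀ i < K.length, s.nat 13 i = natPos K i
  cpxPos : ∀ i < K.length, s.nat 14 i = cpxPos K i
  off : ∀ q ≤ n, s.nat 20 q = q * n
  pow : ∀ q ≤ n, s.nat 21 q = 2 ^ q
  futures : IsTable n (s.nat 23) (futureRow K)
  list : s.IsList L

/-- Whether the command preserves the results of the preparatory steps. -/
def Cmd.keeps (c : Cmd) : Bool :=
  [0, 13, 14, 20, 21, 22, 23, 30, 31, 32, 33].all (fun a => !c.writesN a) && !c.writesC 0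

theorem Ready.frame {c : Cmd} {s' : Mem} (h : Ready K O δ L s) (hf : c.Frame s s')
    (hc : c.keeps = true) : Ready K O δ L s' := by
  simp only [Cmd.keeps, List.all_cons, List.all_nil, Bool.and_true, Bool.and_eq_true,
    Bool.not_eq_true'] at hc
  obtain ⟨⟨h1, h2, h3, h4, h5, h6, h7, h8, h9, h10, h11⟩, h12⟩ := hc
  have hl := h.list
  refine ⟨?_, ?_, ?_, ?_, ?_, ?_, ?_, ?_⟩
  · rw [hf.nat 0 h1, h.nat]
  · rw [hf.cpx 0 h12, h.cpx]
  · rw [hf.nat 13 h2]; exact h.natPos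
  · rw [hf.nat 14 h3]; exact h.cpxPos
  · rw [hf.nat 20 h4]; exact h.off
  · rw [hf.nat 21 h5]; exact h.pow
  · rw [hf.nat 23 h7]; exact h.futures
  · rw [Mem.IsList, hf.nat 30 h8, hf.nat 22 h6, hf.nat 31 h9, hf.nat 32 h10, hf.nat 33 h11]
    exact hl

theorem Ready.card_eq (h : Ready K O δ L s) : s.nat 0 0 = n := by simp [h.nat, natInput]

theorem Ready.length_eq (h : Ready K O δ L s) : s.nat 0 1 = K.length := by simp [h.nat, natInput]

/-- Flag `59` is raised if some qubit of the gate is outside `Q`, and the gate is then skipped; this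
realizes the filtered circuit. -/
def gateCmd : Cmd :=
  .seq (.setR 59 (.const 0)) <|
  .seq (.setR 72 (arityExpr 56)) <|
  .seq (.for false 58 (.reg 72) <|
    .seq (.setN 73 (.reg 58) (qubitExpr 56 58))
      (.ite (.not (.pos (.get 52 (qubitExpr 56 58)))) (.setR 59 (.const 1)) .skip)) <|
  .seq (.setR 74 (.get 14 (.reg 56))) <|
  .ite (.pos (.reg 59)) .skip applyCmd

theorem run_gateCmd (hN : n ≤ N) (hs : Ready K O δ L s) (hQ : IsFlags (s.nat 52) Q)
    (hcard : 2 ^ Q.card ≤ N) {i : ℕ} (hi : i < K.length) (h56 : s.nat 56 0 = i)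
    (hv : IsState Q (s.cpx 3) v) :
    Run N M gateCmd s fun s' =>
      IsState Q (s'.cpx 3) (if K[i].support ⊆ Q then K[i].toOp *ᵥ v else v) := by
  have har : s.nat 0 (s.nat 13 i) = K[i].arity := by
    rw [hs.natPos i hi, hs.nat]
    exact natInput_arity K hi
  have hqu : ∀ j : Fin K[i].arity, s.nat 0 (s.nat 13 i + 1 + j) = K[i].qubits j := fun j => by
    rw [hs.natPos i hi, hs.nat]
    exact natInput_qubits K hi j
  refine Run.seq (Run.setN (Run.seq (Run.setN (Run.seq ((Run.forN K[i].arity (fun k s' =>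
    (∀ j : Fin K[i].arity, (j : ℕ) < k → s'.nat 73 j = K[i].qubits j) ∧ (0 < s'.nat 59 0 ↔
    ∃ j : Fin K[i].arity, (j : ℕ) < k ∧ K[i].qubits j ∉ Q)) (K[i].arity_le.trans hN) rfl
    ?_ ?_ ?_ fun s' _ h => h).mono ?_)))))
  · intro s1 hf1
    simp [NExpr.eval, arityExpr, hf1.nat 72 rfl, h56, har]
  · simp [NExpr.eval]
  · rintro k s1 hk hf1 h58 ⟨h1, h2⟩
    have hqk := hqu ⟨k, hk⟩
    simp only at hqk
    have hQk := hQ (K[i].qubits ⟨k, hk⟩)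
    refine Run.seq (Run.setN ((Run.setFlag (f := 59) (P := K[i].qubits ⟨k, hk⟩ ∉ Q) ?_).mono ?_))
    · simp [Test.holds, NExpr.eval, qubitExpr, hf1.nat 52 rfl, hf1.nat 0 rfl, hf1.nat 13 rfl,
        hf1.nat 56 rfl, h56, h58, hqk, ← hQk]
    · intro s2 hf2 h3
      refine ⟨fun j hj => ?_, ?_⟩
      · rcases Nat.lt_succ_iff_lt_or_eq.1 hj with hj | hj
        · simp [hf2.nat 73 rfl, NExpr.eval, h58, hj.ne, h1 j hj]
        · obtain rfl : j = ⟨k, hk⟩ := Fin.ext hj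
          simp [hf2.nat 73 rfl, NExpr.eval, h58, qubitExpr, hf1.nat 0 rfl, hf1.nat 13 rfl,
            hf1.nat 56 rfl, h56, hqk]
      · rw [Mem.setNat_nat_of_ne _ (by decide), h3, Mem.setNat_nat_of_ne _ (by decide), h2]
        constructor
        · rintro (⟨j, hj, h⟩ | h)
          · exact ⟨j, by omega, h⟩
          · exact ⟨⟨k, hk⟩, by simp, h⟩
        · rintro ⟨j, hj, h⟩
          rcases Nat.lt_succ_iff_lt_or_eq.1 hj with hj | hj
          · exact Or.inl ⟨j, hj, h⟩
          · obtain rfl : j = ⟨k, hk⟩ := Fin.ext hj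
            exact Or.inr h
  · rintro s1 hf1 ⟨h1, h2⟩
    have h2' : 0 < s1.nat 59 0 ↔ ¬ K[i].support ⊆ Q := by
      rw [h2, Finset.not_subset]
      constructor
      · rintro ⟨j, _, h⟩
        exact ⟨_, Gate.mem_support.2 ⟨j, rfl⟩, h⟩
      · rintro ⟨_, hx, h⟩
        obtain ⟨j, rfl⟩ := Gate.mem_support.1 hx
        exact ⟨j, j.isLt, h⟩
    refine Run.seq (Run.setN (Run.ite (fun hb => Run.skip ?_) (fun hb => ?_)))
    · simp only [Test.holds, NExpr.eval, Mem.setNat_nat_of_ne _ (by decide : 59 ≠ 74), h2'] at hb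
      rw [if_neg hb]
      simpa [hf1.cpx 3 rfl] using hv
    · simp only [Test.holds, NExpr.eval, Mem.setNat_nat_of_ne _ (by decide : 59 ≠ 74), h2',
        not_not] at hb
      rw [if_pos hb]
      refine run_applyCmd (q := K[i].qubits) (A := K[i].mat) hN ?_ ?_ ?_ hcard ?_ ?_ hb ?_ ?_
      · simp [hf1.nat 0 rfl, hs.card_eq]
      · simpa [hf1.nat 21 rfl] using hs.pow
      · simpa [hf1.nat 52 rfl] using hQ
      · simp [hf1.nat 72 rfl, NExpr.eval, arityExpr, h56, har]
      · simpa using fun j => h1 j j.isLt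
      · intro r hr c hc
        have h := cpxInput_gate K O δ hi hr hc
        simp only [NExpr.eval, Mem.setNat_cpx, Mem.setNat_nat_self, Function.update_self,
          hf1.nat 14 rfl, hf1.nat 56 rfl, hf1.cpx 0 rfl, hs.cpx]
        simpa [h56, hs.cpxPos i hi] using h
      · simpa [hf1.cpx 3 rfl] using hv

/-- Computes the final state of the circuit restricted to the qubits in `Q`. -/
def simulateCmd : Cmd :=
  .seq listCmd <|
  -- The array may still hold amplitudes from an earlier set, so those on subsets of `Q` are cleared
  -- first.
  .seq (.for false 67 (.reg 55) (.setC 3 (.get 54 (.reg 67)) (.ofNat (.const 0)))) <|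
  .seq (.setC 3 (.const 0) (.ofNat (.const 1))) <|
  .for true 56 (.get 0 (.const 1)) gateCmd

theorem run_simulateCmd (hN : n ≤ N) (hM : K.length ≤ M) (hs : Ready K O δ L s)
    (hQ : IsFlags (s.nat 52) Q) (hcard : 2 ^ Q.card ≤ N) :
    Run N M simulateCmd s fun s' => IsState Q (s'.cpx 3)
      (Circuit.toOp (K.filter fun g => g.support ⊆ Q) *ᵥ zeroState n) := by
  refine Run.seq ((run_listCmd hN hs.card_eq hs.pow hQ hcard).mono fun s1 hf1 hS => ?_)
  have hs1 := hs.frame hf1 rfl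
  refine Run.seq ((Run.forN (s1.nat 55 0) (fun k s' => ∀ u < k, s'.cpx 3 (s1.nat 54 u) = 0)
    ?_ rfl ?_ ?_ ?_ fun s' _ h => h).mono ?_)
  · rwa [hS.length_eq]
  · intro s2 hf2
    simp [NExpr.eval, hf2.nat 55 rfl]
  · simp
  · intro u s2 hu hf2 h67 hI
    refine Run.setC fun u' hu' => ?_
    simp only [NExpr.eval, CExpr.eval, Mem.setNat_cpx, Mem.setCpx_cpx_self, h67, hf2.nat 54 rfl]
    rcases Nat.lt_succ_iff_lt_or_eq.1 hu' with hu' | rfl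
    · simpa using update_apply_eq (T := fun _ => 0) (hI u' hu')
    · simp
  · intro s2 hf2 h2
    have hs2 := hs1.frame hf2 rfl
    refine Run.seq (Run.setC ?_)
    refine Run.forG K.length (fun i s' => IsState Q (s'.cpx 3)
      (Circuit.toOp ((K.take i).filter fun g => g.support ⊆ Q) *ᵥ zeroState n)) hM rfl ?_ ?_ ?_ ?_
    · intro s3 hf3
      simpa [NExpr.eval, hf3.nat 0 rfl] using hs2.length_eq
    · intro Y hY
      obtain ⟨u, hu, huY⟩ := hS.all Y hY
      have h := h2 u hu
      rw [huY] at h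
      by_cases hY0 : Y = ∅
      · subst hY0
        have : ind (∅ : Finset (Fin n)) = fun _ => false := by ext k; simp [ind]
        simp [NExpr.eval, CExpr.eval, setMask_empty, Circuit.toOp, zeroState, this]
      · have h1 : setMask Y ≠ 0 := fun h => hY0 (setMask_injective (h.trans setMask_empty.symm))
        have h3 : ind Y ≠ fun _ => false := by
          intro h
          obtain ⟨k, hk⟩ := Finset.nonempty_iff_ne_empty.2 hY0
          simpa [ind, hk] using congrFun h k
        simp [NExpr.eval, CExpr.eval, h1, h, Circuit.toOp, zeroState, h3]
    · intro i s3 hi hf3 h56 hI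
      have hs3 : Ready K O δ L s3 := by
        refine Ready.frame (c := simulateCmd) hs ⟨fun b hb => ?_, fun b hb => ?_⟩ rfl
        · simp only [simulateCmd, Cmd.writesN, Bool.or_eq_false_iff] at hb
          rw [hf3.nat b hb.2.2.2, Mem.setCpx_nat, hf2.nat b hb.2.1, hf1.nat b hb.1]
        · simp only [simulateCmd, Cmd.writesC, Bool.or_eq_false_iff] at hb
          rw [hf3.cpx b hb.2.2.2, Mem.setCpx_cpx_of_ne _ (by simpa using hb.2.2.1),
            hf2.cpx b hb.2.1, hf1.cpx b hb.1]
      refine (run_gateCmd hN hs3 ?_ hcard hi h56 hI).mono fun s4 _ h4 => ?_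
      · simpa [hf3.nat 52 rfl, hf2.nat 52 rfl, hf1.nat 52 rfl] using hQ
      · rw [Mem.setNat_cpx, List.take_add_one, List.getElem?_eq_getElem hi, Option.toList_some,
          List.filter_append, Circuit.toOp_append]
        by_cases hg : K[i].support ⊆ Q
        · rw [if_pos hg] at h4
          rw [List.filter_cons_of_pos (by simpa using hg), List.filter_nil]
          simpa [Circuit.toOp, Matrix.mulVec_mulVec] using h4
        · rw [if_neg hg] at h4
          rw [List.filter_cons_of_neg (by simpa using hg), List.filter_nil]
          simpa [Circuit.toOp] using h4
    · intro s3 _ h3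
      rwa [List.take_length] at h3

end Evaluation

/-! ### Mean values on connected sets, and the recursion for the factors. -/

section Evaluation

variable {n a N M : ℕ} {K : Circuit n} {O : Fin n → Matrix Bool Bool ℂ} {δ : ℝ}
  {L : List (Finset (Fin n))} {s : Mem} {Q R : Finset (Fin n)} {v : Bits n → ℂ}

/-- Computes the layout lightcone of the set in the register `50`. -/
def coneCmd : Cmd :=
  .for false 51 (.reg 0) <|
    .seq (.setR 59 (.const 0)) <|
    .seq (.for false 53 (.reg 0) (.ite (.and (.pos (futureExpr (.reg 51) (.reg 53)))
      (.pos (rowExpr (.reg 50) (.reg 53)))) (.setR 59 (.const 1)) .skip))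
    (.setN 52 (.reg 51) (.reg 59))

theorem run_coneCmd (hN : n ≤ N) (hs : Ready K O δ L s) {e : ℕ} (he : e < L.length)
    (h50 : s.nat 50 0 = e) :
    Run N M coneCmd s fun s' => IsFlags (s'.nat 52) (K.cone (L.getD e ∅)) := by
  refine Run.forN n (fun k s' => ∀ q : Fin n, (q : ℕ) < k →
    (0 < s'.nat 52 q ↔ q ∈ K.cone (L.getD e ∅))) hN rfl ?_ ?_ ?_ fun s' _ h q => h q q.isLt
  · intro s1 hf1
    simpa [NExpr.eval] using (hs.frame hf1 rfl).card_eq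
  · simp
  · intro q s1 hq hf1 h51 hI
    have hs1 := hs.frame hf1 rfl
    refine Run.seq (Run.setN (Run.seq ((Run.flag (f := 59) n (fun k => ∃ hk : k < n,
      (⟨k, hk⟩ : Fin n) ∈ K.future ⟨q, hq⟩ ∧ (⟨k, hk⟩ : Fin n) ∈ L.getD e ∅) hN (by decide) rfl
      ?_ ?_).mono ?_)))
    · intro s2 hf2
      simp [NExpr.eval, hf2.nat 0 rfl, hs1.card_eq]
    · intro k s2 hk hf2 h53
      refine Run.setFlag ?_
      have e1 := hs1.futures.pos_iff (q := q) (k := ⟨k, hk⟩)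
      have e2 := hs1.list.rows.pos_iff (q := e) (k := ⟨k, hk⟩)
      rw [show futureRow K q = K.future ⟨q, hq⟩ by simp [futureRow, hq]] at e1
      simp only [Test.holds, futureExpr, rowExpr, NExpr.eval, hf2.nat 51 rfl, hf2.nat 20 rfl,
        hf2.nat 23 rfl, hf2.nat 50 rfl, hf2.nat 22 rfl, hf2.nat 30 rfl, h53]
      simp only [ne_eq, Nat.reduceEqDiff, not_false_eq_true, Mem.setNat_nat_of_ne, h51,
        hf1.nat 50 rfl, h50, hs1.off q hq.le, hs1.list.ro e he.le, e1, e2]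
      exact ⟨fun h => ⟨hk, h⟩, fun ⟨_, h⟩ => h⟩
    · intro s2 hf2 h59
      have h59' : 0 < s2.nat 59 0 ↔ (⟨q, hq⟩ : Fin n) ∈ K.cone (L.getD e ∅) := by
        rw [h59, Circuit.mem_cone_iff_future]
        simp only [Mem.setNat_nat_self, NExpr.eval, Function.update_self, lt_irrefl, false_or]
        constructor
        · rintro ⟨k, _, hk, h1, h2⟩
          exact ⟨⟨k, hk⟩, h2, h1⟩
        · rintro ⟨k, h2, h1⟩
          exact ⟨k, k.isLt, k.isLt, h1, h2⟩
      have h51' : s2.nat 51 0 = q := by simp [hf2.nat 51 rfl, h51]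
      refine Run.setN fun q' hq' => ?_
      rcases Nat.lt_succ_iff_lt_or_eq.1 hq' with hq' | hq'
      · simpa [NExpr.eval, h51', hq'.ne, hf2.nat 52 rfl] using hI q' hq'
      · obtain rfl : q' = ⟨q, hq⟩ := Fin.ext hq'
        simpa [NExpr.eval, h51'] using h59'

/-- The operator on one qubit is treated as a gate of arity 1 whose four entries start at position
`1 + 4j` of the numerical input. -/
def oneQubitCmd : Cmd :=
  .seq (.setR 72 (.const 1)) <|
  .seq (.setN 73 (.const 0) (.reg 78)) <|
  .seq (.setR 74 (.add (.const 1)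
    (.add (.add (.add (.reg 78) (.reg 78)) (.reg 78)) (.reg 78)))) applyCmd

theorem run_oneQubitCmd (hN : n ≤ N) (hs : Ready K O δ L s) (hQ : IsFlags (s.nat 52) Q)
    (hcard : 2 ^ Q.card ≤ N) {j : Fin n} (h78 : s.nat 78 0 = j) (hj : j ∈ Q)
    (hv : IsState Q (s.cpx 3) v) :
    Run N M oneQubitCmd s fun s' => IsState Q (s'.cpx 3) (partialTensor O {j} *ᵥ v) := by
  rw [partialTensor_singleton]
  refine Run.seq (Run.setN (Run.seq (Run.setN (Run.seq (Run.setN ?_)))))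
  refine run_applyCmd (q := single j) (A := bitMat (O j)) hN ?_ ?_ ?_ hcard ?_ ?_ ?_ ?_ ?_
  · simp [hs.card_eq]
  · simpa using hs.pow
  · simpa using hQ
  · simp [NExpr.eval]
  · intro i
    obtain rfl : i = 0 := Subsingleton.elim _ _
    have h : single j 0 = j := rfl
    simpa [NExpr.eval, h] using h78
  · intro k hk
    obtain ⟨i, -, rfl⟩ := Finset.mem_map.1 hk
    exact hj
  · intro r hr c hc
    have h := cpxInput_tensor K O δ j (b := r * 2 + c) (by omega)
    simp only [NExpr.eval, Mem.setNat_cpx, Mem.setNat_nat_self, Function.update_self, hs.cpx]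
    simp only [ne_eq, Nat.reduceEqDiff, not_false_eq_true, Mem.setNat_nat_of_ne, h78]
    rw [pow_one, add_assoc, h]
    rw [pow_one] at hr hc
    interval_cases r <;> interval_cases c <;> simp [bitMat, bits]
  · simpa using hv

def observeCmd : Cmd :=
  .seq listCmd <|
  .seq (.for false 67 (.reg 55) (.setC 8 (.get 54 (.reg 67)) (.get 3 (.get 54 (.reg 67))))) <|
  .seq (.for false 78 (.reg 0) (.ite (.pos (rowExpr (.reg 50) (.reg 78))) oneQubitCmd .skip)) <|
  -- Applying the operators has overwritten the list of subsets of `Q`, so it is made again for the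
  -- inner product with the saved state in the array `8`.
  .seq listCmd <|
  .seq (.setC 9 (.const 0) (.ofNat (.const 0))) <|
  .for false 67 (.reg 55) (.setC 9 (.const 0) (.add (.get 9 (.const 0))
    (.mul (.conj (.get 8 (.get 54 (.reg 67)))) (.get 3 (.get 54 (.reg 67))))))

theorem run_observeCmd (hN : n ≤ N) (hs : Ready K O δ L s) (hQ : IsFlags (s.nat 52) Q)
    (hcard : 2 ^ Q.card ≤ N) {e : ℕ} (he : e < L.length) (h50 : s.nat 50 0 = e)
    (hSQ : L.getD e ∅ ⊆ Q) (hv : IsState Q (s.cpx 3) v) :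
    Run N M observeCmd s fun s' => s'.cpx 9 0 = ∑ Y ∈ Q.powerset,
      (starRingEnd ℂ) (v (ind Y)) * (partialTensor O (L.getD e ∅) *ᵥ v) (ind Y) := by
  refine Run.seq ((run_listCmd hN hs.card_eq hs.pow hQ hcard).mono fun s1 hf1 hS => ?_)
  have hs1 := hs.frame hf1 rfl
  have hlen : s1.nat 55 0 ≤ N := by rwa [hS.length_eq]
  refine Run.seq ((Run.forN (s1.nat 55 0) (fun k s' => ∀ u < k, s'.cpx 8 (s1.nat 54 u) =
    s1.cpx 3 (s1.nat 54 u)) hlen rfl ?_ ?_ ?_ fun s' _ h => h).mono ?_)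
  · intro s2 hf2
    simp [NExpr.eval, hf2.nat 55 rfl]
  · simp
  · intro u s2 hu hf2 h67 hI
    refine Run.setC fun u' hu' => ?_
    simp only [NExpr.eval, CExpr.eval, Mem.setNat_cpx, Mem.setCpx_cpx_self, h67, hf2.nat 54 rfl,
      hf2.cpx 3 rfl]
    rcases Nat.lt_succ_iff_lt_or_eq.1 hu' with hu' | rfl
    · exact update_apply_eq (T := s1.cpx 3) (hI u' hu')
    · simp
  intro s2 hf2 h8
  have hs2 := hs1.frame hf2 rfl
  have hv8 : IsState Q (s2.cpx 8) v := by
    intro Y hY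
    obtain ⟨u, hu, huY⟩ := hS.all Y hY
    rw [← huY, h8 u hu, huY, hf1.cpx 3 rfl, hv Y hY]
  refine Run.seq ((Run.forN n (fun k s' => IsState Q (s'.cpx 3)
    (partialTensor O ((L.getD e ∅).filter fun i : Fin n => (i : ℕ) < k) *ᵥ v)) hN rfl
    ?_ ?_ ?_ fun s' _ h => h).mono ?_)
  · intro s3 hf3
    simpa [NExpr.eval] using (hs2.frame hf3 rfl).card_eq
  · rw [filter_val_lt_zero, partialTensor_empty, Matrix.one_mulVec]
    simpa [hf2.cpx 3 rfl, hf1.cpx 3 rfl] using hv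
  · intro k s3 hk hf3 h78 hI
    have hs3 := hs2.frame hf3 rfl
    have ht : (Test.pos (rowExpr (.reg 50) (.reg 78))).holds s3 ↔
        (⟨k, hk⟩ : Fin n) ∈ L.getD e ∅ := by
      have h := hs3.list.rows.pos_iff (q := e) (k := ⟨k, hk⟩)
      simpa only [Test.holds, rowExpr, NExpr.eval, h78, hf3.nat 50 rfl, hf2.nat 50 rfl,
        hf1.nat 50 rfl, h50, hs3.list.ro e he.le] using h
    rw [filter_val_lt_succ _ hk]
    refine Run.ite (fun hb => ?_) (fun hb => Run.skip ?_)
    · rw [ht] at hb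
      rw [if_pos hb, Finset.insert_eq, partialTensor_union _ (by simp), ← Matrix.mulVec_mulVec]
      refine (run_oneQubitCmd hN hs3 ?_ hcard h78 (hSQ hb) hI).mono fun s4 _ h => by simpa using h
      simpa [hf3.nat 52 rfl, hf2.nat 52 rfl, hf1.nat 52 rfl] using hQ
    · rw [ht] at hb
      rw [if_neg hb]
      simpa using hI
  · intro s3 hf3 h3
    rw [filter_val_lt_self] at h3
    have hs3 := hs2.frame hf3 rfl
    refine Run.seq ((run_listCmd (Q := Q) hN hs3.card_eq hs3.pow ?_ hcard).mono
      fun s4 hf4 hS' => ?_)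
    · simpa [hf3.nat 52 rfl, hf2.nat 52 rfl, hf1.nat 52 rfl] using hQ
    refine Run.seq (Run.setC ?_)
    refine Run.forN (s4.nat 55 0) (fun k s' => s'.cpx 9 0 = ∑ u ∈ Finset.range k,
      (starRingEnd ℂ) (s4.cpx 8 (s4.nat 54 u)) * s4.cpx 3 (s4.nat 54 u)) ?_ rfl ?_ ?_ ?_ ?_
    · rwa [hS'.length_eq]
    · intro s5 hf5
      simp [NExpr.eval, hf5.nat 55 rfl]
    · simp [NExpr.eval, CExpr.eval]
    · intro u s5 hu hf5 h67 hI
      refine Run.setC ?_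
      simp [NExpr.eval, CExpr.eval, hI, Finset.sum_range_succ, h67, hf5.cpx 8 rfl, hf5.cpx 3 rfl,
        hf5.nat 54 rfl]
    · intro s5 _ hI
      rw [hI, hS'.sum_eq fun x => (starRingEnd ℂ) (s4.cpx 8 x) * s4.cpx 3 x]
      refine Finset.sum_congr rfl fun Y hY => ?_
      rw [Finset.mem_powerset] at hY
      rw [hf4.cpx 8 rfl, hf4.cpx 3 rfl, hf3.cpx 8 rfl, hv8 Y hY, h3 Y hY]

/-- Computes the mean value of the operators on the set in the register `50`. -/
def valueCmd : Cmd := .seq coneCmd (.seq simulateCmd observeCmd)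

theorem run_valueCmd (hN : n ≤ N) (hM : K.length ≤ M) (hs : Ready K O δ L s) {e : ℕ}
    (he : e < L.length) (h50 : s.nat 50 0 = e) (hcard : 2 ^ (K.cone (L.getD e ∅)).card ≤ N) :
    Run N M valueCmd s fun s' =>
      s'.cpx 9 0 = meanValue K.toOp (partialTensor O (L.getD e ∅)) := by
  refine Run.seq ((run_coneCmd hN hs he h50).mono fun s1 hf1 hQ => ?_)
  have hs1 := hs.frame hf1 rfl
  refine Run.seq ((run_simulateCmd hN hM hs1 hQ hcard).mono fun s2 hf2 hv => ?_)
  refine (run_observeCmd hN (hs1.frame hf2 rfl) ?_ hcard he ?_ (Circuit.subset_cone _ _) hv).mono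
    fun s3 _ h3 => ?_
  · rwa [hf2.nat 52 rfl]
  · rw [hf2.nat 50 rfl, hf1.nat 50 rfl, h50]
  · rw [h3, ← meanValue_eq_sum]
    · rw [meanValue, meanValue,
        Circuit.conj_filter K (actsOn_partialTensor O (L.getD e ∅)) le_rfl]
    · exact (supportedOn_zeroState _).toOp_mulVec _ fun g hg => by simpa using (List.mem_filter.1 hg).2

/-- Disconnected subsets have factor 1, and the connected proper subsets precede the set because the
list is sorted by size. All factors needed to isolate that of the set are thus known in time. -/
theorem IsComplete.prod_powerset {r : ℕ} (hL : IsComplete K r L) {E : Finset (Fin n) → ℂ}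
    (hE : ∀ S, ¬ Grown K.Adj S → E S = 1) {e : ℕ} (he : e < L.length) :
    ∏ S ∈ (L.getD e ∅).powerset, E S = (∏ i ∈ (Finset.range e).filter
      (fun i => L.getD i ∅ ⊆ L.getD e ∅), E (L.getD i ∅)) * E (L.getD e ∅) := by
  have hget : ∀ i (hi : i < L.length), L.getD i ∅ = L[i] := fun i hi => List.getD_eq_getElem _ _ hi
  have hmem : L.getD e ∅ ∈ L := by rw [hget e he]; exact List.getElem_mem he
  have h1 : ((Finset.range L.length).filter fun i => L.getD i ∅ ⊆ L.getD e ∅) =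
      insert e ((Finset.range e).filter fun i => L.getD i ∅ ⊆ L.getD e ∅) := by
    ext i
    simp only [Finset.mem_filter, Finset.mem_range, Finset.mem_insert]
    constructor
    · rintro ⟨hi, hsub⟩
      rcases lt_trichotomy i e with h | h | h
      · exact Or.inr ⟨h, hsub⟩
      · exact Or.inl h
      · have h2 := List.pairwise_iff_getElem.1 hL.sorted e i he hi h
        rw [hget i hi, hget e he] at hsub
        exact Or.inl ((List.Nodup.getElem_inj_iff hL.nodup).1 (Finset.eq_of_subset_of_card_le hsub h2))
    · rintro (rfl | ⟨h, hsub⟩)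
      · exact ⟨he, le_rfl⟩
      · exact ⟨h.trans he, hsub⟩
  rw [mul_comm, ← Finset.prod_insert (f := fun i => E (L.getD i ∅)) (by simp), ← h1]
  symm
  refine Finset.prod_of_injOn (fun i => L.getD i ∅) ?_ ?_ ?_ fun _ _ => rfl
  · intro i hi j hj hij
    simp only [Finset.coe_filter, Finset.mem_range, Set.mem_ofPred_eq] at hi hj
    simp only [hget i hi.1, hget j hj.1] at hij
    exact (List.Nodup.getElem_inj_iff hL.nodup).1 hij
  · intro i hi
    simp only [Finset.coe_filter, Finset.mem_range, Set.mem_ofPred_eq] at hi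
    simpa using hi.2
  · intro S hS hS'
    apply hE
    intro hg
    rw [Finset.mem_powerset] at hS
    obtain ⟨i, hi, hiS⟩ := List.mem_iff_getElem.1 ((hL.mem S).2
      ⟨hg, (Finset.card_le_card hS).trans ((hL.mem _).1 hmem).2⟩)
    exact hS' ⟨i, by simp [← hget i hi] at hiS ⊢; exact ⟨hi, by rw [hiS]; simpa using hS⟩,
      by simp only [hget i hi, hiS]⟩

/-- Register `80` is raised if an earlier set is not contained in the current one; otherwise its
stored factor is divided out of the mean value. -/
def divideCmd : Cmd :=
  .for false 79 (.reg 50) <|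
    .seq (.setR 80 (.const 0)) <|
    .seq (.for false 81 (.reg 0) (.ite (.and (.pos (rowExpr (.reg 79) (.reg 81)))
      (.not (.pos (rowExpr (.reg 50) (.reg 81))))) (.setR 80 (.const 1)) .skip)) <|
    .ite (.pos (.reg 80)) .skip
      (.setC 9 (.const 0) (.div (.get 9 (.const 0)) (.get 7 (.reg 79))))

theorem run_divideCmd (hN : n ≤ N) (hs : Ready K O δ L s) {e : ℕ} (he : e < L.length)
    (heN : e ≤ N) (h50 : s.nat 50 0 = e) {E : Finset (Fin n) → ℂ} (hE : ∀ S, E S ≠ 0)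
    (h7 : ∀ i < e, s.cpx 7 i = E (L.getD i ∅)) :
    Run N M divideCmd s fun s' => s'.cpx 9 0 * (∏ i ∈ (Finset.range e).filter
      (fun i => L.getD i ∅ ⊆ L.getD e ∅), E (L.getD i ∅)) = s.cpx 9 0 := by
  refine Run.forN e (fun k s' => s'.cpx 9 0 * (∏ i ∈ (Finset.range k).filter
      (fun i => L.getD i ∅ ⊆ L.getD e ∅), E (L.getD i ∅)) = s.cpx 9 0) heN rfl ?_ ?_ ?_
      fun s' _ h => h
  · intro s1 hf1
    simp [NExpr.eval, hf1.nat 50 rfl, h50]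
  · simp
  · intro i s1 hi hf1 h79 hI
    have hs1 := hs.frame hf1 rfl
    refine Run.seq (Run.setN (Run.seq ((Run.flag (f := 80) n (fun k => ∃ hk : k < n,
      (⟨k, hk⟩ : Fin n) ∈ L.getD i ∅ ∧ (⟨k, hk⟩ : Fin n) ∉ L.getD e ∅) hN (by decide) rfl
      ?_ ?_).mono ?_)))
    · intro s2 hf2
      simp [NExpr.eval, hf2.nat 0 rfl, hs1.card_eq]
    · intro k s2 hk hf2 h81
      refine Run.setFlag ?_
      have e1 := hs1.list.rows.pos_iff (q := i) (k := ⟨k, hk⟩)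
      have e2 := hs1.list.rows.pos_iff (q := e) (k := ⟨k, hk⟩)
      simp only [Test.holds, rowExpr, NExpr.eval, hf2.nat 79 rfl, hf2.nat 50 rfl, hf2.nat 22 rfl,
        hf2.nat 30 rfl, h81]
      simp only [ne_eq, Nat.reduceEqDiff, not_false_eq_true, Mem.setNat_nat_of_ne, h79,
        hf1.nat 50 rfl, h50, hs1.list.ro i (hi.trans he).le, hs1.list.ro e he.le, e1, e2]
      exact ⟨fun h => ⟨hk, h⟩, fun ⟨_, h⟩ => h⟩
    · intro s2 hf2 h80
      have h80' : 0 < s2.nat 80 0 ↔ ¬ L.getD i ∅ ⊆ L.getD e ∅ := by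
        rw [h80, Finset.not_subset]
        simp only [Mem.setNat_nat_self, NExpr.eval, Function.update_self, lt_irrefl, false_or]
        constructor
        · rintro ⟨k, _, hk, h⟩
          exact ⟨_, h⟩
        · rintro ⟨k, h⟩
          exact ⟨k, k.isLt, k.isLt, h⟩
      have h9 : s2.cpx 9 = s1.cpx 9 := hf2.cpx 9 rfl
      have h7' : s2.cpx 7 i = E (L.getD i ∅) := by
        rw [← h7 i hi, hf2.cpx 7 rfl, Mem.setNat_cpx, hf1.cpx 7 rfl]
      have h79' : s2.nat 79 0 = i := by simp [hf2.nat 79 rfl, h79]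
      refine Run.ite (fun hb => Run.skip ?_) (fun hb => Run.setC ?_)
      · simp only [Test.holds, NExpr.eval, h80'] at hb
        rw [Finset.range_add_one, Finset.filter_insert, if_neg hb]
        simpa [h9] using hI
      · simp only [Test.holds, NExpr.eval, h80', not_not] at hb
        rw [Finset.range_add_one, Finset.filter_insert, if_pos hb, Finset.prod_insert (by simp)]
        simp only [Mem.setNat_cpx, Mem.setCpx_cpx_self, NExpr.eval, CExpr.eval, h79', h7', h9,
          Function.update_self]
        rw [← mul_assoc, div_mul_cancel₀ _ (hE _), hI]

/-- The array `7` keeps the factors found so far, and the output entry accumulates their product. -/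
def evaluateCmd : Cmd :=
  .seq (.setC 1 (.const 0) (.ofNat (.const 1))) <|
  .for false 50 (.reg 33) <|
    .seq valueCmd <|
    .seq divideCmd <|
    .seq (.setC 7 (.reg 50) (.get 9 (.const 0)))
      (.setC 1 (.const 0) (.mul (.get 1 (.const 0)) (.get 9 (.const 0))))

theorem run_evaluateCmd {r : ℕ} (hN : n ≤ N) (hM : K.length ≤ M) (hs : Ready K O δ L s)
    (hL : IsComplete K r L) (hLN : L.length ≤ N) (hcard : ∀ S ∈ L, 2 ^ (K.cone S).card ≤ N)
    {E : Finset (Fin n) → ℂ} (hE : ∀ S, E S ≠ 0) (hE1 : ∀ S, ¬ Grown K.Adj S → E S = 1)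
    (hprod : ∀ T, meanValue K.toOp (partialTensor O T) = ∏ S ∈ T.powerset, E S) :
    Run N M evaluateCmd s fun s' => s'.output = ∏ S ∈ L.toFinset, E S := by
  refine Run.seq (Run.setC ?_)
  refine Run.forN L.length (fun k s' => (∀ i < k, s'.cpx 7 i = E (L.getD i ∅)) ∧
    s'.cpx 1 0 = ∏ i ∈ Finset.range k, E (L.getD i ∅)) hLN rfl ?_ ?_ ?_ ?_
  · intro s1 hf1
    simp [NExpr.eval, hf1.nat 33 rfl, hs.list.cnt]
  · simp [NExpr.eval, CExpr.eval]
  · rintro e s1 he hf1 h50 ⟨hI1, hI2⟩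
    have hs1 : Ready K O δ L s1 := by
      refine Ready.frame (c := evaluateCmd) hs ⟨fun b hb => ?_, fun b hb => ?_⟩ rfl
      · simp only [evaluateCmd, Cmd.writesN, Bool.or_eq_false_iff] at hb
        rw [hf1.nat b hb.2, Mem.setCpx_nat]
      · simp only [evaluateCmd, Cmd.writesC, Bool.or_eq_false_iff] at hb
        rw [hf1.cpx b hb.2, Mem.setCpx_cpx_of_ne _ (by simpa using hb.1)]
    have hmem : L.getD e ∅ ∈ L := by
      rw [List.getD_eq_getElem _ _ he]; exact List.getElem_mem he
    refine Run.seq ((run_valueCmd hN hM hs1 he h50 (hcard _ hmem)).mono fun s2 hf2 h2 => ?_)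
    have hs2 := hs1.frame hf2 rfl
    refine Run.seq ((run_divideCmd hN hs2 he (he.le.trans hLN) (by rw [hf2.nat 50 rfl, h50]) hE
      (by rwa [hf2.cpx 7 rfl])).mono fun s3 hf3 h3 => ?_)
    rw [h2, hprod, hL.prod_powerset hE1 he, mul_comm] at h3
    have h9 : s3.cpx 9 0 = E (L.getD e ∅) :=
      mul_left_cancel₀ (Finset.prod_ne_zero_iff.2 fun i _ => hE _) h3
    have h50' : s3.nat 50 0 = e := by rw [hf3.nat 50 rfl, hf2.nat 50 rfl, h50]
    have h7 : s3.cpx 7 = s1.cpx 7 := by rw [hf3.cpx 7 rfl, hf2.cpx 7 rfl]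
    have h1 : s3.cpx 1 = s1.cpx 1 := by rw [hf3.cpx 1 rfl, hf2.cpx 1 rfl]
    refine Run.seq (Run.setC (Run.setC ⟨fun i hi => ?_, ?_⟩))
    · rcases Nat.lt_succ_iff_lt_or_eq.1 hi with hi | rfl
      · simp only [NExpr.eval, CExpr.eval, Mem.setNat_cpx, ne_eq, Nat.reduceEqDiff,
          not_false_eq_true, Mem.setCpx_cpx_of_ne, Mem.setCpx_cpx_self, h50', h7,
          Function.update_of_ne hi.ne, hI1 i hi]
      · simp only [NExpr.eval, CExpr.eval, Mem.setNat_cpx, ne_eq, Nat.reduceEqDiff,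
          not_false_eq_true, Mem.setCpx_cpx_of_ne, Mem.setCpx_cpx_self, h50', h9,
          Function.update_self]
    · rw [Finset.prod_range_succ, ← hI2]
      simp [NExpr.eval, CExpr.eval, h9, h1]
  · rintro s1 _ ⟨-, h1⟩
    rw [Mem.output, h1]
    refine Finset.prod_of_injOn (fun i => L.getD i ∅) ?_ ?_ ?_ fun _ _ => rfl
    · intro i hi j hj hij
      simp only [Finset.coe_range, Set.mem_Iio] at hi hj
      simp only [List.getD_eq_getElem _ _ hi, List.getD_eq_getElem _ _ hj] at hij
      exact (List.Nodup.getElem_inj_iff hL.nodup).1 hij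
    · intro i hi
      simp only [Finset.coe_range, Set.mem_Iio] at hi
      simp only [List.getD_eq_getElem _ _ hi, List.coe_toFinset, Set.mem_ofPred_eq]
      exact List.getElem_mem hi
    · intro S hS hS'
      obtain ⟨i, hi, hiS⟩ := List.mem_iff_getElem.1 (List.mem_toFinset.1 hS)
      exact absurd ⟨i, by simpa using hi, by simp only [List.getD_eq_getElem _ _ hi, hiS]⟩ hS'

end Evaluation

/-! ## The complete program -/

section Main

variable {n N M : ℕ} {K : Circuit n} {O : Fin n → Matrix Bool Bool ℂ} {δ : ℝ}

def mainCmd : Cmd :=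
  .seq levelsCmd <| .seq parseCmd <| .seq tablesCmd <| .seq futuresCmd <| .seq roundsCmd evaluateCmd

/-- The cutoff `p` is found at run time, so the loop bounds are required for every `p` below which
`δ 2 ^ i < n` holds. The list runs to size `p + 1`, one more than the accuracy asks for. -/
theorem run_mainCmd (hN : n ≤ N) (hδN : ∀ p : ℕ, δ * 2 ^ p < n → p < N)
    (hbound : ∀ p : ℕ, (∀ i < p, δ * 2 ^ i < n) → p + 1 ≤ N ∧
      (∀ L : List (Finset (Fin n)), L.Nodup →
        (∀ S ∈ L, Grown K.Adj S ∧ S.card ≤ p + 1) → L.length ≤ N) ∧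
      ∀ S : Finset (Fin n), S.card ≤ p + 1 → 2 ^ (K.cone S).card ≤ N)
    {E : Finset (Fin n) → ℂ} (hE : ∀ S, E S ≠ 0) (hE1 : ∀ S, ¬ Grown K.Adj S → E S = 1)
    (hprod : ∀ T, meanValue K.toOp (partialTensor O T) = ∏ S ∈ T.powerset, E S) :
    Run N K.length mainCmd (initMem K O δ) fun s' => ∃ (k : ℕ) (u : Finset (Finset (Fin n))),
      (n : ℝ) ≤ δ * 2 ^ k ∧ (∀ S, S ∈ u ↔ Grown K.Adj S ∧ S.card ≤ k + 1) ∧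
      s'.output = ∏ S ∈ u, E S := by
  set s := initMem K O δ with hs
  have hnat0 : s.nat 0 = fun i => (natInput K).getD i 0 := by simp [hs, initMem]
  have hcpx0 : s.cpx 0 = fun i => (cpxInput K O δ).getD i 0 := by simp [hs, initMem]
  have hz : ∀ a i, a ≠ 0 → s.nat a i = 0 := fun a i ha => by simp [hs, initMem, ha]
  have h0 : s.nat 0 0 = n := by simp [hnat0, natInput]
  have h1 : s.nat 0 1 = K.length := by simp [hnat0, natInput]
  refine Run.seq ((run_levelsCmd h0 (hz 1 0 one_ne_zero) (by simp [hcpx0, cpxInput]) hδN).mono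
    fun s1 hf1 ⟨hp, hp'⟩ => ?_)
  obtain ⟨hpN, hlist, hcone⟩ := hbound _ hp'
  refine Run.seq ((run_parseCmd (K := K) hN le_rfl (by rw [hf1.nat 0 rfl, hnat0])).mono
    fun s2 hf2 h2 => ?_)
  refine Run.seq ((run_tablesCmd hN (by rw [hf2.nat 0 rfl, hf1.nat 0 rfl, h0])).mono
    fun s3 hf3 h3 => ?_)
  have h13 : ∀ i < K.length, s3.nat 13 i = natPos K i := fun i hi => by
    rw [hf3.nat 13 rfl, (h2 i hi).1]
  have h14 : ∀ i < K.length, s3.nat 14 i = cpxPos K i := fun i hi => by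
    rw [hf3.nat 14 rfl, (h2 i hi).2]
  have hnat3 : s3.nat 0 = fun i => (natInput K).getD i 0 := by
    rw [hf3.nat 0 rfl, hf2.nat 0 rfl, hf1.nat 0 rfl, hnat0]
  refine Run.seq ((run_futuresCmd (K := K) hN le_rfl ?_ ?_ ?_ (fun q hq => (h3 q hq.le).1) ?_).mono
    fun s4 hf4 h4 => ?_)
  · simp [hnat3, natInput]
  · simp [hnat3, natInput]
  · rw [hnat3]
    exact isLayout_of_natPos h13
  · intro i
    rw [hf3.nat 23 rfl, hf2.nat 23 rfl, hf1.nat 23 rfl, hz 23 i (by decide)]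
  have h20 : ∀ q ≤ n, s4.nat 20 q = q * n := fun q hq => by rw [hf4.nat 20 rfl, (h3 q hq).1]
  have h21 : ∀ q ≤ n, s4.nat 21 q = 2 ^ q := fun q hq => by rw [hf4.nat 21 rfl, (h3 q hq).2]
  have hnat4 : s4.nat 0 = fun i => (natInput K).getD i 0 := by rw [hf4.nat 0 rfl, hnat3]
  refine Run.seq ((run_roundsCmd (K := K) (p := s1.nat 1 0) hN hpN hlist ?_ ?_
    (fun q hq => h20 q hq.le) h21 h4 ?_ ?_ ?_ ?_).mono fun s5 hf5 ⟨L, hL, hC⟩ => ?_)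
  · simp [hnat4, natInput]
  · rw [hf4.nat 1 rfl, hf3.nat 1 rfl, hf2.nat 1 rfl]
  iterate 4
    · intro i
      rw [hf4.nat _ rfl, hf3.nat _ rfl, hf2.nat _ rfl, hf1.nat _ rfl, hz _ i (by decide)]
  have hready : Ready K O δ L s5 := by
    refine ⟨?_, ?_, fun i hi => ?_, fun i hi => ?_, ?_, ?_, ?_, hL⟩
    · rw [hf5.nat 0 rfl, hnat4]
    · rw [hf5.cpx 0 rfl, hf4.cpx 0 rfl, hf3.cpx 0 rfl, hf2.cpx 0 rfl, hf1.cpx 0 rfl, hcpx0]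
    · rw [hf5.nat 13 rfl, hf4.nat 13 rfl, h13 i hi]
    · rw [hf5.nat 14 rfl, hf4.nat 14 rfl, h14 i hi]
    · rwa [hf5.nat 20 rfl]
    · rwa [hf5.nat 21 rfl]
    · rwa [hf5.nat 23 rfl]
  refine (run_evaluateCmd hN le_rfl hready hC (hlist L hC.nodup fun S hS => (hC.mem S).1 hS)
    (fun S hS => hcone S ((hC.mem S).1 hS).2) hE hE1 hprod).mono fun s6 _ h6 => ?_
  exact ⟨s1.nat 1 0, L.toFinset, hp, fun S => by rw [List.mem_toFinset, hC.mem], h6⟩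

theorem four_mul_mul_self_le {h : ℕ} (hh : 1 ≤ h) : 4 * (h * h) ≤ 2 ^ (2 * h) := by
  have h1 : h ≤ 2 ^ (h - 1) := by
    have := Nat.lt_two_pow_self (n := h - 1)
    omega
  calc 4 * (h * h) ≤ 4 * (2 ^ (h - 1) * 2 ^ (h - 1)) := by gcongr
    _ = 2 ^ (2 * h) := by
      obtain ⟨k, rfl⟩ := Nat.exists_eq_add_of_le' hh
      rw [Nat.add_sub_cancel]
      ring

/-- Bounds on the numbers of iterations of the loops. -/
theorem loop_bounds (hn : 1 ≤ n) (hδ : 0 < δ) {ν : ℝ} (hν : ν = 2 * n / min δ 1) {p : ℕ}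
    (hp : ∀ i < p, δ * 2 ^ i < n) (hN : N = ⌊ν ^ (5 * K.ellOne)⌋₊) : p + 1 ≤ N ∧
      (∀ L : List (Finset (Fin n)), L.Nodup →
        (∀ S ∈ L, Grown K.Adj S ∧ S.card ≤ p + 1) → L.length ≤ N) ∧
      ∀ S : Finset (Fin n), S.card ≤ p + 1 → 2 ^ (K.cone S).card ≤ N := by
  classical
  set h := K.ellOne with hh
  have h1 : 1 ≤ h := Circuit.one_le_ellOne K hn
  have hn' : (1 : ℝ) ≤ n := by exact_mod_cast hn
  have hmin : 0 < min δ 1 := lt_min hδ one_pos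
  have hν2n : 2 * (n : ℝ) ≤ ν := by
    rw [hν, le_div_iff₀ hmin]
    exact mul_le_of_le_one_right (by positivity) (min_le_right _ _)
  have hν2 : 2 ≤ ν := by linarith
  have hν1 : 1 ≤ ν := by linarith
  -- The cutoff is the first to succeed: `δ 2 ^ (p - 1) < n` unless `p = 0`.
  have hpν : (2 : ℝ) ^ p ≤ ν := by
    cases p with
    | zero => simpa using hν1
    | succ p =>
      have h2 := hp p (Nat.lt_succ_self p)
      rw [hν, le_div_iff₀ hmin, pow_succ]
      calc (2 : ℝ) ^ p * 2 * min δ 1 ≤ 2 ^ p * 2 * δ := by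
            gcongr
            exact min_le_left _ _
        _ = 2 * (δ * 2 ^ p) := by ring
        _ ≤ 2 * n := by linarith
  have hpν' : (2 : ℝ) ^ (p + 1) ≤ ν ^ 2 := by
    rw [pow_succ, pow_two]
    exact mul_le_mul hpν hν2 (by norm_num) (by linarith)
  have hle : ∀ {x : ℕ}, (x : ℝ) ≤ ν ^ (5 * h) → x ≤ N := fun hx => by
    rw [hN]; exact Nat.le_floor hx
  refine ⟨hle ?_, fun L hL hL' => hle ?_, fun S hS => hle ?_⟩
  · have h2 : ((p + 1 : ℕ) : ℝ) ≤ 2 ^ p := by exact_mod_cast Nat.lt_two_pow_self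
    exact (h2.trans hpν).trans (le_self_pow₀ hν1 (by omega))
  -- Layout neighbourhoods have at most `h²` elements, and `4h² ≤ 2 ^ (2h)` turns the count into a
  -- power of `2 ^ (p + 1) ≤ ν²`. This gives `ν ^ (4h)`; the factor `n` and the empty set account
  -- for one more power of `ν`, hence the exponent `5h`.
  · have h2 : L.length ≤ n * (4 * (h * h)) ^ (p + 1) + 1 := by
      have h3 := card_grown_le (a := K.Adj) (D := h * h) (Nat.mul_pos h1 h1)
        (fun x => ⟨x, K.mem_future_self x, K.mem_future_self x⟩) (fun v => by
          have : nbhd K.Adj {v} = Finset.univ.filter fun k => K.Adj v k := by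
            ext k; simp [mem_nbhd]
          rw [this]
          exact K.card_adj_le v) (p + 1)
      rw [Fintype.card_fin] at h3
      rw [← List.toFinset_card_of_nodup hL]
      refine (Finset.card_le_card fun S hS => ?_).trans h3
      simpa using hL' S (List.mem_toFinset.1 hS)
    have h3 : ((4 * (h * h) : ℕ) : ℝ) ^ (p + 1) ≤ ν ^ (4 * h) := by
      calc ((4 * (h * h) : ℕ) : ℝ) ^ (p + 1) ≤ ((2 : ℝ) ^ (2 * h)) ^ (p + 1) := by
            gcongr
            exact_mod_cast four_mul_mul_self_le h1
        _ = ((2 : ℝ) ^ (p + 1)) ^ (2 * h) := by rw [← pow_mul, ← pow_mul, mul_comm]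
        _ ≤ (ν ^ 2) ^ (2 * h) := by gcongr
        _ = ν ^ (4 * h) := by rw [← pow_mul]; ring_nf
    have h4 : 1 ≤ ν ^ (4 * h) := one_le_pow₀ hν1
    calc (L.length : ℝ) ≤ n * ((4 * (h * h) : ℕ) : ℝ) ^ (p + 1) + 1 := by exact_mod_cast h2
      _ ≤ n * ν ^ (4 * h) + n * ν ^ (4 * h) := by
        refine add_le_add (mul_le_mul_of_nonneg_left h3 (by positivity)) ?_
        exact one_le_mul_of_one_le_of_one_le hn' h4
      _ = 2 * n * ν ^ (4 * h) := by ring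
      _ ≤ ν * ν ^ (4 * h) := by gcongr
      _ = ν ^ (4 * h + 1) := by ring
      _ ≤ ν ^ (5 * h) := pow_le_pow_right₀ hν1 (by omega)
  · push_cast
    calc (2 : ℝ) ^ (K.cone S).card ≤ 2 ^ ((p + 1) * h) :=
          pow_le_pow_right₀ one_le_two ((K.card_cone_le S).trans (Nat.mul_le_mul_right _ hS))
      _ = (2 ^ (p + 1)) ^ h := pow_mul _ _ _
      _ ≤ (ν ^ 2) ^ h := by gcongr
      _ = ν ^ (2 * h) := by rw [← pow_mul]
      _ ≤ ν ^ (5 * h) := pow_le_pow_right₀ hν1 (by omega)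

/-- With `y` in the role of the degree bound, this is the convergence condition of the cluster
expansion; it follows from `16 ≤ 60` and `β x ≥ 1`. -/
theorem perturbation_bounds {β x y : ℝ} (hβ : 1 < β) (hx : 1 ≤ x) (hy : 1 ≤ y) :
    0 ≤ 1 / (60 * β * x * y) ∧ 16 * y * (1 / (60 * β * x * y)) ≤ 1 := by
  have hβ0 : 0 < β := by linarith
  refine ⟨by positivity, ?_⟩
  rw [mul_one_div, div_le_one (by positivity)]
  have h : 1 ≤ β * x := one_le_mul_of_one_le_of_one_le hβ.le hx
  calc 16 * y ≤ 60 * y := by gcongr; norm_num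
    _ ≤ 60 * y * (β * x) := le_mul_of_one_le_right (by positivity) h
    _ = 60 * β * x * y := by ring

theorem exists_weight_factors (hn : 1 ≤ n) (K : Circuit n) (O : Fin n → Matrix Bool Bool ℂ) {β : ℝ}
    (hβ : 1 < β)
    (hO : ∀ j, ‖Matrix.toEuclideanCLM (n := Bool) (𝕜 := ℂ) (O j - 1)‖ ≤
      1 / (60 * β * (ell K.toOp 1 : ℝ) * (ell K.toOp 4 : ℝ))) :
    ∃ E : Finset (Fin n) → ℂ, (∀ S, E S ≠ 0) ∧
      (∀ T, meanValue K.toOp (partialTensor O T) = ∏ S ∈ T.powerset, E S) ∧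
      (∀ S, ¬ Grown K.Adj S → E S = 1) ∧
      ∀ (k : ℕ) (δ : ℝ), n ≤ δ * 2 ^ k → ∀ s : Finset (Finset (Fin n)),
        (∀ S, S ∈ s ↔ Grown K.Adj S ∧ S.card ≤ k) →
        LogClose (meanValue K.toOp (tensor O)) (∏ S ∈ s, E S) δ := by
  classical
  have hU := Circuit.toOp_mem_unitaryGroup K
  have h1 : (1 : ℝ) ≤ ell K.toOp 1 := by exact_mod_cast one_le_ell hn _ _
  have h4 : (1 : ℝ) ≤ ell K.toOp 4 := by exact_mod_cast one_le_ell hn _ _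
  have hε := perturbation_bounds hβ h1 h4
  have hpart : ∀ T, partition (weight K.toOp O) T = meanValue K.toOp (partialTensor O T) :=
    fun T => (meanValue_partialTensor _ O T).symm
  obtain ⟨E, hE, hprod, hE1, hclose⟩ := exists_factors (w := weight K.toOp O)
    (a := ConeAdj K.toOp) (a' := K.Adj) (D := ell K.toOp 4) (one_le_ell hn _ _)
    (fun x => ⟨x, mem_lightcone_self _ x, mem_lightcone_self _ x⟩)
    (fun v => by
      have : nbhd (ConeAdj K.toOp) {v} = Finset.univ.filter fun k => ConeAdj K.toOp v k := by
        ext k; simp [mem_nbhd]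
      rw [this]
      exact card_coneAdj_le hU v)
    (weight_empty hU O) (fun A B h => weight_union_of_not_coneAdj hU O h)
    hε.1 hε.2 (norm_weight_le hU O hO)
    (fun x => ⟨x, K.mem_future_self x, K.mem_future_self x⟩)
    (fun A B h => weight_union_of_not_adj K O h)
  refine ⟨E, hE, fun T => by rw [← hpart, hprod], hE1, fun k δ hk s hs => ?_⟩
  rw [← partialTensor_univ, ← hpart]
  exact hclose k δ (by rwa [Fintype.card_fin]) s hs

/-- As `ν ≥ 2`, the program length is at most `ν ^ size` and `N + 1` at most `ν ^ (6h)`. Both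
constants move into the exponent, so no prefactor is left besides `m + 1`. -/
theorem bound_mainCmd_le {h m : ℕ} (hh : 1 ≤ h) {ν : ℝ} (hν : 2 ≤ ν)
    (hN : N = ⌊ν ^ (5 * h)⌋₊) :
    (mainCmd.bound N m : ℝ) ≤ (m + 1) * ν ^ ((mainCmd.size + 6 * mainCmd.depth false) * h) := by
  have hν1 : 1 ≤ ν := by linarith
  have hN1 : (N + 1 : ℝ) ≤ ν ^ (6 * h) := by
    have h1 : (N : ℝ) ≤ ν ^ (5 * h) := by
      rw [hN]; exact Nat.floor_le (by positivity)
    have h2 : 1 ≤ ν ^ (5 * h) := one_le_pow₀ hν1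
    calc (N + 1 : ℝ) ≤ 2 * ν ^ (5 * h) := by linarith
      _ ≤ ν * ν ^ (5 * h) := by gcongr
      _ = ν ^ (5 * h + 1) := by ring
      _ ≤ ν ^ (6 * h) := pow_le_pow_right₀ hν1 (by omega)
  have hsize : (mainCmd.size : ℝ) ≤ ν ^ (mainCmd.size * h) := by
    calc (mainCmd.size : ℝ) ≤ 2 ^ mainCmd.size := by exact_mod_cast Nat.lt_two_pow_self.le
      _ ≤ ν ^ mainCmd.size := by gcongr
      _ ≤ ν ^ (mainCmd.size * h) := pow_le_pow_right₀ hν1 (Nat.le_mul_of_pos_right _ hh)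
  have hd : mainCmd.depth true = 1 := rfl
  have h1 := Cmd.bound_le N m mainCmd
  rw [hd, pow_one] at h1
  calc (mainCmd.bound N m : ℝ)
      ≤ mainCmd.size * ((N + 1 : ℝ) ^ mainCmd.depth false * (m + 1)) := by exact_mod_cast h1
    _ ≤ ν ^ (mainCmd.size * h) * ((ν ^ (6 * h)) ^ mainCmd.depth false * (m + 1)) := by gcongr
    _ = (m + 1) * ν ^ ((mainCmd.size + 6 * mainCmd.depth false) * h) := by
      rw [← pow_mul, show (mainCmd.size + 6 * mainCmd.depth false) * h =
        mainCmd.size * h + 6 * h * mainCmd.depth false by ring, pow_add]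
      generalize mainCmd.size = x
      generalize mainCmd.depth false = y
      ring

end Main

end MeanValue

end

theorem theorem1 (β : ℝ) (hβ : 1 < β) :
    ∃ (P : MeanValue.Prog) (C : ℕ),
      ∀ (n : ℕ) (_ : 1 ≤ n) (K : MeanValue.Circuit n)
        (O : Fin n → Matrix Bool Bool ℂ) (δ : ℝ) (_ : 0 < δ),
        (∀ j, ‖Matrix.toEuclideanCLM (n := Bool) (𝕜 := ℂ) (O j - 1)‖ ≤
          1 / (60 * β * (MeanValue.ell K.toOp 1 : ℝ) * (MeanValue.ell K.toOp 4 : ℝ))) →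
        ∃ (t : ℕ) (s : MeanValue.Mem),
          MeanValue.Exec P (MeanValue.initMem K O δ) t s ∧
          (t : ℝ) ≤ (K.length + 1 : ℝ) * (2 * n / min δ 1) ^ (C * K.ellOne) ∧
          MeanValue.LogClose
            (MeanValue.meanValue K.toOp (MeanValue.tensor O)) s.output δ := by
  open MeanValue in
  refine ⟨mainCmd.toProg, mainCmd.size + 6 * mainCmd.depth false, fun n hn K O δ hδ hO => ?_⟩
  obtain ⟨E, hE, hprod, hE1, hclose⟩ := MeanValue.exists_weight_factors hn K O hβ hO
  have hn' : (1 : ℝ) ≤ n := by exact_mod_cast hn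
  have hmin : 0 < min δ 1 := lt_min hδ one_pos
  have hν2n : 2 * (n : ℝ) ≤ 2 * n / min δ 1 := by
    rw [le_div_iff₀ hmin]
    exact mul_le_of_le_one_right (by positivity) (min_le_right _ _)
  have hν2 : 2 ≤ 2 * (n : ℝ) / min δ 1 := by linarith
  have hh := MeanValue.Circuit.one_le_ellOne K hn
  have hνpow : 2 * (n : ℝ) / min δ 1 ≤ (2 * n / min δ 1) ^ (5 * K.ellOne) :=
    le_self_pow₀ (by linarith) (by omega)
  -- If level `p` still fails, the bounds apply to `p + 1`, since all lower levels fail as well.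
  have hlevel : ∀ p : ℕ, δ * 2 ^ p < n → p < ⌊(2 * (n : ℝ) / min δ 1) ^ (5 * K.ellOne)⌋₊ := by
    intro p hp
    have h := (MeanValue.loop_bounds (K := K) (p := p + 1) hn hδ rfl (fun i hi => ?_) rfl).1
    · exact (Nat.lt_succ_self p).trans_le ((Nat.le_succ _).trans h)
    · refine lt_of_le_of_lt ?_ hp
      gcongr
      · exact one_le_two
      · exact Nat.lt_succ_iff.1 hi
  obtain ⟨t, s, hexec, ht, -, k, u, hk, hu, hout⟩ := MeanValue.run_mainCmd (K := K) (O := O)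
    (δ := δ) (N := ⌊(2 * (n : ℝ) / min δ 1) ^ (5 * K.ellOne)⌋₊)
    (Nat.le_floor (by linarith)) hlevel
    (fun p hp => MeanValue.loop_bounds hn hδ rfl hp rfl) hE hE1 hprod
  refine ⟨t, s, hexec, ?_, ?_⟩
  · exact (Nat.cast_le.2 ht).trans (MeanValue.bound_mainCmd_le hh hν2 rfl)
  · rw [hout]
    -- The sets have size up to `k + 1`, while `n ≤ δ 2 ^ k` is known; the larger cutoff only
    -- weakens the requirement.
    refine hclose (k + 1) δ (hk.trans ?_) u hu
    gcongr
    · exact one_le_two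
    · exact Nat.le_succ k
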